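/- Let $\zeta$ be the Riemann zeta function and $\Lambda$ the von Mangoldt function. For $t>0$ not the ordinate of a zero of $\zeta$, let $S(t)=\frac1\pi\arg\zeta(\frac12+it)$, where the argument is obtained by continuous variation along the straight line segments joining $2$, $2+it$ and $\frac12+it$, starting from $\arg\zeta(2)=0$; if $t>0$ is the ordinate of a zero, let $S(t)=\frac12\lim_{\varepsilon\to0}\{S(t+\varepsilon)+S(t-\varepsilon)\}$. Put $S_0=S$ and, for $n\ge1$ and $t>0$, $S_n(t)=\int_0^tS_{n-1}(\tau)\,d\tau+\delta_n$, where for $k\ge 1$ $$\delta_{2k-1}=\frac{(-1)^{k-1}}{\pi}\int_{1/2}^\infty\int_{\sigma_{2k-2}}^\infty\cdots\int_{\sigma_1}^\infty\log|\zeta(\sigma_0)|\,d\sigma_0\,d\sigma_1\cdots d\sigma_{2k-2},$$ $$\delta_{2k}=(-1)^{k-1}\int_{1/2}^1\int_{\sigma_{2k-1}}^1\cdots\int_{\sigma_1}^1d\sigma_0\,d\sigma_1\cdots d\sigma_{2k-1}=\frac{(-1)^{k-1}}{(2k)!\,2^{2k}}.$$ For an integer $n\ge1$ and $0<u\le1$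 define $$f_n(u)=\frac{u^{n+1}}{n!}\int_0^\infty y^n\,\frac{2\sinh(y(1-u))}{e^y+(-1)^{n+1}e^{-y}}\,dy,\qquad g_n(u)=\frac{1-f_n(u)}{u^{n+1}},$$ $$A_n=\int_0^1\alpha\,g_n(\alpha)^2\,d\alpha,\qquad C_n=\sum_{m=2}^\infty\frac{\Lambda(m)^2}{m(\log m)^{2n+2}},$$ and, for $x\ge4$, $t\geq 1$ and $T\ge3$, $$I_{3,n}(x,t)=\frac1\pi\sum_{2\le m\le x}\operatorname{Im}\{i^nm^{-it}\}\,\frac{\Lambda(m)}{\sqrt m(\log m)^{n+1}}\,f_n\Big(\frac{\log m}{\log x}\Big),$$ $$H_n(x,T)=2\int_1^TS_n(t)\,I_{3,n}(x,t)\,dt,\qquad G_n(x,T)=\int_1^T|I_{3,n}(x,t)|^2\,dt.$$ Assume the Riemann Hypothesis, and let $n\ge1$ be a fixed integer and $0<\beta<\frac12$ a fixed real number. Then, as $T\to\infty$, $$H_n(T^\beta,T)-G_n(T^\beta,T)=\frac{T}{2\pi^2}\,C_n-\frac{T}{2\pi^2\beta^{2n}(\log T)^{2n}}\Big[A_n+\frac1{2n}\Big]+O\Big(\frac{T}{(\log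 T)^{2n+1}}\Big),$$ where the implied constant may depend on $n$ and $\beta$. -/

import Mathlib

noncomputable section

namespace ZetaSn

open MeasureTheory Filter Topology

/-- `a` is the argument of `ζ(1/2 + it)` obtained by continuous variation along the straight line
segments joining `2`, `2 + it` and `1/2 + it`, starting from `arg ζ(2) = 0` (for `t > 0`). The
function `θ` is the argument on the vertical segment, `φ` the one on the horizontal segment. -/
def IsArgAlongPath (t a : ℝ) : Prop :=
  ∃ θ φ : ℝ → ℝ,
    ContinuousOn θ (Set.Icc 0 t) ∧
    ContinuousOn φ (Set.Icc (1 / 2) 2) ∧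
    θ 0 = 0 ∧
    (∀ u ∈ Set.Icc (0 : ℝ) t,
      riemannZeta (2 + u * Complex.I) =
        ‖riemannZeta (2 + u * Complex.I)‖ * Complex.exp (θ u * Complex.I)) ∧
    φ 2 = θ t ∧
    (∀ σ ∈ Set.Icc (1 / 2 : ℝ) 2,
      riemannZeta (σ + t * Complex.I) =
        ‖riemannZeta (σ + t * Complex.I)‖ * Complex.exp (φ σ * Complex.I)) ∧
    φ (1 / 2) = a

/-- The value `arg ζ(1/2 + it)`. It exists and is unique when `t > 0` is not the ordinate of a
zero of `ζ`. -/
def argZeta (t : ℝ) : ℝ := Classical.epsilon (IsArgAlongPath t)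

/-- `t` is the ordinate of a zero of `ζ`. -/
def IsOrdinate (t : ℝ) : Prop := ∃ σ : ℝ, riemannZeta (σ + t * Complex.I) = 0

open Classical in
/-- The argument function `S(t)`, for `t > 0`. At the ordinate of a zero it is the mean of the
one-sided limits; points close to an ordinate are not ordinates themselves, so there `S` is
`arg ζ / π`. -/
def S (t : ℝ) : ℝ :=
  if IsOrdinate t then
    1 / 2 * limUnder (𝓝[≠] (0 : ℝ))
      (fun ε : ℝ => 1 / Real.pi * argZeta (t + ε) + 1 / Real.pi * argZeta (t - ε))
  else 1 / Real.pi * argZeta t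

/-- `j`-fold iterated integral
`∫_{σ}^∞ ∫_{σ_{j-1}}^∞ ⋯ ∫_{σ_1}^∞ log |ζ(σ_0)| dσ_0 ⋯ dσ_{j-1}`. -/
def iterLogZeta : ℕ → ℝ → ℝ
  | 0, σ => Real.log ‖riemannZeta σ‖
  | j + 1, σ => ∫ u in Set.Ioi σ, iterLogZeta j u

/-- `j`-fold iterated integral `∫_{σ}^1 ∫_{σ_{j-1}}^1 ⋯ ∫_{σ_1}^1 dσ_0 ⋯ dσ_{j-1}`. -/
def iterOne : ℕ → ℝ → ℝ
  | 0, _ => 1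
  | j + 1, σ => ∫ u in σ..1, iterOne j u

/-- The constants `δ_n`, `n ≥ 1`. The exponent `(n - 1) / 2` (rounded down) is `k - 1` both for
`n = 2k - 1` and for `n = 2k`. -/
def δ (n : ℕ) : ℝ :=
  if Odd n then (-1) ^ ((n - 1) / 2) / Real.pi * iterLogZeta n (1 / 2)
  else (-1) ^ ((n - 1) / 2) * iterOne n (1 / 2)

/-- The iterated antiderivatives `S_n` of `S`. -/
def Sn : ℕ → ℝ → ℝ
  | 0, t => S t
  | n + 1, t => (∫ τ in (0 : ℝ)..t, Sn n τ) + δ (n + 1)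

/-- The weight `f_n`. -/
def f (n : ℕ) (x : ℝ) : ℝ :=
  x ^ (n + 1) / (n.factorial : ℝ) *
    ∫ y in Set.Ioi (0 : ℝ),
      y ^ n * (2 * Real.sinh (y * (1 - x)) / (Real.exp y + (-1) ^ (n + 1) * Real.exp (-y)))

/-- `g_n(x) = (1 - f_n(x)) / x^{n+1}`, for `x > 0`. -/
def g (n : ℕ) (x : ℝ) : ℝ := (1 - f n x) / x ^ (n + 1)

/-- `A_n = ∫_0^1 α g_n(α)² dα`. -/
def A (n : ℕ) : ℝ := ∫ α in (0 : ℝ)..1, α * g n α ^ 2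

/-- `C_n = ∑_{m ≥ 2} Λ(m)² / (m (log m)^{2n+2})`, with the index shifted by `2`. -/
def C (n : ℕ) : ℝ :=
  ∑' k : ℕ, ArithmeticFunction.vonMangoldt (k + 2) ^ 2 /
    (((k + 2 : ℕ) : ℝ) * Real.log ((k + 2 : ℕ) : ℝ) ^ (2 * n + 2))

/-- The Dirichlet polynomial `I_{3,n}(x,t)` over the prime powers up to `x`. -/
def I₃ (n : ℕ) (x t : ℝ) : ℝ :=
  1 / Real.pi * ∑ m ∈ Finset.Icc 2 ⌊x⌋₊,
    (Complex.I ^ n * (m : ℂ) ^ (-(Complex.I * t))).im *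
      (ArithmeticFunction.vonMangoldt m / (Real.sqrt m * Real.log m ^ (n + 1))) *
      f n (Real.log m / Real.log x)

/-- `H_n(x,T) = 2 ∫_1^T S_n(t) I_{3,n}(x,t) dt`. -/
def H (n : ℕ) (x T : ℝ) : ℝ := 2 * ∫ t in (1 : ℝ)..T, Sn n t * I₃ n x t

/-- `G_n(x,T) = ∫_1^T |I_{3,n}(x,t)|² dt`. -/
def G (n : ℕ) (x T : ℝ) : ℝ := ∫ t in (1 : ℝ)..T, |I₃ n x t| ^ 2

end ZetaSn

end

/-!
Under the Riemann Hypothesis `(s - 1) ζ(s)` has a holomorphic logarithm on `Re s > 1/2`, hence so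
has `ζ` on the part of this half-plane above the real axis. The argument `π S(t)` is its imaginary
part on the critical line, and `π S_n(t)` is the imaginary part of `i ^ n` times its `n`-fold
integral along horizontal rays, taken at `1/2 + it`. For `Re s > 1` this iterated integral is the
Dirichlet series `∑ Λ(m) (log m) ^ (-n - 1) m ^ (-s)`. Moving the line of integration from
`Re s = 1/2` to `Re s = c > 1` therefore shows that the correlation of `S_n` with the oscillation
`Im (i ^ n m ^ (-it))` over `[1, T]` is `T / 2π` times `Λ(m) (log m) ^ (-n - 1) m ^ (-1/2)`, up to
`O(m ^ (c + 1/2) log T)`. For `x = T ^ β` with `β < 1/2` one can take `c = 1 / (2β)`, and the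
accumulated errors are `O(T ^ (1/2 + β) log T)` and `O(T ^ (2β))`, both smaller than `T` by a power.

The oscillations are nearly orthogonal on `[1, T]`, so `H - G` reduces to the diagonal sum of
`Λ(m)² / (m (log m) ^ (2n + 2)) * (2 f - f²)`. Since `2 f - f² = 1 - (1 - f)²`, this is `C_n` minus
its tail and minus a sum of `(1 - f)²`; Mertens' theorem and partial summation turn these into
`1 / (2n)` and `A_n`.
-/

noncomputable section

namespace ZetaSn

open MeasureTheory Filter Topology
open ArithmeticFunction (vonMangoldt)

/-! ### The weights `f` and `g` -/

/-- Twice `cosh a` for odd `n` and twice `sinh a` for even `n`: the two shapes which the denominator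
in the definition of `f n` takes. -/
def twoHyp (n : ℕ) (a : ℝ) : ℝ := Real.exp a + (-1) ^ (n + 1) * Real.exp (-a)

lemma monotoneOn_twoHyp (n : ℕ) : MonotoneOn (twoHyp n) (Set.Ici 0) := by
  intro a ha b hb hab
  rw [Set.mem_Ici] at ha hb
  unfold twoHyp
  rcases neg_one_pow_eq_or ℝ (n + 1) with h | h <;> rw [h]
  · have hcosh := Real.cosh_le_cosh.mpr (by rwa [abs_of_nonneg ha, abs_of_nonneg hb] : |a| ≤ |b|)
    rw [Real.cosh_eq, Real.cosh_eq] at hcosh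
    linarith
  · have hpos : Real.exp a ≤ Real.exp b := Real.exp_le_exp.mpr hab
    have hneg : Real.exp (-b) ≤ Real.exp (-a) := Real.exp_le_exp.mpr (by linarith)
    linarith

lemma twoHyp_pos (n : ℕ) {a : ℝ} (ha : 0 < a) : 0 < twoHyp n a := by
  have hlt : Real.exp (-a) < Real.exp a := Real.exp_lt_exp.mpr (by linarith)
  have hpos := Real.exp_pos (-a)
  unfold twoHyp
  rcases neg_one_pow_eq_or ℝ (n + 1) with h | h <;> rw [h] <;> linarith

lemma twoHyp_nonneg (n : ℕ) {a : ℝ} (ha : 0 ≤ a) : 0 ≤ twoHyp n a := by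
  have hle : Real.exp (-a) ≤ Real.exp a := Real.exp_le_exp.mpr (by linarith)
  have hpos := Real.exp_pos (-a)
  unfold twoHyp
  rcases neg_one_pow_eq_or ℝ (n + 1) with h | h <;> rw [h] <;> linarith

/-- The quotient `cosh (y u) / cosh y` for odd `n` and `sinh (y u) / sinh y` for even `n`. It
measures how far `f n u` is from `1`, see `g_eq_integral`. -/
def hypRatio (n : ℕ) (u y : ℝ) : ℝ := twoHyp n (y * u) / twoHyp n y

lemma hypRatio_mono (n : ℕ) {u v y : ℝ} (hy : 0 < y) (hu : 0 ≤ u) (huv : u ≤ v) :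
    hypRatio n u y ≤ hypRatio n v y := by
  have hden := twoHyp_pos n hy
  unfold hypRatio
  gcongr ?_ / _
  exact monotoneOn_twoHyp n (mul_nonneg hy.le hu) (mul_nonneg hy.le (hu.trans huv)) (by gcongr)

lemma hypRatio_nonneg (n : ℕ) {u y : ℝ} (hy : 0 < y) (hu : 0 ≤ u) : 0 ≤ hypRatio n u y :=
  div_nonneg (twoHyp_nonneg n (by positivity)) (twoHyp_pos n hy).le

lemma hypRatio_le_one (n : ℕ) {u y : ℝ} (hy : 0 < y) (hu : 0 ≤ u) (hu1 : u ≤ 1) :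
    hypRatio n u y ≤ 1 := by
  refine (hypRatio_mono n hy hu hu1).trans ?_
  rw [hypRatio, mul_one]
  exact div_self_le_one _

lemma integrableOn_pow_mul_exp_neg (n : ℕ) {u : ℝ} (hu : 0 < u) :
    IntegrableOn (fun y : ℝ => y ^ n * Real.exp (-(u * y))) (Set.Ioi 0) := by
  have hn : (-1 : ℝ) < n := by linarith [n.cast_nonneg (α := ℝ)]
  simpa using integrableOn_rpow_mul_exp_neg_mul_rpow (p := 1) (s := n) hn one_pos hu

lemma integral_pow_mul_exp_neg (n : ℕ) {u : ℝ} (hu : 0 < u) :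
    ∫ y in Set.Ioi (0 : ℝ), y ^ n * Real.exp (-(u * y)) = n.factorial / u ^ (n + 1) := by
  have h := Real.integral_rpow_mul_exp_neg_mul_Ioi (a := n + 1) (r := u) (by positivity) hu
  rw [Real.Gamma_nat_eq_factorial] at h
  simp only [add_sub_cancel_right, Real.rpow_natCast] at h
  rw [h, ← Nat.cast_add_one, Real.rpow_natCast, one_div, inv_pow, div_eq_inv_mul]

lemma integrableOn_hypRatio (n : ℕ) {u : ℝ} (hu : 0 ≤ u) (hu1 : u ≤ 1) :
    IntegrableOn (fun y : ℝ => y ^ n * Real.exp (-y) * hypRatio n u y) (Set.Ioi 0) := by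
  have hexp := integrableOn_pow_mul_exp_neg n one_pos
  simp only [one_mul] at hexp
  refine Integrable.mono' hexp (Measurable.aestronglyMeasurable ?_) ?_
  · unfold hypRatio twoHyp
    fun_prop
  · filter_upwards [ae_restrict_mem measurableSet_Ioi] with y (hy : 0 < y)
    rw [Real.norm_of_nonneg (mul_nonneg (by positivity) (hypRatio_nonneg n hy hu))]
    exact mul_le_of_le_one_right (by positivity) (hypRatio_le_one n hy hu hu1)

lemma two_sinh_mul_div_twoHyp (n : ℕ) (u : ℝ) {y : ℝ} (hy : 0 < y) :
    2 * Real.sinh (y * (1 - u)) / twoHyp n y =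
      Real.exp (-(u * y)) - Real.exp (-y) * hypRatio n u y := by
  have hden := (twoHyp_pos n hy).ne'
  have hadd : Real.exp (y * (1 - u)) = Real.exp y * Real.exp (-(u * y)) := by
    rw [← Real.exp_add]; ring_nf
  have hsub : Real.exp (-(y * (1 - u))) = Real.exp (-y) * Real.exp (y * u) := by
    rw [← Real.exp_add]; ring_nf
  rw [hypRatio, ← mul_div_assoc, eq_sub_iff_add_eq, ← add_div, div_eq_iff hden, Real.sinh_eq,
    hadd, hsub, mul_comm u y, twoHyp, twoHyp]
  ring

lemma f_eq_one_sub (n : ℕ) {u : ℝ} (hu : 0 < u) (hu1 : u ≤ 1) :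
    f n u = 1 - u ^ (n + 1) / n.factorial *
      ∫ y in Set.Ioi (0 : ℝ), y ^ n * Real.exp (-y) * hypRatio n u y := by
  have hsplit : ∫ y in Set.Ioi (0 : ℝ), y ^ n * (2 * Real.sinh (y * (1 - u)) / twoHyp n y) =
      ∫ y in Set.Ioi (0 : ℝ), (y ^ n * Real.exp (-(u * y)) -
        y ^ n * Real.exp (-y) * hypRatio n u y) :=
    setIntegral_congr_fun measurableSet_Ioi fun y hy => by
      rw [two_sinh_mul_div_twoHyp n u hy, mul_sub, mul_assoc]
  have hfact : (n.factorial : ℝ) ≠ 0 := by positivity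
  change u ^ (n + 1) / n.factorial *
    ∫ y in Set.Ioi (0 : ℝ), y ^ n * (2 * Real.sinh (y * (1 - u)) / twoHyp n y) = _
  rw [hsplit, integral_sub (integrableOn_pow_mul_exp_neg n hu) (integrableOn_hypRatio n hu.le hu1),
    integral_pow_mul_exp_neg n hu]
  field_simp

lemma g_eq_integral (n : ℕ) {u : ℝ} (hu : 0 < u) (hu1 : u ≤ 1) :
    g n u = (∫ y in Set.Ioi (0 : ℝ), y ^ n * Real.exp (-y) * hypRatio n u y) / n.factorial := by
  rw [g, f_eq_one_sub n hu hu1]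
  field_simp
  ring

lemma g_nonneg (n : ℕ) {u : ℝ} (hu : 0 < u) (hu1 : u ≤ 1) : 0 ≤ g n u := by
  rw [g_eq_integral n hu hu1]
  refine div_nonneg (setIntegral_nonneg measurableSet_Ioi fun y (hy : 0 < y) => ?_) (by positivity)
  exact mul_nonneg (by positivity) (hypRatio_nonneg n hy hu.le)

lemma monotoneOn_g (n : ℕ) : MonotoneOn (g n) (Set.Ioc 0 1) := by
  intro u hu v hv huv
  rw [g_eq_integral n hu.1 hu.2, g_eq_integral n hv.1 hv.2]
  gcongr ?_ / _
  refine setIntegral_mono_on (integrableOn_hypRatio n hu.1.le hu.2)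
    (integrableOn_hypRatio n hv.1.le hv.2) measurableSet_Ioi fun y (hy : 0 < y) => ?_
  exact mul_le_mul_of_nonneg_left (hypRatio_mono n hy hu.1.le huv) (by positivity)

lemma g_le_one (n : ℕ) {u : ℝ} (hu : 0 < u) (hu1 : u ≤ 1) : g n u ≤ 1 := by
  have hint := integral_pow_mul_exp_neg n one_pos
  have hexp := integrableOn_pow_mul_exp_neg n one_pos
  simp only [one_mul, one_pow, div_one] at hint hexp
  rw [g_eq_integral n hu hu1, div_le_one (by positivity), ← hint]
  refine setIntegral_mono_on (integrableOn_hypRatio n hu.le hu1) hexp measurableSet_Ioi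
    fun y (hy : 0 < y) => ?_
  exact mul_le_of_le_one_right (by positivity) (hypRatio_le_one n hy hu.le hu1)

lemma one_sub_f_eq (n : ℕ) {u : ℝ} (hu : u ≠ 0) : 1 - f n u = u ^ (n + 1) * g n u := by
  unfold g
  field_simp

lemma f_le_one (n : ℕ) {u : ℝ} (hu : 0 < u) (hu1 : u ≤ 1) : f n u ≤ 1 := by
  have := one_sub_f_eq n hu.ne'
  have := mul_nonneg (pow_nonneg hu.le (n + 1)) (g_nonneg n hu hu1)
  linarith

lemma f_nonneg (n : ℕ) {u : ℝ} (hu : 0 < u) (hu1 : u ≤ 1) : 0 ≤ f n u := by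
  have := one_sub_f_eq n hu.ne'
  have := mul_le_one₀ (pow_le_one₀ hu.le hu1 (n := n + 1)) (g_nonneg n hu hu1) (g_le_one n hu hu1)
  linarith

lemma monotoneOn_mul_g_sq (n : ℕ) : MonotoneOn (fun u => u * g n u ^ 2) (Set.Icc 0 1) := by
  intro u hu v hv huv
  simp only
  rcases hu.1.eq_or_lt with h0 | h0
  · rw [← h0, zero_mul]
    exact mul_nonneg hv.1 (sq_nonneg _)
  · have hu0 := g_nonneg n h0 hu.2
    have huv' := monotoneOn_g n ⟨h0, hu.2⟩ ⟨h0.trans_le huv, hv.2⟩ huv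
    have hv0 := hv.1
    gcongr

/-! ### Partial summation against Mertens' theorem -/

/-- The deviation of the partial sums of `c` from the logarithm. For `c m = Λ(m) / m` it is bounded
by Mertens' first theorem, and this is all that partial summation uses. -/
def logRemainder (c : ℕ → ℝ) (N : ℕ) : ℝ := ∑ m ∈ Finset.Ioc 0 N, c m - Real.log N

lemma sum_vonMangoldt_mul_div (N : ℕ) :
    ∑ m ∈ Finset.Ioc 0 N, vonMangoldt m * ((N / m : ℕ) : ℝ) = Real.log N.factorial := by
  rw [← ArithmeticFunction.sum_Ioc_mul_zeta_eq_sum, ArithmeticFunction.vonMangoldt_mul_zeta]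
  simp only [ArithmeticFunction.log_apply]
  induction N with
  | zero => simp
  | succ k ih =>
    rw [Finset.sum_Ioc_succ_top (by omega), ih, Nat.factorial_succ, Nat.cast_mul,
      Real.log_mul (by positivity) (by positivity), add_comm]

lemma log_factorial_le (N : ℕ) : Real.log N.factorial ≤ N * Real.log N := by
  rw [← Real.log_pow]
  exact Real.log_le_log (by positivity) (mod_cast Nat.factorial_le_pow N)

lemma le_log_factorial {N : ℕ} (hN : N ≠ 0) : N * Real.log N - N ≤ Real.log N.factorial := by
  have hstirling := Stirling.le_log_factorial_stirling hN
  have hlogN : 0 ≤ Real.log N := Real.log_natCast_nonneg N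
  have hlogpi : 0 ≤ Real.log (2 * Real.pi) := Real.log_nonneg (by linarith [Real.pi_gt_three])
  linarith

lemma log_factorial_le_mul_sum (N : ℕ) :
    Real.log N.factorial ≤ N * ∑ m ∈ Finset.Ioc 0 N, vonMangoldt m / m := by
  rw [← sum_vonMangoldt_mul_div, Finset.mul_sum]
  refine Finset.sum_le_sum fun m _ => ?_
  have hdiv : ((N / m : ℕ) : ℝ) ≤ (N : ℝ) / m := Nat.cast_div_le
  calc vonMangoldt m * ((N / m : ℕ) : ℝ) ≤ vonMangoldt m * ((N : ℝ) / m) := by gcongr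
    _ = N * (vonMangoldt m / m) := by ring

lemma mul_sum_le_log_factorial_add (N : ℕ) :
    N * ∑ m ∈ Finset.Ioc 0 N, vonMangoldt m / m ≤
      Real.log N.factorial + (Real.log 4 + 4) * N := by
  have hpsi := Chebyshev.psi_le_const_mul_self (x := N) N.cast_nonneg
  rw [Chebyshev.psi, Nat.floor_natCast] at hpsi
  refine le_trans ?_ (add_le_add_right hpsi _)
  rw [← sum_vonMangoldt_mul_div, Finset.mul_sum, ← Finset.sum_add_distrib]
  refine Finset.sum_le_sum fun m _ => ?_
  have hdiv : (N : ℝ) / m ≤ ((N / m : ℕ) : ℝ) + 1 := by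
    rw [← Nat.floor_div_eq_div (K := ℝ)]
    exact (Nat.lt_floor_add_one _).le
  calc (N : ℝ) * (vonMangoldt m / m) = vonMangoldt m * ((N : ℝ) / m) := by ring
    _ ≤ vonMangoldt m * (((N / m : ℕ) : ℝ) + 1) := by gcongr
    _ = vonMangoldt m * ((N / m : ℕ) : ℝ) + vonMangoldt m := by ring

lemma abs_logRemainder_vonMangoldt_le {N : ℕ} (hN : 1 ≤ N) :
    |logRemainder (fun m => vonMangoldt m / m) N| ≤ Real.log 4 + 4 := by
  have hN0 : (0 : ℝ) < N := by exact_mod_cast hN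
  have hlog4 : 0 ≤ Real.log 4 := Real.log_nonneg (by norm_num)
  have hlower := (le_log_factorial (by omega : N ≠ 0)).trans (log_factorial_le_mul_sum N)
  have hupper := (mul_sum_le_log_factorial_add N).trans
    (add_le_add_left (log_factorial_le N) ((Real.log 4 + 4) * N))
  rw [logRemainder, abs_le]
  constructor
  · refine le_of_mul_le_mul_left ?_ hN0
    nlinarith
  · refine le_of_mul_le_mul_left ?_ hN0
    linarith

lemma intervalIntegrable_mul_inv_of_monotoneOn {φ : ℝ → ℝ} {a b : ℝ} (ha : 0 < a) (hab : a ≤ b)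
    (hφ : MonotoneOn φ (Set.Icc a b)) :
    IntervalIntegrable (fun y => φ y * y⁻¹) volume a b := by
  rw [← Set.uIcc_of_le hab] at hφ
  refine hφ.intervalIntegrable.mul_continuousOn (continuousOn_id.inv₀ fun y hy => ?_)
  rw [Set.uIcc_of_le hab] at hy
  exact (ha.trans_le hy.1).ne'

lemma integral_mul_inv_le_of_monotoneOn {φ : ℝ → ℝ} {a b : ℝ} (ha : 0 < a) (hab : a ≤ b)
    (hφ : MonotoneOn φ (Set.Icc a b)) :
    ∫ y in a..b, φ y * y⁻¹ ≤ φ b * (Real.log b - Real.log a) := by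
  have hb : 0 < b := ha.trans_le hab
  rw [← Real.log_div hb.ne' ha.ne', ← integral_inv_of_pos ha hb,
    ← intervalIntegral.integral_const_mul]
  refine intervalIntegral.integral_mono_on hab (intervalIntegrable_mul_inv_of_monotoneOn ha hab hφ)
    (intervalIntegrable_mul_inv_of_monotoneOn ha hab monotoneOn_const) fun y hy => ?_
  have hy0 : 0 < y := ha.trans_le hy.1
  gcongr
  exact hφ hy (Set.right_mem_Icc.mpr hab) hy.2

lemma mul_le_integral_mul_inv_of_monotoneOn {φ : ℝ → ℝ} {a b : ℝ} (ha : 0 < a) (hab : a ≤ b)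
    (hφ : MonotoneOn φ (Set.Icc a b)) :
    φ a * (Real.log b - Real.log a) ≤ ∫ y in a..b, φ y * y⁻¹ := by
  have hb : 0 < b := ha.trans_le hab
  rw [← Real.log_div hb.ne' ha.ne', ← integral_inv_of_pos ha hb,
    ← intervalIntegral.integral_const_mul]
  refine intervalIntegral.integral_mono_on hab
    (intervalIntegrable_mul_inv_of_monotoneOn ha hab monotoneOn_const)
    (intervalIntegrable_mul_inv_of_monotoneOn ha hab hφ) fun y hy => ?_
  have hy0 : 0 < y := ha.trans_le hy.1
  gcongr
  exact hφ (Set.left_mem_Icc.mpr hab) hy hy.1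

lemma log_add_one_sub_log_le_one {b : ℝ} (hb : 1 ≤ b) : Real.log (b + 1) - Real.log b ≤ 1 := by
  have hb0 : 0 < b := by linarith
  rw [← Real.log_div (by linarith) hb0.ne']
  refine (Real.log_le_sub_one_of_pos (by positivity)).trans ?_
  rwa [add_div, div_self hb0.ne', add_sub_cancel_left, div_le_one hb0]

lemma log_sub_log_floor_le_one {x : ℝ} (hx : 1 ≤ x) : Real.log x - Real.log ⌊x⌋₊ ≤ 1 := by
  have hN : (1 : ℝ) ≤ ⌊x⌋₊ := by exact_mod_cast Nat.le_floor (by exact_mod_cast hx)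
  have hlog : Real.log x ≤ Real.log (⌊x⌋₊ + 1) :=
    Real.log_le_log (by linarith) (Nat.lt_floor_add_one x).le
  linarith [log_add_one_sub_log_le_one hN]

lemma abs_log_mul_sub_integral_le {φ : ℝ → ℝ} {b : ℝ} (hb : 1 ≤ b)
    (hφ : MonotoneOn φ (Set.Icc b (b + 1))) :
    |(Real.log (b + 1) - Real.log b) * φ (b + 1) - ∫ y in b..(b + 1), φ y * y⁻¹| ≤
      φ (b + 1) - φ b := by
  have hb0 : 0 < b := by linarith
  have hb1 : b ≤ b + 1 := by linarith
  have hlower := mul_le_integral_mul_inv_of_monotoneOn hb0 hb1 hφ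
  have hupper := integral_mul_inv_le_of_monotoneOn hb0 hb1 hφ
  have : 0 ≤ Real.log (b + 1) - Real.log b := sub_nonneg.mpr (Real.log_le_log hb0 hb1)
  have hlog1 := log_add_one_sub_log_le_one hb
  have hφb : φ b ≤ φ (b + 1) := hφ (Set.left_mem_Icc.mpr hb1) (Set.right_mem_Icc.mpr hb1) hb1
  rw [abs_le]
  constructor <;> nlinarith

section PartialSummation

variable {c : ℕ → ℝ} {B : ℝ} {φ : ℝ → ℝ} {a b : ℕ}

lemma abs_sum_mul_sub_integral_sub_boundary_le (hB : ∀ N, 1 ≤ N → |logRemainder c N| ≤ B)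
    (ha : 1 ≤ a) (hab : a ≤ b) (hφ : MonotoneOn φ (Set.Icc a b)) :
    |∑ m ∈ Finset.Ioc a b, c m * φ m - (∫ y in (a : ℝ)..b, φ y * y⁻¹) -
      (logRemainder c b * φ b - logRemainder c a * φ a)| ≤ (B + 1) * (φ b - φ a) := by
  induction b, hab using Nat.le_induction with
  | base => simp
  | succ b hab ih =>
    have hb1 : (1 : ℝ) ≤ b := by exact_mod_cast ha.trans hab
    have ha0 : (0 : ℝ) < a := by exact_mod_cast ha
    have habR : (a : ℝ) ≤ b := by exact_mod_cast hab
    push_cast at hφ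
    have hφ_left : MonotoneOn φ (Set.Icc (a : ℝ) b) :=
      hφ.mono (Set.Icc_subset_Icc le_rfl (by linarith))
    have hφ_right : MonotoneOn φ (Set.Icc (b : ℝ) (b + 1)) :=
      hφ.mono (Set.Icc_subset_Icc habR le_rfl)
    have hleft := ih hφ_left
    have hright := abs_log_mul_sub_integral_le hb1 hφ_right
    have hmono : φ b ≤ φ (b + 1) := hφ_right (Set.left_mem_Icc.mpr (by linarith))
      (Set.right_mem_Icc.mpr (by linarith)) (by linarith)
    have hrem : |logRemainder c b * (φ b - φ (b + 1))| ≤ B * (φ (b + 1) - φ b) := by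
      rw [abs_mul, abs_sub_comm (φ b), abs_of_nonneg (sub_nonneg.mpr hmono)]
      exact mul_le_mul_of_nonneg_right (hB b (ha.trans hab)) (sub_nonneg.mpr hmono)
    have hsucc : logRemainder c (b + 1) =
        logRemainder c b + c (b + 1) - (Real.log (b + 1) - Real.log b) := by
      rw [logRemainder, logRemainder, Finset.sum_Ioc_succ_top (Nat.zero_le b)]
      push_cast
      ring
    rw [Finset.sum_Ioc_succ_top hab, hsucc]
    push_cast
    rw [← intervalIntegral.integral_add_adjacent_intervals
      (intervalIntegrable_mul_inv_of_monotoneOn ha0 habR hφ_left)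
      (intervalIntegrable_mul_inv_of_monotoneOn (by linarith) (by linarith) hφ_right)]
    rw [abs_le] at hleft hright hrem ⊢
    constructor <;> nlinarith

lemma abs_sum_mul_sub_integral_le_of_monotoneOn (hB : ∀ N, 1 ≤ N → |logRemainder c N| ≤ B)
    (ha : 1 ≤ a) (hab : a ≤ b) (hφ : MonotoneOn φ (Set.Icc a b)) :
    |∑ m ∈ Finset.Ioc a b, c m * φ m - ∫ y in (a : ℝ)..b, φ y * y⁻¹| ≤
      (B + 1) * (φ b - φ a) + B * (|φ a| + |φ b|) := by
  have hmain := abs_sum_mul_sub_integral_sub_boundary_le hB ha hab hφ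
  have hboundary : |logRemainder c b * φ b - logRemainder c a * φ a| ≤ B * (|φ a| + |φ b|) := by
    refine (abs_sub _ _).trans ?_
    rw [abs_mul, abs_mul, mul_add, add_comm (B * |φ a|)]
    gcongr
    exacts [hB b (ha.trans hab), hB a ha]
  rw [abs_le] at hmain hboundary ⊢
  constructor <;> linarith

lemma abs_sum_mul_sub_integral_le_of_antitoneOn (hB : ∀ N, 1 ≤ N → |logRemainder c N| ≤ B)
    (ha : 1 ≤ a) (hab : a ≤ b) (hφ : AntitoneOn φ (Set.Icc a b)) :
    |∑ m ∈ Finset.Ioc a b, c m * φ m - ∫ y in (a : ℝ)..b, φ y * y⁻¹| ≤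
      (B + 1) * (φ a - φ b) + B * (|φ a| + |φ b|) := by
  have h := abs_sum_mul_sub_integral_le_of_monotoneOn hB ha hab hφ.neg
  simp only [mul_neg, neg_mul, Finset.sum_neg_distrib, intervalIntegral.integral_neg, abs_neg,
    sub_neg_eq_add] at h
  rw [← abs_neg]
  convert h using 2 <;> ring

end PartialSummation

/-! ### Sums of squares of the von Mangoldt function -/

/-- The difference between `Λ(m) log m / m` and `Λ(m)² / m`. It is supported on proper prime
powers and summable, so that partial summation applies to `Λ(m)² / m` as well. -/
def powerDefect (m : ℕ) : ℝ := vonMangoldt m * (Real.log m - vonMangoldt m) / m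

lemma powerDefect_nonneg (m : ℕ) : 0 ≤ powerDefect m :=
  div_nonneg (mul_nonneg ArithmeticFunction.vonMangoldt_nonneg
    (sub_nonneg.mpr ArithmeticFunction.vonMangoldt_le_log)) (by positivity)

lemma powerDefect_prime_pow (p : Nat.Primes) (k : ℕ) :
    powerDefect ((p : ℕ) ^ (k + 1)) = k * Real.log p ^ 2 / (p : ℝ) ^ (k + 1) := by
  unfold powerDefect
  rw [ArithmeticFunction.vonMangoldt_apply_pow (by omega),
    ArithmeticFunction.vonMangoldt_apply_prime p.prop]
  push_cast
  rw [Real.log_pow]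
  push_cast
  ring

lemma powerDefect_prime_pow_le (p : Nat.Primes) (k : ℕ) :
    powerDefect ((p : ℕ) ^ (k + 1)) ≤ (32 * (p : ℝ) ^ (-(3 / 2) : ℝ)) * (k * (1 / 2 : ℝ) ^ k) := by
  rw [powerDefect_prime_pow]
  rcases k with - | k
  · simp
  have hp2 : (2 : ℝ) ≤ p := by exact_mod_cast p.prop.two_le
  have hp0 : (0 : ℝ) < p := by linarith
  have hlog : Real.log p ≤ 4 * (p : ℝ) ^ (1 / 4 : ℝ) := by
    have := Real.log_le_rpow_div hp0.le (show (0 : ℝ) < 1 / 4 by norm_num)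
    linarith
  have : 0 ≤ Real.log p := Real.log_nonneg (by linarith)
  have hsq : Real.log p ^ 2 ≤ 16 * (p : ℝ) ^ (1 / 2 : ℝ) := by
    calc Real.log p ^ 2 ≤ (4 * (p : ℝ) ^ (1 / 4 : ℝ)) ^ 2 := by gcongr
      _ = 16 * (p : ℝ) ^ (1 / 2 : ℝ) := by
        rw [mul_pow, ← Real.rpow_mul_natCast hp0.le]
        norm_num
  have hpk : (1 : ℝ) / (p : ℝ) ^ k ≤ (1 / 2) ^ k := by
    rw [one_div_pow]
    gcongr
  have hdec : (p : ℝ) ^ (-(3 / 2) : ℝ) = (p : ℝ) ^ (1 / 2 : ℝ) / (p : ℝ) ^ 2 := by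
    rw [← Real.rpow_natCast, ← Real.rpow_sub hp0]
    norm_num
  calc ((k + 1 : ℕ) : ℝ) * Real.log p ^ 2 / (p : ℝ) ^ (k + 1 + 1)
      = ((k + 1 : ℕ) : ℝ) * (Real.log p ^ 2 / (p : ℝ) ^ 2) * (1 / (p : ℝ) ^ k) := by
        field_simp
        ring
    _ ≤ ((k + 1 : ℕ) : ℝ) * ((16 * (p : ℝ) ^ (1 / 2 : ℝ)) / (p : ℝ) ^ 2) * (1 / 2) ^ k := by
        gcongr
    _ = _ := by
        rw [hdec]
        ring

lemma summable_powerDefect : Summable powerDefect := by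
  have hsupp : ∀ m, ¬ IsPrimePow m → powerDefect m = 0 := fun m hm => by
    simp [powerDefect, ArithmeticFunction.vonMangoldt_eq_zero_iff.mpr hm]
  have hprime : Summable fun p : Nat.Primes => 32 * (p : ℝ) ^ (-(3 / 2) : ℝ) :=
    (Nat.Primes.summable_rpow.mpr (by norm_num)).mul_left 32
  have hexponent : Summable fun k : ℕ => (k : ℝ) * (1 / 2 : ℝ) ^ k := by
    simpa using summable_pow_mul_geometric_of_norm_lt_one (R := ℝ) 1 (r := 1 / 2) (by norm_num)
  have hpairs : Summable fun pk : Nat.Primes × ℕ => powerDefect ((pk.1 : ℕ) ^ (pk.2 + 1)) :=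
    (hprime.mul_of_nonneg hexponent (fun p => by positivity)
      (fun k => by positivity)).of_nonneg_of_le
      (fun _ => powerDefect_nonneg _) (fun pk => powerDefect_prime_pow_le pk.1 pk.2)
  refine (summable_subtype_iff_indicator (s := {n | IsPrimePow n}).mp ?_).congr
    fun n => Set.indicator_apply_eq_self.mpr fun hn => hsupp n hn
  exact (Nat.Primes.prodNatEquiv.summable_iff
    (f := powerDefect ∘ Subtype.val (p := fun n => n ∈ {n | IsPrimePow n}))).mp hpairs

lemma abs_sum_powerDefect_mul_le {s : Finset ℕ} {w : ℕ → ℝ} {W : ℝ} (hW : 0 ≤ W)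
    (hw : ∀ m ∈ s, |w m| ≤ W) :
    |∑ m ∈ s, powerDefect m * w m| ≤ (∑' m, powerDefect m) * W := by
  calc |∑ m ∈ s, powerDefect m * w m| ≤ ∑ m ∈ s, powerDefect m * W := by
        refine (Finset.abs_sum_le_sum_abs _ _).trans (Finset.sum_le_sum fun m hm => ?_)
        rw [abs_mul, abs_of_nonneg (powerDefect_nonneg m)]
        exact mul_le_mul_of_nonneg_left (hw m hm) (powerDefect_nonneg m)
    _ ≤ (∑' m, powerDefect m) * W := by
        rw [← Finset.sum_mul]
        gcongr
        exact summable_powerDefect.sum_le_tsum s fun m _ => powerDefect_nonneg m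

lemma log_div_log_mem_Icc {x y : ℝ} (hy : y ∈ Set.Icc 1 x) :
    Real.log y / Real.log x ∈ Set.Icc (0 : ℝ) 1 :=
  have hlog : Real.log y ≤ Real.log x := Real.log_le_log (by linarith [hy.1]) hy.2
  have hlogy : 0 ≤ Real.log y := Real.log_nonneg hy.1
  ⟨div_nonneg hlogy (hlogy.trans hlog), div_le_one_of_le₀ hlog (hlogy.trans hlog)⟩

lemma image_log_div_log_Ioc {x : ℝ} (hx : 1 < x) :
    (fun y => Real.log y / Real.log x) '' Set.Ioc 1 x = Set.Ioc 0 1 := by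
  have hl : 0 < Real.log x := Real.log_pos hx
  ext u
  constructor
  · rintro ⟨y, hy, rfl⟩
    exact ⟨div_pos (Real.log_pos hy.1) hl, (log_div_log_mem_Icc ⟨hy.1.le, hy.2⟩).2⟩
  · intro hu
    refine ⟨Real.exp (u * Real.log x), ⟨?_, ?_⟩, ?_⟩
    · rw [Real.one_lt_exp_iff]
      exact mul_pos hu.1 hl
    · rw [← Real.le_log_iff_exp_le (by linarith)]
      exact mul_le_of_le_one_left hl.le hu.2
    · simp only [Real.log_exp]
      exact mul_div_cancel_right₀ u hl.ne'

lemma integral_comp_log_div_mul_inv (ψ : ℝ → ℝ) {x : ℝ} (hx : 1 < x) :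
    ∫ y in (1 : ℝ)..x, ψ (Real.log y / Real.log x) * y⁻¹ =
      Real.log x * ∫ α in (0 : ℝ)..1, ψ α := by
  have hl : 0 < Real.log x := Real.log_pos hx
  have hderiv : ∀ y ∈ Set.Ioc 1 x, HasDerivWithinAt (fun y => Real.log y / Real.log x)
      (y⁻¹ / Real.log x) (Set.Ioc 1 x) y := fun y hy =>
    ((Real.hasDerivAt_log (by linarith [hy.1])).div_const _).hasDerivWithinAt
  have hinj : Set.InjOn (fun y => Real.log y / Real.log x) (Set.Ioc 1 x) := fun y hy z hz h =>
    Real.log_injOn_pos (zero_lt_one.trans hy.1) (zero_lt_one.trans hz.1)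
      ((div_left_inj' hl.ne').mp h)
  rw [intervalIntegral.integral_of_le hx.le, intervalIntegral.integral_of_le zero_le_one,
    ← image_log_div_log_Ioc hx,
    integral_image_eq_integral_abs_deriv_smul measurableSet_Ioc hderiv hinj, ← integral_const_mul]
  refine setIntegral_congr_fun measurableSet_Ioc fun y hy => ?_
  have hy0 : 0 < y := by linarith [hy.1]
  simp only [smul_eq_mul]
  rw [abs_of_pos (by positivity)]
  field_simp

lemma abs_sum_mul_comp_log_div_sub_integral_le {c : ℕ → ℝ} {B : ℝ} {ψ : ℝ → ℝ} {x : ℝ}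
    (hB : ∀ N, 1 ≤ N → |logRemainder c N| ≤ B) (hψ : MonotoneOn ψ (Set.Icc 0 1)) (hψ0 : 0 ≤ ψ 0)
    (hx : 1 < x) :
    |∑ m ∈ Finset.Ioc 1 ⌊x⌋₊, c m * ψ (Real.log m / Real.log x) -
      Real.log x * ∫ α in (0 : ℝ)..1, ψ α| ≤ (3 * B + 2) * ψ 1 := by
  set φ : ℝ → ℝ := fun y => ψ (Real.log y / Real.log x)
  have hB0 : 0 ≤ B := (abs_nonneg _).trans (hB 1 le_rfl)
  have hN : 1 ≤ ⌊x⌋₊ := Nat.le_floor (by exact_mod_cast hx.le)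
  have hNR : (1 : ℝ) ≤ ⌊x⌋₊ := by exact_mod_cast hN
  have hNx : (⌊x⌋₊ : ℝ) ≤ x := Nat.floor_le (by linarith)
  have hφ : MonotoneOn φ (Set.Icc 1 x) := fun y hy z hz hyz =>
    hψ (log_div_log_mem_Icc hy) (log_div_log_mem_Icc hz)
      (div_le_div_of_nonneg_right (Real.log_le_log (by linarith [hy.1]) hyz) (Real.log_pos hx).le)
  have hφ_nonneg : ∀ y ∈ Set.Icc 1 x, 0 ≤ φ y := fun y hy => hψ0.trans
    (hψ (Set.left_mem_Icc.mpr zero_le_one) (log_div_log_mem_Icc hy) (log_div_log_mem_Icc hy).1)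
  have hφ_le : ∀ y ∈ Set.Icc 1 x, φ y ≤ ψ 1 := fun y hy =>
    hψ (log_div_log_mem_Icc hy) (Set.right_mem_Icc.mpr zero_le_one) (log_div_log_mem_Icc hy).2
  have hφ_left := hφ.mono (Set.Icc_subset_Icc le_rfl hNx)
  have hφ_right := hφ.mono (Set.Icc_subset_Icc hNR le_rfl)
  have hsum := abs_sum_mul_sub_integral_le_of_monotoneOn hB le_rfl hN
    (φ := φ) (by rwa [Nat.cast_one])
  have htail_nonneg : 0 ≤ ∫ y in (⌊x⌋₊ : ℝ)..x, φ y * y⁻¹ :=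
    intervalIntegral.integral_nonneg hNx fun y hy => mul_nonneg
      (hφ_nonneg y ⟨hNR.trans hy.1, hy.2⟩) (inv_nonneg.mpr (by linarith [hy.1]))
  have htail_le := integral_mul_inv_le_of_monotoneOn (by linarith) hNx hφ_right
  have hlog := log_sub_log_floor_le_one hx.le
  have hφ1 := hφ_nonneg 1 ⟨le_rfl, hx.le⟩
  have hφN := hφ_nonneg _ ⟨hNR, hNx⟩
  have hφN_le := hφ_le _ ⟨hNR, hNx⟩
  have hφx := hφ_nonneg x ⟨hx.le, le_rfl⟩
  have hφx_le := hφ_le x ⟨hx.le, le_rfl⟩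
  rw [Nat.cast_one, abs_of_nonneg hφ1, abs_of_nonneg hφN] at hsum
  rw [← integral_comp_log_div_mul_inv ψ hx, ← intervalIntegral.integral_add_adjacent_intervals
    (intervalIntegrable_mul_inv_of_monotoneOn one_pos hNR hφ_left)
    (intervalIntegrable_mul_inv_of_monotoneOn (by linarith) hNx hφ_right)]
  rw [abs_le] at hsum ⊢
  constructor <;> nlinarith

lemma abs_sum_vonMangoldt_sq_mul_g_sq_sub_le (n : ℕ) {x : ℝ} (hx : 1 < x) :
    |∑ m ∈ Finset.Ioc 1 ⌊x⌋₊, vonMangoldt m ^ 2 / m * g n (Real.log m / Real.log x) ^ 2 -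
      Real.log x ^ 2 * A n| ≤
      Real.log x * ((3 * (Real.log 4 + 4) + 2) * (1 * g n 1 ^ 2)) + ∑' m, powerDefect m := by
  set s := Finset.Ioc 1 ⌊x⌋₊ with hs
  set u : ℕ → ℝ := fun m => Real.log m / Real.log x with hu
  have hl : 0 < Real.log x := Real.log_pos hx
  have hdecomp : ∑ m ∈ s, vonMangoldt m ^ 2 / m * g n (u m) ^ 2 =
      Real.log x * ∑ m ∈ s, vonMangoldt m / m * (u m * g n (u m) ^ 2) -
        ∑ m ∈ s, powerDefect m * g n (u m) ^ 2 := by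
    rw [Finset.mul_sum, ← Finset.sum_sub_distrib]
    refine Finset.sum_congr rfl fun m _ => ?_
    simp only [hu, powerDefect]
    field_simp
    ring
  have hmain := abs_sum_mul_comp_log_div_sub_integral_le
    (fun N hN => abs_logRemainder_vonMangoldt_le hN) (monotoneOn_mul_g_sq n) (by simp) hx
  have hdefect : |∑ m ∈ s, powerDefect m * g n (u m) ^ 2| ≤ (∑' m, powerDefect m) * 1 := by
    refine abs_sum_powerDefect_mul_le zero_le_one fun m hm => ?_
    rw [hs, Finset.mem_Ioc] at hm
    have hm1 : (1 : ℝ) < m := by exact_mod_cast hm.1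
    have hmx : (m : ℝ) ≤ x := (Nat.le_floor_iff (by linarith)).mp hm.2
    have hu0 : 0 < u m := div_pos (Real.log_pos hm1) hl
    have hu1 : u m ≤ 1 := (log_div_log_mem_Icc ⟨hm1.le, hmx⟩).2
    rw [abs_of_nonneg (sq_nonneg _)]
    exact pow_le_one₀ (g_nonneg n hu0 hu1) (g_le_one n hu0 hu1)
  rw [mul_one] at hdefect
  have hA : ∫ α in (0 : ℝ)..1, α * g n α ^ 2 = A n := rfl
  rw [hA, abs_le] at hmain
  rw [hdecomp, abs_le]
  rw [abs_le] at hdefect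
  constructor <;> nlinarith

lemma isBigO_sum_vonMangoldt_sq_mul_g_sq (n : ℕ) :
    (fun x : ℝ => ∑ m ∈ Finset.Ioc 1 ⌊x⌋₊, vonMangoldt m ^ 2 / m *
      g n (Real.log m / Real.log x) ^ 2 - Real.log x ^ 2 * A n) =O[atTop] Real.log := by
  refine Asymptotics.IsBigO.of_bound
    ((3 * (Real.log 4 + 4) + 2) * (1 * g n 1 ^ 2) + ∑' m, powerDefect m) ?_
  filter_upwards [eventually_gt_atTop 1, Real.tendsto_log_atTop.eventually_ge_atTop 1] with x hx hl
  have hdefect : 0 ≤ ∑' m, powerDefect m := tsum_nonneg powerDefect_nonneg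
  rw [Real.norm_eq_abs, Real.norm_of_nonneg (by linarith)]
  refine (abs_sum_vonMangoldt_sq_mul_g_sq_sub_le n hx).trans ?_
  nlinarith

/-! ### The diagonal sum -/

/-- The coefficients `Λ(m) / (√m (log m)^{n+1})` of the Dirichlet polynomial `I₃ n x`, without the
smoothing weight. -/
def coeff (n m : ℕ) : ℝ := vonMangoldt m / (Real.sqrt m * Real.log m ^ (n + 1))

lemma coeff_sq (n m : ℕ) :
    coeff n m ^ 2 = vonMangoldt m ^ 2 / (m * Real.log m ^ (2 * n + 2)) := by
  rw [coeff, div_pow, mul_pow, Real.sq_sqrt m.cast_nonneg, ← pow_mul]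
  ring_nf

lemma coeff_sq_eq_sub (n : ℕ) {m : ℕ} (hm : 2 ≤ m) :
    coeff n m ^ 2 = vonMangoldt m / m * (Real.log m ^ (2 * n + 1))⁻¹ -
      powerDefect m * (Real.log m ^ (2 * n + 2))⁻¹ := by
  have hl : 0 < Real.log m := Real.log_pos (by exact_mod_cast hm)
  rw [coeff_sq, powerDefect, pow_succ _ (2 * n + 1)]
  field_simp
  ring

lemma integral_inv_log_pow_mul_inv {k : ℕ} (hk : k ≠ 0) {a b : ℝ} (ha : 1 < a) (hab : a ≤ b) :
    ∫ y in a..b, (Real.log y ^ (k + 1))⁻¹ * y⁻¹ =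
      1 / (k * Real.log a ^ k) - 1 / (k * Real.log b ^ k) := by
  have hk0 : (k : ℝ) ≠ 0 := by exact_mod_cast hk
  have hpos : ∀ y ∈ Set.uIcc a b, 1 < y := fun y hy => by
    rw [Set.uIcc_of_le hab] at hy
    exact ha.trans_le hy.1
  have hderiv : ∀ y ∈ Set.uIcc a b, HasDerivAt (fun y => -(k * Real.log y ^ k)⁻¹)
      ((Real.log y ^ (k + 1))⁻¹ * y⁻¹) y := fun y hy => by
    have hl := Real.log_pos (hpos y hy)
    have hy0 : y ≠ 0 := by linarith [hpos y hy]
    refine ((((Real.hasDerivAt_log hy0).fun_pow k).const_mul (k : ℝ)).fun_inv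
      (by positivity)).fun_neg.congr_deriv ?_
    obtain ⟨j, rfl⟩ := Nat.exists_eq_succ_of_ne_zero hk
    simp only [Nat.succ_eq_add_one, Nat.add_sub_cancel]
    field_simp
    ring
  rw [intervalIntegral.integral_eq_sub_of_hasDerivAt hderiv]
  · ring
  · refine ContinuousOn.intervalIntegrable fun y hy => ContinuousAt.continuousWithinAt ?_
    have hl := Real.log_pos (hpos y hy)
    have hy0 : y ≠ 0 := by linarith [hpos y hy]
    fun_prop (disch := first | assumption | positivity)

lemma abs_sum_powerDefect_div_log_pow_le (k : ℕ) {N b : ℕ} (hN : 2 ≤ N) :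
    |∑ m ∈ Finset.Ioc N b, powerDefect m * (Real.log m ^ (k + 1))⁻¹| ≤
      (∑' m, powerDefect m) / Real.log 2 / Real.log N ^ k := by
  have hNR : (2 : ℝ) ≤ N := by exact_mod_cast hN
  have hl2 : 0 < Real.log 2 := Real.log_pos (by norm_num)
  have hlN : Real.log 2 ≤ Real.log N := Real.log_le_log (by norm_num) hNR
  have hlN0 : 0 < Real.log N := hl2.trans_le hlN
  rw [div_div, div_eq_mul_inv]
  refine abs_sum_powerDefect_mul_le (by positivity) fun m hm => ?_
  have hmN : (N : ℝ) ≤ m := by exact_mod_cast (Finset.mem_Ioc.mp hm).1.le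
  have hlm : Real.log N ≤ Real.log m := Real.log_le_log (by linarith) hmN
  have hpow : Real.log 2 * Real.log N ^ k ≤ Real.log m ^ (k + 1) := by
    rw [pow_succ']
    gcongr
    linarith
  rw [abs_of_nonneg (by have := hlN0.trans_le hlm; positivity)]
  gcongr

lemma exists_abs_sum_coeff_sq_sub_le {n : ℕ} (hn : 1 ≤ n) :
    ∃ K : ℝ, 0 ≤ K ∧ ∀ N b : ℕ, 2 ≤ N → N ≤ b →
      |∑ m ∈ Finset.Ioc N b, coeff n m ^ 2 -
        (1 / (2 * n * Real.log N ^ (2 * n)) - 1 / (2 * n * Real.log b ^ (2 * n)))| ≤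
        K / Real.log N ^ (2 * n + 1) := by
  set B : ℝ := Real.log 4 + 4
  have hB : 0 ≤ B := add_nonneg (Real.log_nonneg (by norm_num)) (by norm_num)
  have : 0 ≤ ∑' m, powerDefect m := tsum_nonneg powerDefect_nonneg
  refine ⟨3 * B + 1 + (∑' m, powerDefect m) / Real.log 2, by positivity, fun N b hN hNb => ?_⟩
  have hNR : (2 : ℝ) ≤ N := by exact_mod_cast hN
  have hNbR : (N : ℝ) ≤ b := by exact_mod_cast hNb
  have hlN : 0 < Real.log N := Real.log_pos (by linarith)
  have hlb : Real.log N ≤ Real.log b := Real.log_le_log (by linarith) hNbR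
  have hanti : AntitoneOn (fun y : ℝ => (Real.log y ^ (2 * n + 1))⁻¹) (Set.Icc N b) :=
    fun y hy z _ hyz => by
      have hly : 0 < Real.log y := Real.log_pos (by linarith [hy.1])
      have hyz' : Real.log y ≤ Real.log z := Real.log_le_log (by linarith [hy.1]) hyz
      simp only
      gcongr
  have hsum := abs_sum_mul_sub_integral_le_of_antitoneOn
    (fun N hN => abs_logRemainder_vonMangoldt_le hN) (by omega) hNb hanti
  have hdefect := abs_sum_powerDefect_div_log_pow_le (2 * n + 1) (b := b) hN
  have hinvb : 0 ≤ (Real.log b ^ (2 * n + 1))⁻¹ := by have := hlN.trans_le hlb; positivity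
  have hinvNb : (Real.log b ^ (2 * n + 1))⁻¹ ≤ (Real.log N ^ (2 * n + 1))⁻¹ := by gcongr
  rw [integral_inv_log_pow_mul_inv (by omega) (by linarith) hNbR, abs_of_nonneg hinvb,
    abs_of_nonneg (hinvb.trans hinvNb)] at hsum
  push_cast at hsum
  rw [Finset.sum_congr rfl fun m hm => coeff_sq_eq_sub n (by
    have := (Finset.mem_Ioc.mp hm).1
    omega), Finset.sum_sub_distrib, add_div, div_eq_mul_inv (3 * B + 1)]
  rw [abs_le] at hsum hdefect ⊢
  constructor <;> nlinarith

lemma coeff_eq_zero_of_lt_two (n : ℕ) {m : ℕ} (hm : m < 2) : coeff n m = 0 := by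
  interval_cases m <;> simp [coeff]

lemma sum_range_succ_coeff_sq (n N : ℕ) :
    ∑ m ∈ Finset.range (N + 1), coeff n m ^ 2 = ∑ m ∈ Finset.Ioc 1 N, coeff n m ^ 2 := by
  refine (Finset.sum_subset (fun m hm => ?_) fun m hm hm' => ?_).symm
  · simp only [Finset.mem_Ioc, Finset.mem_range] at hm ⊢
    omega
  · simp only [Finset.mem_Ioc, Finset.mem_range, not_and, not_le] at hm hm'
    rw [coeff_eq_zero_of_lt_two n (by omega), zero_pow two_ne_zero]

lemma summable_coeff_sq {n : ℕ} (hn : 1 ≤ n) : Summable fun m => coeff n m ^ 2 := by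
  obtain ⟨K, -, hK⟩ := exists_abs_sum_coeff_sq_sub_le hn
  refine summable_of_sum_range_le (c := coeff n 2 ^ 2 + (1 / (2 * n * Real.log 2 ^ (2 * n)) +
    K / Real.log 2 ^ (2 * n + 1))) (fun m => sq_nonneg _) fun b => ?_
  have hmono : ∑ m ∈ Finset.range b, coeff n m ^ 2 ≤ ∑ m ∈ Finset.range (b + 3), coeff n m ^ 2 :=
    Finset.sum_le_sum_of_subset_of_nonneg (Finset.range_subset_range.mpr (by omega))
      fun _ _ _ => sq_nonneg _
  have htail := (abs_le.mp (hK 2 (b + 2) le_rfl (by omega))).2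
  have hb : 0 ≤ 1 / (2 * n * Real.log ((b + 2 : ℕ) : ℝ) ^ (2 * n)) := by
    have := Real.log_natCast_nonneg (b + 2)
    positivity
  have hIoc : Finset.Ioc 1 2 = {2} := rfl
  rw [sum_range_succ_coeff_sq n (b + 2),
    ← Finset.sum_Ioc_consecutive _ one_le_two (by omega : 2 ≤ b + 2), hIoc,
    Finset.sum_singleton] at hmono
  push_cast at htail hb
  linarith

lemma hasSum_coeff_sq {n : ℕ} (hn : 1 ≤ n) : HasSum (fun m => coeff n m ^ 2) (C n) := by
  have hC : C n = ∑' k, coeff n (k + 2) ^ 2 := tsum_congr fun k => (coeff_sq n (k + 2)).symm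
  have hsplit := (summable_coeff_sq hn).sum_add_tsum_nat_add 2
  rw [Finset.sum_eq_zero fun m hm => by
    rw [coeff_eq_zero_of_lt_two n (Finset.mem_range.mp hm), zero_pow two_ne_zero], zero_add,
    ← hC] at hsplit
  rw [hsplit]
  exact (summable_coeff_sq hn).hasSum

lemma sum_coeff_sq_le {n : ℕ} (hn : 1 ≤ n) (s : Finset ℕ) : ∑ m ∈ s, coeff n m ^ 2 ≤ C n :=
  sum_le_hasSum s (fun _ _ => sq_nonneg _) (hasSum_coeff_sq hn)

lemma C_nonneg {n : ℕ} (hn : 1 ≤ n) : 0 ≤ C n := (hasSum_coeff_sq hn).nonneg fun _ => sq_nonneg _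

lemma exists_abs_C_sub_sum_sub_le {n : ℕ} (hn : 1 ≤ n) :
    ∃ K : ℝ, 0 ≤ K ∧ ∀ N : ℕ, 2 ≤ N →
      |C n - ∑ m ∈ Finset.Ioc 1 N, coeff n m ^ 2 - 1 / (2 * n * Real.log N ^ (2 * n))| ≤
        K / Real.log N ^ (2 * n + 1) := by
  obtain ⟨K, hK0, hK⟩ := exists_abs_sum_coeff_sq_sub_le hn
  refine ⟨K, hK0, fun N hN => ?_⟩
  have hsum : Tendsto (fun b => ∑ m ∈ Finset.Ioc 1 b, coeff n m ^ 2) atTop (𝓝 (C n)) :=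
    ((tendsto_add_atTop_iff_nat 1).mpr (hasSum_coeff_sq hn).tendsto_sum_nat).congr
      fun b => sum_range_succ_coeff_sq n b
  have hlog : Tendsto (fun b : ℕ => Real.log b ^ (2 * n)) atTop atTop :=
    (tendsto_pow_atTop (by omega)).comp (Real.tendsto_log_atTop.comp tendsto_natCast_atTop_atTop)
  have hlim := ((hsum.sub_const (∑ m ∈ Finset.Ioc 1 N, coeff n m ^ 2)).sub
    ((tendsto_const_nhds (x := 1 / (2 * n * Real.log N ^ (2 * n)))).sub
      ((tendsto_const_nhds (x := (1 : ℝ))).div_atTop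
        (hlog.const_mul_atTop (by positivity : 0 < 2 * (n : ℝ)))))).abs
  rw [sub_zero] at hlim
  refine le_of_tendsto hlim ?_
  filter_upwards [eventually_ge_atTop N] with b hb
  have htail := hK N b hN hb
  rwa [← Finset.sum_Ioc_consecutive _ (by omega : 1 ≤ N) hb, add_sub_cancel_left]

lemma inv_pow_sub_inv_pow_le {a b : ℝ} (ha : 0 < a) (hab : a ≤ b) (k : ℕ) :
    1 / a ^ k - 1 / b ^ k ≤ k * (b - a) / a ^ (k + 1) := by
  have hb : 0 < b := ha.trans_le hab
  have hbernoulli : 1 - k * ((b - a) / b) ≤ (a / b) ^ k := by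
    have h := one_add_mul_le_pow (a := a / b - 1) (by linarith [div_pos ha hb]) k
    rw [add_sub_cancel] at h
    rw [sub_div, div_self hb.ne']
    linarith
  have hdiv : (b - a) / b ≤ (b - a) / a := by
    have := sub_nonneg.mpr hab
    gcongr
  have hk : (k : ℝ) * ((b - a) / b) ≤ k * ((b - a) / a) := by gcongr
  calc 1 / a ^ k - 1 / b ^ k = 1 / a ^ k * (1 - (a / b) ^ k) := by rw [div_pow]; field_simp
    _ ≤ 1 / a ^ k * (k * ((b - a) / a)) := by gcongr; linarith
    _ = k * (b - a) / a ^ (k + 1) := by rw [pow_succ]; field_simp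

lemma eventually_log_le_two_mul_log_floor :
    ∀ᶠ x : ℝ in atTop, Real.log x ≤ 2 * Real.log ⌊x⌋₊ := by
  filter_upwards [eventually_ge_atTop 1, Real.tendsto_log_atTop.eventually_ge_atTop 2] with x hx hl
  linarith [log_sub_log_floor_le_one hx]

lemma isBigO_inv_log_floor_pow (k : ℕ) :
    (fun x : ℝ => (Real.log ⌊x⌋₊ ^ k)⁻¹) =O[atTop] fun x => (Real.log x ^ k)⁻¹ := by
  refine Asymptotics.IsBigO.inv_rev (Asymptotics.IsBigO.pow ?_ k) ?_
  · refine Asymptotics.IsBigO.of_bound 2 ?_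
    filter_upwards [eventually_log_le_two_mul_log_floor, eventually_ge_atTop 1] with x hx hx1
    rwa [Real.norm_of_nonneg (Real.log_nonneg hx1),
      Real.norm_of_nonneg (Real.log_natCast_nonneg _)]
  · filter_upwards [eventually_log_le_two_mul_log_floor, eventually_gt_atTop 1] with x _ hx1 h0
    have := Real.log_pos hx1
    exact absurd h0 (by positivity)

lemma isBigO_inv_log_floor_pow_sub (k : ℕ) :
    (fun x : ℝ => 1 / Real.log ⌊x⌋₊ ^ k - 1 / Real.log x ^ k) =O[atTop]
      fun x => (Real.log x ^ (k + 1))⁻¹ := by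
  refine Asymptotics.IsBigO.trans (Asymptotics.IsBigO.of_bound k ?_)
    (isBigO_inv_log_floor_pow (k + 1))
  filter_upwards [eventually_log_le_two_mul_log_floor, eventually_gt_atTop 1] with x hx hx1
  have hl := Real.log_pos hx1
  have hlN : 0 < Real.log ⌊x⌋₊ := by linarith
  have hN : (0 : ℝ) < ⌊x⌋₊ := by
    exact_mod_cast Nat.floor_pos.mpr hx1.le
  have hle : Real.log ⌊x⌋₊ ≤ Real.log x := Real.log_le_log hN (Nat.floor_le (by linarith))
  have hanti : 1 / Real.log x ^ k ≤ 1 / Real.log ⌊x⌋₊ ^ k := by gcongr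
  rw [Real.norm_of_nonneg (sub_nonneg.mpr hanti), Real.norm_of_nonneg (by positivity),
    ← div_eq_mul_inv]
  refine (inv_pow_sub_inv_pow_le hlN hle k).trans ?_
  gcongr
  exact mul_le_of_le_one_right k.cast_nonneg (log_sub_log_floor_le_one hx1.le)

lemma isBigO_C_sub_sum {n : ℕ} (hn : 1 ≤ n) :
    (fun x : ℝ => C n - ∑ m ∈ Finset.Ioc 1 ⌊x⌋₊, coeff n m ^ 2 -
      1 / (2 * n) / Real.log x ^ (2 * n)) =O[atTop] fun x => (Real.log x ^ (2 * n + 1))⁻¹ := by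
  obtain ⟨K, -, hK⟩ := exists_abs_C_sub_sum_sub_le hn
  have hfloor : (fun x : ℝ => C n - ∑ m ∈ Finset.Ioc 1 ⌊x⌋₊, coeff n m ^ 2 -
      1 / (2 * n * Real.log ⌊x⌋₊ ^ (2 * n))) =O[atTop] fun x => (Real.log x ^ (2 * n + 1))⁻¹ := by
    refine Asymptotics.IsBigO.trans (Asymptotics.IsBigO.of_bound K ?_)
      (isBigO_inv_log_floor_pow (2 * n + 1))
    filter_upwards [eventually_ge_atTop 2] with x hx
    have := Real.log_natCast_nonneg ⌊x⌋₊
    rw [Real.norm_eq_abs, Real.norm_of_nonneg (by positivity), ← div_eq_mul_inv]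
    exact hK _ (Nat.le_floor (by exact_mod_cast hx))
  refine (hfloor.add ((isBigO_inv_log_floor_pow_sub (2 * n)).const_mul_left
    (1 / (2 * n)))).congr_left fun x => ?_
  rw [mul_sub, ← div_eq_mul_one_div (1 / (2 * (n : ℝ))), div_div _ (2 * (n : ℝ)), mul_one_div,
    div_div]
  ring

/-- The coefficient of `T / (2 π²)` in the diagonal contribution to `H n x T - G n x T`. -/
def diagonalSum (n : ℕ) (x : ℝ) : ℝ :=
  ∑ m ∈ Finset.Icc 2 ⌊x⌋₊, coeff n m ^ 2 *
    (2 * f n (Real.log m / Real.log x) - f n (Real.log m / Real.log x) ^ 2)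

lemma diagonalSum_eq (n : ℕ) {x : ℝ} (hx : 1 < x) :
    diagonalSum n x = ∑ m ∈ Finset.Ioc 1 ⌊x⌋₊, coeff n m ^ 2 -
      (∑ m ∈ Finset.Ioc 1 ⌊x⌋₊, vonMangoldt m ^ 2 / m * g n (Real.log m / Real.log x) ^ 2) /
        Real.log x ^ (2 * n + 2) := by
  have hset : Finset.Icc 2 ⌊x⌋₊ = Finset.Ioc 1 ⌊x⌋₊ := Finset.Icc_add_one_left_eq_Ioc 1 _
  have hl := Real.log_pos hx
  rw [diagonalSum, hset, Finset.sum_div, ← Finset.sum_sub_distrib]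
  refine Finset.sum_congr rfl fun m hm => ?_
  rw [Finset.mem_Ioc] at hm
  have hlm : 0 < Real.log m := Real.log_pos (by exact_mod_cast hm.1)
  have hm0 : (0 : ℝ) < m := by exact_mod_cast zero_lt_one.trans hm.1
  have hsq : 2 * f n (Real.log m / Real.log x) - f n (Real.log m / Real.log x) ^ 2 =
      1 - (1 - f n (Real.log m / Real.log x)) ^ 2 := by ring
  rw [hsq, one_sub_f_eq n (div_pos hlm hl).ne', coeff_sq, mul_pow, div_pow, div_pow, ← pow_mul,
    ← pow_mul, show (n + 1) * 2 = 2 * n + 2 by ring]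
  field_simp

lemma isBigO_diagonalSum_sub {n : ℕ} (hn : 1 ≤ n) :
    (fun x => diagonalSum n x - (C n - (A n + 1 / (2 * n)) / Real.log x ^ (2 * n))) =O[atTop]
      fun x => (Real.log x ^ (2 * n + 1))⁻¹ := by
  have hg : (fun x : ℝ => (∑ m ∈ Finset.Ioc 1 ⌊x⌋₊, vonMangoldt m ^ 2 / m *
      g n (Real.log m / Real.log x) ^ 2 - Real.log x ^ 2 * A n) * (Real.log x ^ (2 * n + 2))⁻¹)
      =O[atTop] fun x => (Real.log x ^ (2 * n + 1))⁻¹ := by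
    refine ((isBigO_sum_vonMangoldt_sq_mul_g_sq n).mul
      (Asymptotics.isBigO_refl (fun x => (Real.log x ^ (2 * n + 2))⁻¹) atTop)).congr' .rfl ?_
    filter_upwards [eventually_gt_atTop 1] with x hx
    have := (Real.log_pos hx).ne'
    rw [pow_succ _ (2 * n + 1)]
    field_simp
  refine ((isBigO_C_sub_sum hn).add hg).neg_left.congr' ?_ .rfl
  filter_upwards [eventually_gt_atTop 1] with x hx
  have := (Real.log_pos hx).ne'
  rw [diagonalSum_eq n hx, pow_add _ (2 * n) 2]
  field_simp
  ring

/-! ### Moments of the Dirichlet polynomial -/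

lemma norm_integral_exp_mul_I_le {ℓ : ℝ} (hℓ : ℓ ≠ 0) (a b : ℝ) :
    ‖∫ t in a..b, Complex.exp (ℓ * t * Complex.I)‖ ≤ 2 / |ℓ| := by
  have hc : (ℓ * Complex.I : ℂ) ≠ 0 := by simp [hℓ]
  have hcomm : ∀ t : ℝ, Complex.exp (ℓ * t * Complex.I) = Complex.exp (ℓ * Complex.I * t) :=
    fun t => by ring_nf
  have hexp : ∀ t : ℝ, ‖Complex.exp (ℓ * Complex.I * t)‖ = 1 := fun t => by
    rw [← hcomm, ← Complex.ofReal_mul, Complex.norm_exp_ofReal_mul_I]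
  simp only [hcomm]
  rw [integral_exp_mul_complex hc, norm_div, norm_mul, Complex.norm_I, mul_one,
    Complex.norm_real, Real.norm_eq_abs]
  gcongr
  refine (norm_sub_le _ _).trans ?_
  rw [hexp, hexp]
  norm_num

lemma natCast_cpow_neg_I_mul {m : ℕ} (hm : m ≠ 0) (t : ℝ) :
    (m : ℂ) ^ (-(Complex.I * t)) = Complex.exp ((-Real.log m : ℝ) * t * Complex.I) := by
  rw [Complex.cpow_def_of_ne_zero (by exact_mod_cast hm), ← Complex.natCast_log]
  congr 1
  push_cast
  ring

lemma conj_exp_ofReal_mul_mul_I (q t : ℝ) :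
    (starRingEnd ℂ) (Complex.exp (q * t * Complex.I)) =
      Complex.exp ((-q : ℝ) * t * Complex.I) := by
  rw [← Complex.exp_conj, map_mul, map_mul, Complex.conj_ofReal, Complex.conj_ofReal,
    Complex.conj_I, Complex.ofReal_neg, neg_mul, neg_mul, mul_neg]

lemma im_I_pow_mul_mul_im (n : ℕ) (a b : ℂ) :
    (Complex.I ^ n * a).im * (Complex.I ^ n * b).im =
      1 / 2 * (a * (starRingEnd ℂ) b - (-1) ^ n * (a * b)).re := by
  have hI : Complex.I ^ n * (starRingEnd ℂ) (Complex.I ^ n) = 1 := by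
    rw [Complex.mul_conj, Complex.normSq_eq_norm_sq]
    simp
  have hconj : a * (starRingEnd ℂ) b =
      Complex.I ^ n * a * (starRingEnd ℂ) (Complex.I ^ n * b) := by
    rw [map_mul]
    linear_combination -(a * (starRingEnd ℂ) b) * hI
  have hsq : (-1) ^ n * (a * b) = Complex.I ^ n * a * (Complex.I ^ n * b) := by
    rw [← Complex.I_sq, ← pow_mul]
    ring
  rw [hconj, hsq]
  simp only [Complex.sub_re, Complex.mul_re, Complex.conj_re, Complex.conj_im]
  ring

/-- The oscillating factor `Im (iⁿ m^{-it})` of the Dirichlet polynomial `I₃ n x t`. -/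
def osc (n m : ℕ) (t : ℝ) : ℝ := (Complex.I ^ n * (m : ℂ) ^ (-(Complex.I * t))).im

lemma osc_eq (n : ℕ) {m : ℕ} (hm : m ≠ 0) (t : ℝ) :
    osc n m t = (Complex.I ^ n * Complex.exp ((-Real.log m : ℝ) * t * Complex.I)).im := by
  rw [osc, natCast_cpow_neg_I_mul hm]

lemma continuous_osc (n : ℕ) {m : ℕ} (hm : m ≠ 0) : Continuous (osc n m) := by
  rw [funext (osc_eq n hm)]
  fun_prop

lemma osc_mul_osc (n : ℕ) {m k : ℕ} (hm : m ≠ 0) (hk : k ≠ 0) (t : ℝ) :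
    osc n m t * osc n k t =
      1 / 2 * (Complex.exp ((Real.log k - Real.log m : ℝ) * t * Complex.I) -
        (-1) ^ n * Complex.exp ((-(Real.log k + Real.log m) : ℝ) * t * Complex.I)).re := by
  rw [osc_eq n hm, osc_eq n hk, im_I_pow_mul_mul_im, conj_exp_ofReal_mul_mul_I, neg_neg,
    ← Complex.exp_add, ← Complex.exp_add]
  push_cast
  ring_nf

lemma integral_osc_mul_osc (n : ℕ) {m k : ℕ} (hm : m ≠ 0) (hk : k ≠ 0) (a b : ℝ) :
    ∫ t in a..b, osc n m t * osc n k t =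
      1 / 2 * ((∫ t in a..b, Complex.exp ((Real.log k - Real.log m : ℝ) * t * Complex.I)) -
        (-1) ^ n * ∫ t in a..b,
          Complex.exp ((-(Real.log k + Real.log m) : ℝ) * t * Complex.I)).re := by
  simp only [osc_mul_osc n hm hk]
  rw [intervalIntegral.integral_const_mul]
  congr 1
  have hint : ∀ ℓ : ℝ,
      IntervalIntegrable (fun t : ℝ => Complex.exp (ℓ * t * Complex.I)) volume a b :=
    fun ℓ => Continuous.intervalIntegrable (by fun_prop) _ _
  rw [← intervalIntegral.integral_const_mul, ← intervalIntegral.integral_sub (hint _)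
    ((hint _).const_mul _)]
  exact Complex.reCLM.intervalIntegral_comp_comm ((hint _).sub ((hint _).const_mul _))

lemma one_div_le_abs_log_sub_log {N m k : ℕ} (hm : m ≠ 0) (hk : k ≠ 0) (hmN : m ≤ N) (hkN : k ≤ N)
    (hmk : m ≠ k) : 1 / (N : ℝ) ≤ |Real.log k - Real.log m| := by
  wlog h : m < k generalizing m k
  · rw [abs_sub_comm]
    exact this hk hm hkN hmN hmk.symm (by omega)
  have hm0 : (0 : ℝ) < m := by positivity
  have hk0 : (0 : ℝ) < k := by positivity
  have hmk1 : (m : ℝ) + 1 ≤ k := by exact_mod_cast h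
  refine le_trans ?_ (le_abs_self _)
  have hlog : Real.log (m / k) ≤ m / k - 1 := Real.log_le_sub_one_of_pos (by positivity)
  rw [Real.log_div hm0.ne' hk0.ne'] at hlog
  calc 1 / (N : ℝ) ≤ 1 / k := by gcongr
    _ ≤ 1 - m / k := by
        rw [le_sub_iff_add_le, ← add_div, div_le_one hk0]
        linarith
    _ ≤ Real.log k - Real.log m := by linarith

lemma abs_half_re_sub_le (n : ℕ) (a b : ℂ) : |1 / 2 * (a - (-1) ^ n * b).re| ≤
    1 / 2 * (‖a‖ + ‖b‖) := by
  rw [abs_mul, abs_of_pos (by norm_num : (0 : ℝ) < 1 / 2)]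
  gcongr
  refine (Complex.abs_re_le_norm _).trans ((norm_sub_le _ _).trans ?_)
  rw [norm_mul, norm_pow, norm_neg, norm_one, one_pow, one_mul]

lemma norm_integral_exp_neg_log_add_log_le {m k : ℕ} (hm : 2 ≤ m) (hk : 2 ≤ k) (a b : ℝ) :
    ‖∫ t in a..b, Complex.exp ((-(Real.log k + Real.log m) : ℝ) * t * Complex.I)‖ ≤ 2 := by
  have hlm : Real.log 2 ≤ Real.log m := Real.log_le_log (by norm_num) (by exact_mod_cast hm)
  have hlk : Real.log 2 ≤ Real.log k := Real.log_le_log (by norm_num) (by exact_mod_cast hk)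
  have hl2 := Real.log_two_gt_d9
  refine (norm_integral_exp_mul_I_le (by linarith) a b).trans ?_
  rw [abs_neg, abs_of_pos (by linarith), div_le_iff₀ (by linarith)]
  linarith

lemma abs_integral_osc_sq_sub_le (n : ℕ) {m : ℕ} (hm : 2 ≤ m) (T : ℝ) :
    |(∫ t in (1 : ℝ)..T, osc n m t * osc n m t) - T / 2| ≤ 3 / 2 := by
  have hB := norm_integral_exp_neg_log_add_log_le hm hm 1 T
  rw [integral_osc_mul_osc n (by omega) (by omega)]
  set B := ∫ t in (1 : ℝ)..T, Complex.exp ((-(Real.log m + Real.log m) : ℝ) * t * Complex.I)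
  have hdiag : ∫ t in (1 : ℝ)..T, Complex.exp ((Real.log m - Real.log m : ℝ) * t * Complex.I) =
      ((T - 1 : ℝ) : ℂ) := by simp
  have hsub : 1 / 2 * (((T - 1 : ℝ) : ℂ) - (-1) ^ n * B).re - T / 2 =
      1 / 2 * ((-1 : ℂ) - (-1) ^ n * B).re := by
    simp only [Complex.sub_re, Complex.ofReal_re, Complex.neg_re, Complex.one_re]
    ring
  rw [hdiag, hsub]
  refine (abs_half_re_sub_le n _ _).trans ?_
  rw [norm_neg, norm_one]
  linarith

lemma abs_integral_osc_mul_osc_le (n : ℕ) {m k N : ℕ} (hm : 2 ≤ m) (hk : 2 ≤ k) (hmN : m ≤ N)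
    (hkN : k ≤ N) (hmk : m ≠ k) (a b : ℝ) :
    |∫ t in a..b, osc n m t * osc n k t| ≤ 2 * N := by
  have hN : (2 : ℝ) ≤ N := by exact_mod_cast hm.trans hmN
  have hgap := one_div_le_abs_log_sub_log (by omega) (by omega) hmN hkN hmk
  have hpos : 0 < |Real.log k - Real.log m| := lt_of_lt_of_le (by positivity) hgap
  have hsub : 2 / |Real.log k - Real.log m| ≤ 2 * N := by
    rw [div_le_iff₀ hpos]
    rw [div_le_iff₀ (by linarith)] at hgap
    linarith
  have hminus := norm_integral_exp_mul_I_le (abs_pos.mp hpos) a b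
  have hplus := norm_integral_exp_neg_log_add_log_le hm hk a b
  rw [integral_osc_mul_osc n (by omega) (by omega)]
  refine (abs_half_re_sub_le n _ _).trans ?_
  linarith

lemma abs_integral_osc_mul_osc_sub_le (n : ℕ) {m k N : ℕ} (hm : 2 ≤ m) (hk : 2 ≤ k) (hmN : m ≤ N)
    (hkN : k ≤ N) (T : ℝ) :
    |(∫ t in (1 : ℝ)..T, osc n m t * osc n k t) - if m = k then T / 2 else 0| ≤ 2 * N := by
  split_ifs with h
  · subst h
    have hN : (2 : ℝ) ≤ N := by exact_mod_cast hm.trans hmN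
    linarith [abs_integral_osc_sq_sub_le n hm T]
  · rw [sub_zero]
    exact abs_integral_osc_mul_osc_le n hm hk hmN hkN h 1 T

/-- The coefficients `Λ(m) / (√m (log m)^{n+1}) · f_n(log m / log x)` of the Dirichlet polynomial
`I₃ n x`. -/
def smoothCoeff (n : ℕ) (x : ℝ) (m : ℕ) : ℝ := coeff n m * f n (Real.log m / Real.log x)

lemma I₃_eq (n : ℕ) (x t : ℝ) :
    I₃ n x t = 1 / Real.pi * ∑ m ∈ Finset.Icc 2 ⌊x⌋₊, smoothCoeff n x m * osc n m t := by
  unfold I₃ smoothCoeff coeff osc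
  congr 1
  exact Finset.sum_congr rfl fun m _ => by ring

lemma sq_smoothCoeff_le (n : ℕ) {x : ℝ} {m : ℕ} (hm : m ∈ Finset.Icc 2 ⌊x⌋₊) :
    smoothCoeff n x m ^ 2 ≤ coeff n m ^ 2 := by
  obtain ⟨hm2, hmx⟩ := Finset.mem_Icc.mp hm
  have hx : (m : ℝ) ≤ x := (Nat.le_floor_iff' (by omega)).mp hmx
  have hm1 : (1 : ℝ) < m := by exact_mod_cast hm2
  have hu0 : 0 < Real.log m / Real.log x :=
    div_pos (Real.log_pos hm1) (Real.log_pos (hm1.trans_le hx))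
  have hu1 := (log_div_log_mem_Icc ⟨hm1.le, hx⟩).2
  rw [smoothCoeff, mul_pow]
  exact mul_le_of_le_one_right (sq_nonneg _)
    (pow_le_one₀ (f_nonneg n hu0 hu1) (f_le_one n hu0 hu1))

lemma sq_sum_abs_smoothCoeff_le {n : ℕ} (hn : 1 ≤ n) {x : ℝ} (hx : 0 ≤ x) :
    (∑ m ∈ Finset.Icc 2 ⌊x⌋₊, |smoothCoeff n x m|) ^ 2 ≤ x * C n := by
  have hcard : ((Finset.Icc 2 ⌊x⌋₊).card : ℝ) ≤ x := by
    refine le_trans ?_ (Nat.floor_le hx)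
    rw [Nat.card_Icc]
    exact_mod_cast (by omega : ⌊x⌋₊ + 1 - 2 ≤ ⌊x⌋₊)
  calc _ ≤ ((Finset.Icc 2 ⌊x⌋₊).card : ℝ) * ∑ m ∈ Finset.Icc 2 ⌊x⌋₊, |smoothCoeff n x m| ^ 2 :=
        sq_sum_le_card_mul_sum_sq
    _ ≤ x * ∑ m ∈ Finset.Icc 2 ⌊x⌋₊, coeff n m ^ 2 := by
        simp only [sq_abs]
        exact mul_le_mul hcard (Finset.sum_le_sum fun m hm => sq_smoothCoeff_le n hm)
          (Finset.sum_nonneg fun _ _ => sq_nonneg _) hx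
    _ ≤ x * C n := by
        gcongr
        exact sum_coeff_sq_le hn _

lemma G_eq_sum (n : ℕ) (x T : ℝ) :
    G n x T = 1 / Real.pi ^ 2 * ∑ m ∈ Finset.Icc 2 ⌊x⌋₊, ∑ k ∈ Finset.Icc 2 ⌊x⌋₊,
      smoothCoeff n x m * smoothCoeff n x k * ∫ t in (1 : ℝ)..T, osc n m t * osc n k t := by
  set s := Finset.Icc 2 ⌊x⌋₊
  set a := smoothCoeff n x
  have hsq : ∀ t : ℝ, |I₃ n x t| ^ 2 = 1 / Real.pi ^ 2 * ∑ m ∈ s, ∑ k ∈ s,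
      a m * a k * (osc n m t * osc n k t) := fun t => by
    rw [sq_abs, I₃_eq, mul_pow, sq (∑ m ∈ _, _), Finset.sum_mul_sum, one_div_pow]
    congr 1
    exact Finset.sum_congr rfl fun m _ => Finset.sum_congr rfl fun k _ => by ring
  have hne : ∀ m ∈ s, m ≠ 0 := fun m hm => by
    have := (Finset.mem_Icc.mp hm).1
    omega
  have hcont : ∀ m ∈ s, ∀ k ∈ s, Continuous fun t => a m * a k * (osc n m t * osc n k t) :=
    fun m hm k hk => ((continuous_osc n (hne m hm)).mul (continuous_osc n (hne k hk))).const_mul _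
  unfold G
  simp only [hsq]
  rw [intervalIntegral.integral_const_mul, intervalIntegral.integral_finsetSum fun m hm =>
    (continuous_finsetSum s fun k hk => hcont m hm k hk).intervalIntegrable _ _]
  congr 1
  refine Finset.sum_congr rfl fun m hm => ?_
  rw [intervalIntegral.integral_finsetSum fun k hk => (hcont m hm k hk).intervalIntegrable _ _]
  exact Finset.sum_congr rfl fun k _ => intervalIntegral.integral_const_mul _ _

lemma G_sub_eq_sum (n : ℕ) (x T : ℝ) :
    G n x T - T / (2 * Real.pi ^ 2) * ∑ m ∈ Finset.Icc 2 ⌊x⌋₊, smoothCoeff n x m ^ 2 =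
      1 / Real.pi ^ 2 * ∑ m ∈ Finset.Icc 2 ⌊x⌋₊, ∑ k ∈ Finset.Icc 2 ⌊x⌋₊,
        smoothCoeff n x m * smoothCoeff n x k *
          ((∫ t in (1 : ℝ)..T, osc n m t * osc n k t) - if m = k then T / 2 else 0) := by
  have hdiag : T / (2 * Real.pi ^ 2) * ∑ m ∈ Finset.Icc 2 ⌊x⌋₊, smoothCoeff n x m ^ 2 =
      1 / Real.pi ^ 2 * ∑ m ∈ Finset.Icc 2 ⌊x⌋₊, ∑ k ∈ Finset.Icc 2 ⌊x⌋₊,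
        smoothCoeff n x m * smoothCoeff n x k * if m = k then T / 2 else 0 := by
    rw [Finset.mul_sum, Finset.mul_sum]
    refine Finset.sum_congr rfl fun m hm => ?_
    simp only [mul_ite, mul_zero]
    rw [Finset.sum_ite_eq _ m, if_pos hm]
    field_simp
  rw [G_eq_sum, hdiag, ← mul_sub, ← Finset.sum_sub_distrib]
  simp only [← Finset.sum_sub_distrib, ← mul_sub]

lemma abs_G_sub_le {n : ℕ} (hn : 1 ≤ n) {x : ℝ} (hx : 0 ≤ x) (T : ℝ) :
    |G n x T - T / (2 * Real.pi ^ 2) * ∑ m ∈ Finset.Icc 2 ⌊x⌋₊, smoothCoeff n x m ^ 2| ≤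
      2 * C n * x ^ 2 := by
  set s := Finset.Icc 2 ⌊x⌋₊
  set a := smoothCoeff n x
  have hpi : 1 / Real.pi ^ 2 ≤ 1 := by
    rw [div_le_one (by positivity)]
    nlinarith [Real.pi_gt_three]
  have hsum : |∑ m ∈ s, ∑ k ∈ s, a m * a k * ((∫ t in (1 : ℝ)..T, osc n m t * osc n k t) -
      if m = k then T / 2 else 0)| ≤ (∑ m ∈ s, |a m|) ^ 2 * (2 * x) := by
    rw [sq, Finset.sum_mul_sum, Finset.sum_mul]
    refine (Finset.abs_sum_le_sum_abs _ _).trans (Finset.sum_le_sum fun m hm => ?_)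
    rw [Finset.sum_mul]
    refine (Finset.abs_sum_le_sum_abs _ _).trans (Finset.sum_le_sum fun k hk => ?_)
    obtain ⟨hm2, hmx⟩ := Finset.mem_Icc.mp hm
    obtain ⟨hk2, hkx⟩ := Finset.mem_Icc.mp hk
    rw [abs_mul, abs_mul]
    gcongr
    linarith [abs_integral_osc_mul_osc_sub_le n hm2 hk2 hmx hkx T, Nat.floor_le hx]
  rw [G_sub_eq_sum, abs_mul, abs_of_pos (by positivity)]
  calc _ ≤ 1 * ((∑ m ∈ s, |a m|) ^ 2 * (2 * x)) := by gcongr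
    _ ≤ 1 * (x * C n * (2 * x)) := by
        gcongr
        exact sq_sum_abs_smoothCoeff_le hn hx
    _ = 2 * C n * x ^ 2 := by ring

lemma H_eq_sum {n : ℕ} (x : ℝ) {T : ℝ} (hS : IntervalIntegrable (Sn n) volume 1 T) :
    H n x T = 2 / Real.pi * ∑ m ∈ Finset.Icc 2 ⌊x⌋₊,
      smoothCoeff n x m * ∫ t in (1 : ℝ)..T, Sn n t * osc n m t := by
  have hmul : ∀ t : ℝ, Sn n t * I₃ n x t = 1 / Real.pi * ∑ m ∈ Finset.Icc 2 ⌊x⌋₊,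
      smoothCoeff n x m * (Sn n t * osc n m t) := fun t => by
    rw [I₃_eq, mul_left_comm, Finset.mul_sum]
    congr 1
    exact Finset.sum_congr rfl fun m _ => by ring
  have hcont : ∀ m ∈ Finset.Icc 2 ⌊x⌋₊, Continuous (osc n m) := fun m hm =>
    continuous_osc n (by have := (Finset.mem_Icc.mp hm).1; omega)
  unfold H
  simp only [hmul]
  rw [intervalIntegral.integral_const_mul, intervalIntegral.integral_finsetSum fun m hm =>
    (hS.mul_continuousOn (hcont m hm).continuousOn).const_mul _, ← mul_assoc, mul_one_div]
  congr 1
  exact Finset.sum_congr rfl fun m _ => intervalIntegral.integral_const_mul _ _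

lemma abs_H_sub_le {n : ℕ} (hn : 1 ≤ n) {x : ℝ} (hx : 2 ≤ x) {T E : ℝ}
    (hS : IntervalIntegrable (Sn n) volume 1 T)
    (hE : ∀ m ∈ Finset.Icc 2 ⌊x⌋₊,
      |(∫ t in (1 : ℝ)..T, Sn n t * osc n m t) - T / (2 * Real.pi) * coeff n m| ≤ E) :
    |H n x T - T / (2 * Real.pi ^ 2) *
      ∑ m ∈ Finset.Icc 2 ⌊x⌋₊, 2 * (coeff n m ^ 2 * f n (Real.log m / Real.log x))| ≤
      E * Real.sqrt (x * C n) := by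
  have hE0 : 0 ≤ E := (abs_nonneg _).trans
    (hE 2 (Finset.mem_Icc.mpr ⟨le_rfl, Nat.le_floor (by exact_mod_cast hx)⟩))
  set s := Finset.Icc 2 ⌊x⌋₊
  have hmain : T / (2 * Real.pi ^ 2) *
      ∑ m ∈ s, 2 * (coeff n m ^ 2 * f n (Real.log m / Real.log x)) =
      2 / Real.pi * ∑ m ∈ s, smoothCoeff n x m * (T / (2 * Real.pi) * coeff n m) := by
    rw [Finset.mul_sum, Finset.mul_sum]
    refine Finset.sum_congr rfl fun m _ => ?_
    rw [smoothCoeff]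
    field_simp
  have hpi : 2 / Real.pi ≤ 1 := by
    rw [div_le_one Real.pi_pos]
    linarith [Real.pi_gt_three]
  have hsum : |∑ m ∈ s, smoothCoeff n x m * ((∫ t in (1 : ℝ)..T, Sn n t * osc n m t) -
      T / (2 * Real.pi) * coeff n m)| ≤ (∑ m ∈ s, |smoothCoeff n x m|) * E := by
    rw [Finset.sum_mul]
    refine (Finset.abs_sum_le_sum_abs _ _).trans (Finset.sum_le_sum fun m hm => ?_)
    rw [abs_mul]
    gcongr
    exact hE m hm
  have hsqrt : ∑ m ∈ s, |smoothCoeff n x m| ≤ Real.sqrt (x * C n) :=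
    Real.le_sqrt_of_sq_le (sq_sum_abs_smoothCoeff_le hn (by linarith))
  rw [H_eq_sum x hS, hmain, ← mul_sub, ← Finset.sum_sub_distrib]
  simp only [← mul_sub]
  rw [abs_mul, abs_of_pos (by positivity)]
  calc _ ≤ 1 * ((∑ m ∈ s, |smoothCoeff n x m|) * E) := by gcongr
    _ ≤ 1 * (Real.sqrt (x * C n) * E) := by gcongr
    _ = E * Real.sqrt (x * C n) := by ring

/-! ### Continuous logarithms -/

lemma eq_of_continuousOn_of_int_mul {X : Type*} [TopologicalSpace X] {S : Set X}
    (hS : IsPreconnected S) {φ : X → ℝ} (hφ : ContinuousOn φ S) {c : ℝ} (hc : 0 < c)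
    (hint : ∀ x ∈ S, ∃ k : ℤ, φ x = k * c) {x y : X} (hx : x ∈ S) (hy : y ∈ S) : φ x = φ y := by
  by_contra hne
  wlog hlt : φ x < φ y generalizing x y
  · exact this hy hx (Ne.symm hne) (lt_of_le_of_ne (not_lt.mp hlt) (Ne.symm hne))
  obtain ⟨k, hk⟩ := hint x hx
  obtain ⟨l, hl⟩ := hint y hy
  have hkl : (k : ℝ) + 1 ≤ l := by
    rw [hk, hl] at hlt
    exact_mod_cast Int.add_one_le_of_lt (by exact_mod_cast lt_of_mul_lt_mul_right hlt hc.le)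
  have hmid : ((k : ℝ) + 1 / 2) * c ∈ φ '' S := by
    refine (hS.image φ hφ).ordConnected.out ⟨x, hx, rfl⟩ ⟨y, hy, rfl⟩ ⟨?_, ?_⟩
    · rw [hk]
      nlinarith
    · rw [hl]
      nlinarith
  obtain ⟨z, hz, hzmid⟩ := hmid
  obtain ⟨j, hj⟩ := hint z hz
  have hjk : (j : ℝ) = k + 1 / 2 := mul_right_cancel₀ hc.ne' (hj.symm.trans hzmid)
  have hparity : 2 * j = 2 * k + 1 := by
    have : (2 * j : ℝ) = 2 * k + 1 := by linarith
    exact_mod_cast this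
  omega

lemma sub_eq_sub_of_exp_eq_exp {X : Type*} [TopologicalSpace X] {S : Set X}
    (hS : IsPreconnected S) {p q : X → ℂ} (hp : ContinuousOn p S) (hq : ContinuousOn q S)
    (hexp : ∀ x ∈ S, Complex.exp (p x) = Complex.exp (q x)) {x y : X} (hx : x ∈ S) (hy : y ∈ S) :
    p x - q x = p y - q y := by
  have hint : ∀ x ∈ S, ∃ k : ℤ, p x = q x + k * (2 * Real.pi * Complex.I) := fun x hx =>
    Complex.exp_eq_exp_iff_exists_int.mp (hexp x hx)
  have him : (p x - q x).im = (p y - q y).im := by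
    refine eq_of_continuousOn_of_int_mul hS (φ := fun x => (p x - q x).im)
      (Complex.continuous_im.comp_continuousOn (hp.sub hq)) (c := 2 * Real.pi) (by positivity)
      (fun x hx => ?_) hx hy
    obtain ⟨k, hk⟩ := hint x hx
    exact ⟨k, by simp [hk]⟩
  have hre : ∀ x ∈ S, (p x - q x).re = 0 := fun x hx => by
    obtain ⟨k, hk⟩ := hint x hx
    simp [hk]
  exact Complex.ext (by rw [hre x hx, hre y hy]) him

/-! ### The entire function `(s - 1) ζ(s)` -/

/-- The entire function `(s - 1) ζ(s)`, with the removable singularity at `s = 1` filled in. -/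
def Z : ℂ → ℂ := Function.update (fun s => (s - 1) * riemannZeta s) 1 1

lemma Z_apply {s : ℂ} (hs : s ≠ 1) : Z s = (s - 1) * riemannZeta s := Function.update_of_ne hs _ _

lemma Z_one : Z 1 = 1 := Function.update_self _ _ _

lemma differentiable_Z : Differentiable ℂ Z := by
  rw [← differentiableOn_univ,
    ← Complex.differentiableOn_compl_singleton_and_continuousAt_iff (c := 1) Filter.univ_mem]
  refine ⟨DifferentiableOn.congr (f := fun s => (s - 1) * riemannZeta s) (fun s hs => ?_)
    fun s hs => Z_apply hs.2, continuousWithinAt_compl_self.mp ?_⟩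
  · have := differentiableAt_riemannZeta hs.2
    exact DifferentiableAt.differentiableWithinAt (by fun_prop)
  · rw [ContinuousWithinAt, Z_one]
    refine riemannZeta_residue_one.congr' ?_
    filter_upwards [self_mem_nhdsWithin] with s hs
    exact (Z_apply hs).symm

lemma Z_ofReal_im (v : ℝ) : (Z v).im = 0 := by
  by_cases hv : (v : ℂ) = 1
  · rw [hv, Z_one, Complex.one_im]
  · rw [Z_apply hv, ← Complex.conj_eq_iff_im, map_mul, ← riemannZeta_conj]
    simp

/-- The fractional part, cut off to `(1, ∞)`; `Z s` is expressed by its Mellin transform. -/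
def fractTail : ℝ → ℂ := Set.indicator (Set.Ioi 1) fun t => ((Int.fract t : ℝ) : ℂ)

lemma norm_fract_le_one (t : ℝ) : ‖((Int.fract t : ℝ) : ℂ)‖ ≤ 1 := by
  rw [Complex.norm_real, Real.norm_of_nonneg (Int.fract_nonneg t)]
  exact (Int.fract_lt_one t).le

lemma norm_fractTail_le (t : ℝ) : ‖fractTail t‖ ≤ 1 :=
  (norm_indicator_le_norm_self _ _).trans (norm_fract_le_one t)

lemma measurable_fractTail : Measurable fractTail :=
  (Complex.measurable_ofReal.comp measurable_fract).indicator measurableSet_Ioi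

lemma mellin_fractTail (s : ℂ) :
    mellin fractTail (-s) =
      ∫ t in Set.Ioi (1 : ℝ), ((Int.fract t : ℝ) : ℂ) * (t : ℂ) ^ (-(s + 1)) := by
  have hindicator : ∀ t : ℝ, (t : ℂ) ^ (-s - 1) • fractTail t =
      Set.indicator (Set.Ioi 1)
        (fun t : ℝ => ((Int.fract t : ℝ) : ℂ) * (t : ℂ) ^ (-(s + 1))) t := by
    intro t
    rw [fractTail]
    by_cases ht : t ∈ Set.Ioi (1 : ℝ)
    · rw [Set.indicator_of_mem ht, Set.indicator_of_mem ht, smul_eq_mul, mul_comm]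
      ring_nf
    · rw [Set.indicator_of_notMem ht, Set.indicator_of_notMem ht, smul_zero]
  simp only [mellin, hindicator]
  rw [setIntegral_indicator measurableSet_Ioi, Set.inter_eq_right.mpr]
  exact Set.Ioi_subset_Ioi zero_le_one

lemma differentiableAt_mellin_fractTail {s : ℂ} (hs : 0 < s.re) :
    DifferentiableAt ℂ (fun s => mellin fractTail (-s)) s := by
  have hmellin : DifferentiableAt ℂ (mellin fractTail) (-s) := by
    refine mellin_differentiableAt_of_isBigO_rpow (a := 0) (b := (-s).re - 1) ?_ ?_ ?_ ?_ ?_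
    · refine LocallyIntegrable.locallyIntegrableOn ?_ _
      refine LocallyIntegrable.mono (f := fun _ : ℝ => (1 : ℝ)) (locallyIntegrable_const (1 : ℝ))
        measurable_fractTail.aestronglyMeasurable (ae_of_all _ fun t => ?_)
      simpa using norm_fractTail_le t
    · refine Asymptotics.isBigO_of_le _ fun t => ?_
      simpa using norm_fractTail_le t
    · simpa using hs
    · refine Asymptotics.IsBigO.of_bound 0 ?_
      have hIio : Set.Iio (1 : ℝ) ∈ 𝓝[>] (0 : ℝ) :=
        mem_nhdsWithin_of_mem_nhds (Iio_mem_nhds one_pos)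
      filter_upwards [hIio] with t ht
      have : t ∉ Set.Ioi (1 : ℝ) := fun h : 1 < t => lt_asymm ht h
      simp [fractTail, Set.indicator_of_notMem this]
    · linarith
  exact hmellin.comp s differentiableAt_id.neg

lemma integrableOn_fract_mul_cpow {s : ℂ} (hs : 0 < s.re) :
    IntegrableOn (fun t : ℝ => ((Int.fract t : ℝ) : ℂ) * (t : ℂ) ^ (-(s + 1))) (Set.Ioi 1) :=
  Integrable.bdd_mul (c := 1)
    (integrableOn_Ioi_cpow_of_lt (by
      simp only [Complex.neg_re, Complex.add_re, Complex.one_re]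
      linarith) one_pos)
    (Complex.measurable_ofReal.comp measurable_fract).aestronglyMeasurable
    (ae_of_all _ norm_fract_le_one)

lemma integral_floor_mul_cpow {s : ℂ} (hs : 1 < s.re) :
    ∫ t in Set.Ioi (1 : ℝ), (⌊t⌋₊ : ℂ) * (t : ℂ) ^ (-(s + 1)) =
      1 / (s - 1) - mellin fractTail (-s) := by
  have hlt : (-s).re < -1 := by rw [Complex.neg_re]; linarith
  have hpow : ∫ t in Set.Ioi (1 : ℝ), (t : ℂ) ^ (-s) = 1 / (s - 1) := by
    rw [integral_Ioi_cpow_of_lt hlt one_pos, Complex.ofReal_one, Complex.one_cpow,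
      neg_add_eq_sub, ← neg_sub s 1, neg_div_neg_eq]
  rw [mellin_fractTail, ← hpow, ← integral_sub (integrableOn_Ioi_cpow_of_lt hlt one_pos)
    (integrableOn_fract_mul_cpow (by linarith))]
  refine setIntegral_congr_fun measurableSet_Ioi fun t (ht : 1 < t) => ?_
  have ht0 : (t : ℂ) ≠ 0 := by exact_mod_cast (by linarith : t ≠ 0)
  have hfloor : (⌊t⌋₊ : ℂ) = t - (Int.fract t : ℝ) := by
    have : (⌊t⌋₊ : ℝ) = t - Int.fract t := by
      rw [natCast_floor_eq_intCast_floor (by linarith)]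
      exact (Int.self_sub_fract t).symm
    exact_mod_cast congrArg Complex.ofReal this
  rw [hfloor, sub_mul, neg_add, Complex.cpow_add _ _ ht0, Complex.cpow_neg_one]
  field_simp

lemma riemannZeta_eq_mul_integral_floor {s : ℂ} (hs : 1 < s.re) :
    riemannZeta s = s * ∫ t in Set.Ioi (1 : ℝ), (⌊t⌋₊ : ℂ) * (t : ℂ) ^ (-(s + 1)) := by
  have h := LSeries_eq_mul_integral_of_nonneg (fun _ => 1) zero_le_one (s := s) hs
    (by simpa using Asymptotics.isBigO_refl (fun n : ℕ => (n : ℝ)) atTop) (fun _ => zero_le_one)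
  simp only [Complex.ofReal_one, Finset.sum_const, Nat.card_Icc, add_tsub_cancel_right,
    nsmul_eq_mul, mul_one] at h
  rw [← LSeries_one_eq_riemannZeta hs, ← h]
  rfl

lemma Z_eq_of_one_lt_re {s : ℂ} (hs : 1 < s.re) :
    Z s = s - s * (s - 1) * mellin fractTail (-s) := by
  have hs1 : s ≠ 1 := by
    rintro rfl
    simp at hs
  have hs10 : s - 1 ≠ 0 := sub_ne_zero.mpr hs1
  rw [Z_apply hs1, riemannZeta_eq_mul_integral_floor hs, integral_floor_mul_cpow hs]
  field_simp

lemma Z_eq_of_re_pos {s : ℂ} (hs : 0 < s.re) :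
    Z s = s - s * (s - 1) * mellin fractTail (-s) := by
  have hopen : ∀ a : ℝ, IsOpen {s : ℂ | a < s.re} := fun a =>
    isOpen_lt continuous_const Complex.continuous_re
  have hZ : AnalyticOnNhd ℂ Z {s : ℂ | 0 < s.re} :=
    differentiable_Z.differentiableOn.analyticOnNhd (hopen 0)
  have hmellin : AnalyticOnNhd ℂ (fun s => s - s * (s - 1) * mellin fractTail (-s))
      {s : ℂ | 0 < s.re} := by
    refine DifferentiableOn.analyticOnNhd (fun s hs => ?_) (hopen 0)
    have := differentiableAt_mellin_fractTail hs
    exact DifferentiableAt.differentiableWithinAt (by fun_prop)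
  refine hZ.eqOn_of_preconnected_of_eventuallyEq hmellin (convex_halfSpace_re_gt 0).isPreconnected
    (z₀ := 2) (by simp) ?_ hs
  filter_upwards [(hopen 1).mem_nhds (by simp : (2 : ℂ) ∈ {s : ℂ | 1 < s.re})] with s hs
  exact Z_eq_of_one_lt_re hs

lemma norm_mellin_fractTail_le {s : ℂ} (hs : 0 < s.re) : ‖mellin fractTail (-s)‖ ≤ 1 / s.re := by
  have hlt : -(s.re + 1) < -1 := by linarith
  rw [mellin_fractTail]
  refine (norm_integral_le_of_norm_le (integrableOn_Ioi_rpow_of_lt hlt one_pos) ?_).trans_eq ?_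
  · filter_upwards [ae_restrict_mem measurableSet_Ioi] with t (ht : 1 < t)
    rw [norm_mul, Complex.norm_cpow_eq_rpow_re_of_pos (by linarith)]
    exact mul_le_of_le_one_left (by positivity) (norm_fract_le_one t)
  · rw [integral_Ioi_rpow_of_lt hlt one_pos, Real.one_rpow, show -(s.re + 1) + 1 = -s.re by ring,
      neg_div_neg_eq]

lemma norm_Z_le {s : ℂ} (hs : 1 / 2 ≤ s.re) : ‖Z s‖ ≤ 3 * (1 + ‖s‖) ^ 2 := by
  have hmellin : ‖mellin fractTail (-s)‖ ≤ 2 :=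
    (norm_mellin_fractTail_le (by linarith)).trans (by
      rw [div_le_iff₀ (by linarith)]
      linarith)
  have hsub : ‖s - 1‖ ≤ ‖s‖ + 1 := (norm_sub_le _ _).trans (by simp)
  rw [Z_eq_of_re_pos (by linarith)]
  calc ‖s - s * (s - 1) * mellin fractTail (-s)‖
      ≤ ‖s‖ + ‖s‖ * ‖s - 1‖ * ‖mellin fractTail (-s)‖ := by
        refine (norm_sub_le _ _).trans ?_
        rw [norm_mul, norm_mul]
    _ ≤ ‖s‖ + ‖s‖ * (‖s‖ + 1) * 2 := by gcongr
    _ ≤ 3 * (1 + ‖s‖) ^ 2 := by nlinarith [norm_nonneg s]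

lemma Z_ne_zero (hRH : RiemannHypothesis) {s : ℂ} (hs : 1 / 2 < s.re) : Z s ≠ 0 := by
  by_cases h1 : s = 1
  · rw [h1, Z_one]
    exact one_ne_zero
  rw [Z_apply h1]
  refine mul_ne_zero (sub_ne_zero.mpr h1) fun h0 => ?_
  have hnontrivial : ¬∃ n : ℕ, s = -2 * (n + 1) := by
    rintro ⟨n, rfl⟩
    simp only [Complex.mul_re, Complex.neg_re, Complex.re_ofNat, Complex.add_re, Complex.natCast_re,
      Complex.one_re, Complex.neg_im, Complex.im_ofNat, Complex.add_im, Complex.natCast_im,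
      Complex.one_im] at hs
    linarith [n.cast_nonneg (α := ℝ)]
  linarith [hRH s h0 hnontrivial h1]

/-! ### The logarithm of `ζ` -/

lemma exists_differentiableOn_log_of_convex {U : Set ℂ} (hU : IsOpen U) (hconv : Convex ℝ U)
    {h : ℂ → ℂ} (hd : DifferentiableOn ℂ h U) (hne : ∀ s ∈ U, h s ≠ 0) {s₀ : ℂ} (hs₀ : s₀ ∈ U) :
    ∃ F : ℂ → ℂ, DifferentiableOn ℂ F U ∧ (∀ s ∈ U, Complex.exp (F s) = h s) ∧
      F s₀ = Complex.log (h s₀) := by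
  obtain ⟨P, hP⟩ := hconv.exists_forall_hasDerivWithinAt ((hd.deriv hU).div hd hne)
  set F : ℂ → ℂ := fun s => P s - P s₀ + Complex.log (h s₀)
  have hF : ∀ s ∈ U, HasDerivAt F (deriv h s / h s) s := fun s hs =>
    (((hP s hs).hasDerivAt (hU.mem_nhds hs)).sub_const _).add_const _
  have hF₀ : F s₀ = Complex.log (h s₀) := by simp [F]
  have hquot : ∀ s ∈ U, HasDerivAt (fun s => h s * Complex.exp (-F s)) 0 s := fun s hs => by
    have hh := (hd.differentiableAt (hU.mem_nhds hs)).hasDerivAt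
    refine (hh.fun_mul (hF s hs).fun_neg.cexp).congr_deriv ?_
    have := hne s hs
    field_simp
    ring
  refine ⟨F, fun s hs => (hF s hs).differentiableAt.differentiableWithinAt, fun s hs => ?_, hF₀⟩
  have hconst : h s * Complex.exp (-F s) = h s₀ * Complex.exp (-F s₀) :=
    hU.is_const_of_deriv_eq_zero hconv.isPreconnected
      (fun z hz => (hquot z hz).differentiableAt.differentiableWithinAt)
      (fun z hz => (hquot z hz).deriv) hs hs₀
  rw [hF₀, Complex.exp_neg (Complex.log _), Complex.exp_log (hne s₀ hs₀),
    mul_inv_cancel₀ (hne s₀ hs₀), Complex.exp_neg,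
    mul_inv_eq_one₀ (Complex.exp_ne_zero _)] at hconst
  exact hconst.symm

/-- `M` is the holomorphic logarithm of `(s - 1) ζ(s)` on the half-plane `Re s > 1/2` that is real
on the real axis. -/
structure IsLogZ (M : ℂ → ℂ) : Prop where
  differentiableOn : DifferentiableOn ℂ M {s | 1 / 2 < s.re}
  exp_eq : ∀ s : ℂ, 1 / 2 < s.re → Complex.exp (M s) = Z s
  im_ofReal : ∀ v : ℝ, 1 / 2 < v → (M v).im = 0

/-- The logarithm of `ζ` with the pole at `1` put back. On the real segment `(1/2, 1)` it takes the
boundary values from the upper half-plane. -/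
def logZeta (M : ℂ → ℂ) (s : ℂ) : ℂ := M s - Complex.log (s - 1)

lemma isOpen_half_lt_re : IsOpen {s : ℂ | 1 / 2 < s.re} :=
  isOpen_lt continuous_const Complex.continuous_re

lemma log_Z_two_im : (Complex.log (Z 2)).im = 0 := by
  have : Z 2 = ((Real.pi ^ 2 / 6 : ℝ) : ℂ) := by
    rw [Z_apply (by norm_num), riemannZeta_two]
    push_cast
    ring
  rw [this, Complex.log_im, Complex.arg_ofReal_of_nonneg (by positivity)]

lemma exists_isLogZ (hRH : RiemannHypothesis) : ∃ M, IsLogZ M := by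
  obtain ⟨M, hM, hexp, hM₂⟩ := exists_differentiableOn_log_of_convex isOpen_half_lt_re
    (convex_halfSpace_re_gt _) differentiable_Z.differentiableOn
    (fun _ hs => Z_ne_zero hRH hs) (s₀ := 2) (by norm_num)
  refine ⟨M, hM, hexp, fun v hv => ?_⟩
  have hcont : ContinuousOn (fun v : ℝ => (M v).im) (Set.Ioi (1 / 2)) :=
    Complex.continuous_im.comp_continuousOn
      (hM.continuousOn.comp Complex.continuous_ofReal.continuousOn fun v hv => by simpa using hv)
  have htwo : (M (2 : ℝ)).im = 0 := by rw [Complex.ofReal_ofNat, hM₂, log_Z_two_im]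
  rw [← htwo]
  refine eq_of_continuousOn_of_int_mul isPreconnected_Ioi hcont Real.pi_pos (fun v hv => ?_) hv
    (by norm_num : (2 : ℝ) ∈ Set.Ioi (1 / 2))
  have hsin : Real.sin (M v).im = 0 := by
    have him := congrArg Complex.im (hexp v (by simpa using hv))
    rw [Z_ofReal_im, Complex.exp_im] at him
    exact (mul_eq_zero.mp him).resolve_left (Real.exp_ne_zero _)
  obtain ⟨k, hk⟩ := Real.sin_eq_zero_iff.mp hsin
  exact ⟨k, hk.symm⟩

variable {M : ℂ → ℂ}

lemma IsLogZ.differentiableAt (hM : IsLogZ M) {s : ℂ} (hs : 1 / 2 < s.re) :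
    DifferentiableAt ℂ M s :=
  hM.differentiableOn.differentiableAt (isOpen_half_lt_re.mem_nhds hs)

lemma exp_logZeta (hM : IsLogZ M) {s : ℂ} (hs : 1 / 2 < s.re) (hs1 : s ≠ 1) :
    Complex.exp (logZeta M s) = riemannZeta s := by
  have hsub := sub_ne_zero.mpr hs1
  rw [logZeta, Complex.exp_sub, hM.exp_eq s hs, Complex.exp_log hsub, Z_apply hs1,
    mul_div_cancel_left₀ _ hsub]

lemma logZeta_re (hM : IsLogZ M) {s : ℂ} (hs : 1 / 2 < s.re) (hs1 : s ≠ 1) :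
    (logZeta M s).re = Real.log ‖riemannZeta s‖ := by
  rw [← exp_logZeta hM hs hs1, Complex.norm_exp, Real.log_exp]

lemma logZeta_im_ofReal (hM : IsLogZ M) {v : ℝ} (hv : 1 / 2 < v) :
    (logZeta M v).im = if v < 1 then -Real.pi else 0 := by
  rw [logZeta, Complex.sub_im, hM.im_ofReal v hv, Complex.log_im,
    show (v : ℂ) - 1 = ((v - 1 : ℝ) : ℂ) by push_cast; rfl]
  split_ifs with h
  · rw [Complex.arg_ofReal_of_neg (by linarith), zero_sub]
  · rw [Complex.arg_ofReal_of_nonneg (by linarith), sub_zero]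

lemma differentiableAt_logZeta (hM : IsLogZ M) {s : ℂ} (hs : 1 / 2 < s.re)
    (hs1 : s - 1 ∈ Complex.slitPlane) : DifferentiableAt ℂ (logZeta M) s :=
  (hM.differentiableAt hs).sub ((differentiableAt_id.sub_const 1).clog hs1)

lemma continuousOn_logZeta (hM : IsLogZ M) :
    ContinuousOn (logZeta M) {s | 1 / 2 < s.re ∧ 0 ≤ s.im ∧ s ≠ 1} := by
  intro s ⟨hre, _, hne⟩
  refine (hM.differentiableAt hre).continuousAt.continuousWithinAt.sub ?_
  have hs1 : s - 1 ≠ 0 := sub_ne_zero.mpr hne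
  by_cases hslit : s - 1 ∈ Complex.slitPlane
  · exact ((differentiableAt_id.sub_const 1).clog hslit).continuousAt.continuousWithinAt
  · rw [Complex.mem_slitPlane_iff, not_or, not_lt, not_not] at hslit
    have hneg : (s - 1).re < 0 :=
      lt_of_le_of_ne hslit.1 fun h => hs1 (Complex.ext h hslit.2)
    refine (Complex.continuousWithinAt_log_of_re_neg_of_im_zero hneg hslit.2).comp
      (f := fun s : ℂ => s - 1) (by fun_prop) fun z hz => ?_
    simpa using hz.2.1

/-- The Dirichlet series with coefficients `Λ(k) / (log k)^j`. For `j = 1` it is `log ζ`; raising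
`j` by one amounts to integrating once from `s` to `∞`. -/
def mangoldtSeries (j : ℕ) (s : ℂ) : ℂ :=
  LSeries (fun k => ((vonMangoldt k / Real.log k ^ j : ℝ) : ℂ)) s

lemma norm_mangoldt_div_le (j k : ℕ) :
    ‖((vonMangoldt k / Real.log k ^ (j + 1) : ℝ) : ℂ)‖ ≤ (Real.log 2 ^ j)⁻¹ := by
  rw [Complex.norm_real, Real.norm_eq_abs, abs_div, abs_pow,
    abs_of_nonneg ArithmeticFunction.vonMangoldt_nonneg,
    abs_of_nonneg (Real.log_natCast_nonneg k)]
  have hlog2 : 0 < Real.log 2 := Real.log_pos (by norm_num)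
  rcases lt_or_ge k 2 with hk | hk
  · have : vonMangoldt k = 0 := by
      interval_cases k <;> simp
    rw [this, zero_div]
    positivity
  · have hlog : Real.log 2 ≤ Real.log k := Real.log_le_log (by norm_num) (by exact_mod_cast hk)
    have hpos : 0 < Real.log k := by linarith
    calc vonMangoldt k / Real.log k ^ (j + 1) ≤ Real.log k / Real.log k ^ (j + 1) := by
          gcongr
          exact ArithmeticFunction.vonMangoldt_le_log
      _ = (Real.log k ^ j)⁻¹ := by
          rw [pow_succ]
          field_simp
      _ ≤ (Real.log 2 ^ j)⁻¹ := by gcongr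

lemma lseriesSummable_mangoldt (j : ℕ) {s : ℂ} (hs : 1 < s.re) :
    LSeriesSummable (fun k => ((vonMangoldt k / Real.log k ^ (j + 1) : ℝ) : ℂ)) s :=
  LSeriesSummable_of_bounded_of_one_lt_re (fun k _ => norm_mangoldt_div_le j k) hs

lemma lseries_ofReal_im (a : ℕ → ℝ) {v : ℝ} (ha : LSeriesSummable (fun k => (a k : ℂ)) v) :
    (LSeries (fun k => (a k : ℂ)) v).im = 0 := by
  rw [LSeries, Complex.im_tsum ha]
  convert tsum_zero with k
  rw [LSeries.term_def]
  split_ifs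
  · simp
  · rw [← Complex.ofReal_natCast, ← Complex.ofReal_cpow (by positivity), ← Complex.ofReal_div,
      Complex.ofReal_im]

lemma exp_logZeta_eq_exp_mangoldtSeries (hM : IsLogZ M) {s : ℂ} (hs : 1 < s.re) :
    Complex.exp (logZeta M s) = Complex.exp (mangoldtSeries 1 s) := by
  have hne : s ≠ 1 := by
    rintro rfl
    simp at hs
  rw [exp_logZeta hM (by linarith) hne, ← riemannZeta_eq_exp_LSeries hs, mangoldtSeries]
  simp

lemma logZeta_eq_mangoldtSeries (hM : IsLogZ M) {s : ℂ} (hs : 1 < s.re) :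
    logZeta M s = mangoldtSeries 1 s := by
  have hlogZeta : ContinuousOn (logZeta M) {s : ℂ | 1 < s.re} := fun s (hs : 1 < s.re) =>
    (differentiableAt_logZeta hM (by linarith)
      (Complex.mem_slitPlane_iff.mpr (Or.inl (by simpa using hs)))).continuousAt.continuousWithinAt
  have hseries : ContinuousOn (mangoldtSeries 1) {s : ℂ | 1 < s.re} := fun s (hs : 1 < s.re) => by
    refine (LSeries_hasDerivAt ?_).continuousAt.continuousWithinAt
    refine (LSeries.abscissaOfAbsConv_le_of_le_const ⟨_, fun k _ =>
      norm_mangoldt_div_le 0 k⟩).trans_lt ?_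
    exact_mod_cast hs
  have htwo : 1 < (((2 : ℝ) : ℂ)).re := by simp
  have hdiff := sub_eq_sub_of_exp_eq_exp (convex_halfSpace_re_gt 1).isPreconnected hlogZeta hseries
    (fun _ hs => exp_logZeta_eq_exp_mangoldtSeries hM hs) hs htwo
  suffices h : logZeta M ((2 : ℝ) : ℂ) = mangoldtSeries 1 ((2 : ℝ) : ℂ) by
    rwa [h, sub_self, sub_eq_zero] at hdiff
  refine Complex.ext ?_ ?_
  · have hnorm := congrArg norm (exp_logZeta_eq_exp_mangoldtSeries hM htwo)
    rwa [Complex.norm_exp, Complex.norm_exp, Real.exp_eq_exp] at hnorm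
  · rw [logZeta_im_ofReal hM (by norm_num), if_neg (by norm_num), mangoldtSeries,
      lseries_ofReal_im _ (lseriesSummable_mangoldt 0 htwo)]

lemma half_le_log {x : ℝ} (hx : 2 ≤ x) : 1 / 2 ≤ Real.log x :=
  (by linarith [Real.log_two_gt_d9] : 1 / 2 ≤ Real.log 2).trans
    (Real.log_le_log (by norm_num) hx)

lemma rpow_neg_le_exp {x a : ℝ} (hx : 2 ≤ x) (ha : 0 ≤ a) : x ^ (-a) ≤ Real.exp (-(a / 2)) := by
  have hlog := half_le_log hx
  rw [Real.rpow_def_of_pos (by linarith), Real.exp_le_exp]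
  nlinarith

lemma norm_term_le_of_two_le_re {c : ℕ → ℂ} {B : ℝ} (hB : ∀ k, ‖c k‖ ≤ B) (h1 : c 1 = 0) {s : ℂ}
    (hs : 2 ≤ s.re) (k : ℕ) :
    ‖LSeries.term c s k‖ ≤ ((k : ℝ) ^ 2)⁻¹ * (B * Real.exp (1 - s.re / 2)) := by
  have hB₀ : 0 ≤ B := (norm_nonneg _).trans (hB 0)
  rw [LSeries.norm_term_eq]
  split_ifs with hk
  · positivity
  rcases lt_or_ge k 2 with hk2 | hk2
  · obtain rfl : k = 1 := by lia
    rw [h1, norm_zero, zero_div]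
    positivity
  have hk0 : (0 : ℝ) < k := by positivity
  calc ‖c k‖ / (k : ℝ) ^ s.re ≤ B / (k : ℝ) ^ s.re := by
        gcongr
        exact hB k
    _ = ((k : ℝ) ^ 2)⁻¹ * (B * (k : ℝ) ^ (-(s.re - 2))) := by
        rw [neg_sub, Real.rpow_sub hk0, Real.rpow_two]
        field_simp
    _ ≤ ((k : ℝ) ^ 2)⁻¹ * (B * Real.exp (-((s.re - 2) / 2))) := by
        gcongr
        exact rpow_neg_le_exp (by exact_mod_cast hk2) (by linarith)
    _ = ((k : ℝ) ^ 2)⁻¹ * (B * Real.exp (1 - s.re / 2)) := by ring_nf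

lemma norm_lseries_le_of_two_le_re {c : ℕ → ℂ} {B : ℝ} (hB : ∀ k, ‖c k‖ ≤ B) (h1 : c 1 = 0)
    {s : ℂ} (hs : 2 ≤ s.re) :
    ‖LSeries c s‖ ≤ (∑' k : ℕ, ((k : ℝ) ^ 2)⁻¹) * (B * Real.exp (1 - s.re / 2)) := by
  have hsum : Summable fun k : ℕ => ((k : ℝ) ^ 2)⁻¹ :=
    Real.summable_nat_pow_inv.mpr (by norm_num)
  rw [← tsum_mul_right]
  exact tsum_of_norm_bounded (hsum.mul_right _).hasSum (norm_term_le_of_two_le_re hB h1 hs)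

lemma exists_norm_logZeta_le (hM : IsLogZ M) :
    ∃ K : ℝ, 0 ≤ K ∧ ∀ s : ℂ, 2 ≤ s.re → ‖logZeta M s‖ ≤ K * Real.exp (-(s.re / 2)) := by
  refine ⟨(∑' k : ℕ, ((k : ℝ) ^ 2)⁻¹) * Real.exp 1,
    mul_nonneg (tsum_nonneg fun k => by positivity) (Real.exp_pos _).le, fun s hs => ?_⟩
  rw [logZeta_eq_mangoldtSeries hM (by linarith)]
  have hbound := norm_lseries_le_of_two_le_re (norm_mangoldt_div_le 0) (by simp) hs
  rwa [pow_zero, inv_one, one_mul, sub_eq_add_neg, Real.exp_add, ← mul_assoc] at hbound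

/-! ### Behaviour at the critical line -/

lemma exists_Z_eq_pow_mul (s₀ : ℂ) : ∃ (k : ℕ) (h : ℂ → ℂ), AnalyticAt ℂ h s₀ ∧ h s₀ ≠ 0 ∧
    ∀ᶠ z in 𝓝 s₀, Z z = (z - s₀) ^ k * h z := by
  have hZ : AnalyticOnNhd ℂ Z Set.univ :=
    differentiable_Z.differentiableOn.analyticOnNhd isOpen_univ
  have hne : ¬ ∀ᶠ z in 𝓝 s₀, Z z = 0 := fun h => by
    have := hZ.eqOn_zero_of_preconnected_of_eventuallyEq_zero isPreconnected_univ
      (Set.mem_univ s₀) h (Set.mem_univ 1)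
    rw [Z_one] at this
    exact one_ne_zero this
  simpa only [smul_eq_mul] using
    (hZ s₀ (Set.mem_univ _)).exists_eventuallyEq_pow_smul_nonzero_iff.mpr hne

lemma eventually_eq_add_of_exp_eq (hM : IsLogZ M) {s₀ : ℂ} (hs₀ : s₀.re = 1 / 2) {r : ℝ}
    (hr : 0 < r) {q : ℂ → ℂ} (hq : ContinuousOn q (Metric.ball s₀ r ∩ {z | 1 / 2 < z.re}))
    (hexp : ∀ z ∈ Metric.ball s₀ r ∩ {z | 1 / 2 < z.re}, Complex.exp (M z) = Complex.exp (q z)) :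
    ∃ c : ℂ, ∀ᶠ z in 𝓝[{z | 1 / 2 < z.re}] s₀, M z = q z + c := by
  have hconn : IsPreconnected (Metric.ball s₀ r ∩ {z : ℂ | 1 / 2 < z.re}) :=
    ((convex_ball s₀ r).inter (convex_halfSpace_re_gt _)).isPreconnected
  have hmem : s₀ + (r / 2 : ℝ) ∈ Metric.ball s₀ r ∩ {z : ℂ | 1 / 2 < z.re} := by
    constructor
    · rw [Metric.mem_ball, dist_eq_norm, add_sub_cancel_left, Complex.norm_real,
        Real.norm_of_nonneg (by positivity)]
      linarith
    · simp only [Set.mem_ofPred_eq, Complex.add_re, Complex.ofReal_re, hs₀]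
      linarith
  refine ⟨M (s₀ + (r / 2 : ℝ)) - q (s₀ + (r / 2 : ℝ)), ?_⟩
  filter_upwards [self_mem_nhdsWithin,
    mem_nhdsWithin_of_mem_nhds (Metric.ball_mem_nhds s₀ hr)] with z hre hball
  rw [← sub_eq_sub_of_exp_eq_exp hconn (hM.differentiableOn.continuousOn.mono
    Set.inter_subset_right) hq hexp ⟨hball, hre⟩ hmem, add_sub_cancel]

lemma exists_eventually_eq_mul_log_add (hM : IsLogZ M) {s₀ : ℂ} (hs₀ : s₀.re = 1 / 2) :
    ∃ (k : ℕ) (L : ℂ → ℂ), ContinuousAt L s₀ ∧ (Z s₀ ≠ 0 → k = 0) ∧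
      ∀ᶠ z in 𝓝[{z | 1 / 2 < z.re}] s₀, M z = k * Complex.log (z - s₀) + L z := by
  obtain ⟨k, h, hh, hh₀, hZ⟩ := exists_Z_eq_pow_mul s₀
  obtain ⟨r, hr, hball⟩ := Metric.eventually_nhds_iff_ball.mp
    (hZ.and (hh.eventually_analyticAt.and (hh.continuousAt.eventually_ne hh₀)))
  obtain ⟨L, hL, hexpL, -⟩ := exists_differentiableOn_log_of_convex Metric.isOpen_ball
    (convex_ball s₀ r)
    (fun z hz => (hball z hz).2.1.differentiableAt.differentiableWithinAt)
    (fun z hz => (hball z hz).2.2) (Metric.mem_ball_self hr)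
  have hslit : ∀ z ∈ Metric.ball s₀ r ∩ {z : ℂ | 1 / 2 < z.re}, z - s₀ ∈ Complex.slitPlane :=
    fun z ⟨_, (hz : 1 / 2 < z.re)⟩ =>
      Complex.mem_slitPlane_iff.mpr (Or.inl (by rw [Complex.sub_re]; linarith))
  have hq : ContinuousOn (fun z => k * Complex.log (z - s₀) + L z)
      (Metric.ball s₀ r ∩ {z | 1 / 2 < z.re}) :=
    (continuousOn_const.mul ((continuousOn_id.sub continuousOn_const).clog hslit)).add
      (hL.continuousOn.mono Set.inter_subset_left)
  obtain ⟨c, hc⟩ := eventually_eq_add_of_exp_eq hM hs₀ hr hq fun z hz => by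
    rw [hM.exp_eq z hz.2, (hball z hz.1).1, Complex.exp_add, Complex.exp_nat_mul,
      Complex.exp_log (Complex.slitPlane_ne_zero (hslit z hz)), hexpL z hz.1]
  refine ⟨k, fun z => L z + c,
    (hL.continuousOn.continuousAt (Metric.ball_mem_nhds s₀ hr)).add_const c, fun hne => ?_, ?_⟩
  · by_contra hk
    exact hne (by rw [hZ.self_of_nhds, sub_self, zero_pow hk, zero_mul])
  · filter_upwards [hc] with z hz
    rw [hz, add_assoc]

lemma exists_tendsto_of_Z_ne_zero (hM : IsLogZ M) {s₀ : ℂ} (hs₀ : s₀.re = 1 / 2)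
    (hZ : Z s₀ ≠ 0) : ∃ ℓ : ℂ, Tendsto M (𝓝[{z | 1 / 2 < z.re}] s₀) (𝓝 ℓ) := by
  obtain ⟨k, L, hL, hk, heq⟩ := exists_eventually_eq_mul_log_add hM hs₀
  refine ⟨L s₀, (hL.tendsto.mono_left nhdsWithin_le_nhds).congr' ?_⟩
  filter_upwards [heq] with z hz
  rw [hz, hk hZ, Nat.cast_zero, zero_mul, zero_add]

/-- The growth of `log ((s - 1) ζ(s))` on approach to the critical line: bounded imaginary part and
at most logarithmic real part. -/
structure LogGrowthBound (M : ℂ → ℂ) (K : ℝ) (z : ℂ) : Prop where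
  abs_im_le : |(M z).im| ≤ K
  abs_re_le : |(M z).re| ≤ K * (1 + |Real.log (z.re - 1 / 2)|)

lemma LogGrowthBound.mono {K K' : ℝ} {z : ℂ} (h : LogGrowthBound M K z) (hK : K ≤ K') :
    LogGrowthBound M K' z :=
  ⟨h.abs_im_le.trans hK, h.abs_re_le.trans (by gcongr)⟩

lemma LogGrowthBound.of_norm_le {K : ℝ} {z : ℂ} (h : ‖M z‖ ≤ K) : LogGrowthBound M K z :=
  ⟨(Complex.abs_im_le_norm _).trans h, ((Complex.abs_re_le_norm _).trans h).trans
    (le_mul_of_one_le_right ((norm_nonneg _).trans h) (by simp))⟩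

lemma LogGrowthBound.of_eq_mul_log_add {s₀ z : ℂ} (hs₀ : s₀.re = 1 / 2) (hz : 1 / 2 < z.re)
    (hle : ‖z - s₀‖ ≤ 1) {k : ℕ} {w : ℂ} {B : ℝ} (hw : ‖w‖ ≤ B)
    (hM : M z = k * Complex.log (z - s₀) + w) : LogGrowthBound M (k * Real.pi + B) z := by
  have him : (M z).im = k * (z - s₀).arg + w.im := by simp [hM, Complex.log_im]
  have hre : (M z).re = k * Real.log ‖z - s₀‖ + w.re := by simp [hM, Complex.log_re]
  constructor
  · calc |(M z).im| ≤ k * |(z - s₀).arg| + |w.im| := by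
          rw [him]
          exact (abs_add_le _ _).trans_eq (by rw [abs_mul, Nat.abs_cast])
      _ ≤ k * Real.pi + B := by
          gcongr
          · exact Complex.abs_arg_le_pi _
          · exact (Complex.abs_im_le_norm _).trans hw
  · set a := |Real.log (z.re - 1 / 2)|
    have ha : 0 ≤ a := abs_nonneg _
    have hlog : |Real.log ‖z - s₀‖| ≤ a := by
      have hle' : z.re - 1 / 2 ≤ ‖z - s₀‖ := by
        simpa only [Complex.sub_re, hs₀] using Complex.re_le_norm (z - s₀)
      rw [abs_of_nonpos (Real.log_nonpos (norm_nonneg _) hle)]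
      exact (neg_le_neg (Real.log_le_log (by linarith) hle')).trans (neg_le_abs _)
    have hB : 0 ≤ B := (norm_nonneg _).trans hw
    calc |(M z).re| ≤ k * |Real.log ‖z - s₀‖| + |w.re| := by
          rw [hre]
          exact (abs_add_le _ _).trans_eq (by rw [abs_mul, Nat.abs_cast])
      _ ≤ k * a + B := by
          gcongr
          exact (Complex.abs_re_le_norm _).trans hw
      _ ≤ (k * Real.pi + B) * (1 + a) := by
          have := mul_nonneg (mul_nonneg k.cast_nonneg (by linarith [Real.pi_gt_three] :
            0 ≤ Real.pi - 1)) ha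
          nlinarith [Real.pi_pos, mul_nonneg hB ha, mul_nonneg (k.cast_nonneg (α := ℝ))
            Real.pi_pos.le]

lemma exists_eventually_logGrowthBound (hM : IsLogZ M) {s₀ : ℂ} (hs₀ : 1 / 2 ≤ s₀.re) :
    ∃ K : ℝ, ∀ᶠ z in 𝓝[{z | 1 / 2 < z.re}] s₀, LogGrowthBound M K z := by
  rcases hs₀.eq_or_lt with h | h
  · obtain ⟨k, L, hL, -, heq⟩ := exists_eventually_eq_mul_log_add hM h.symm
    refine ⟨k * Real.pi + (‖L s₀‖ + 1), ?_⟩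
    have hLle := nhdsWithin_le_nhds (s := {z : ℂ | 1 / 2 < z.re})
      (hL.norm.tendsto.eventually_le_const (lt_add_one ‖L s₀‖))
    filter_upwards [heq, hLle, self_mem_nhdsWithin,
      mem_nhdsWithin_of_mem_nhds (Metric.closedBall_mem_nhds s₀ one_pos)] with z hz hLz hre hball
    exact .of_eq_mul_log_add h.symm hre (by simpa [dist_eq_norm] using hball) hLz hz
  · refine ⟨‖M s₀‖ + 1, nhdsWithin_le_nhds ?_⟩
    filter_upwards [(hM.differentiableAt h).continuousAt.norm.tendsto.eventually_le_const
      (lt_add_one ‖M s₀‖)] with z hz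
    exact .of_norm_le hz

lemma exists_logGrowthBound_on_rect (hM : IsLogZ M) (T : ℝ) :
    ∃ K : ℝ, 0 ≤ K ∧ ∀ z : ℂ, 1 / 2 < z.re → z.re ≤ 2 → 0 ≤ z.im → z.im ≤ T →
      LogGrowthBound M K z := by
  have hcpt : IsCompact (Set.Icc (1 / 2 : ℝ) 2 ×ℂ Set.Icc 0 T) :=
    isCompact_Icc.reProdIm isCompact_Icc
  have hbound : ∃ K : ℝ, ∀ z ∈ Set.Icc (1 / 2 : ℝ) 2 ×ℂ Set.Icc 0 T, 1 / 2 < z.re →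
      LogGrowthBound M K z := by
    refine hcpt.induction_on (p := fun U => ∃ K : ℝ, ∀ z ∈ U, 1 / 2 < z.re →
      LogGrowthBound M K z) ?_ ?_ ?_ ?_
    · exact ⟨0, fun z hz => absurd hz (Set.notMem_empty z)⟩
    · rintro U V hUV ⟨K, hK⟩
      exact ⟨K, fun z hz => hK z (hUV hz)⟩
    · rintro U V ⟨K, hK⟩ ⟨K', hK'⟩
      refine ⟨max K K', fun z hz hre => ?_⟩
      rcases hz with hz | hz
      · exact (hK z hz hre).mono (le_max_left _ _)
      · exact (hK' z hz hre).mono (le_max_right _ _)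
    · intro s hs
      obtain ⟨K, hK⟩ := exists_eventually_logGrowthBound hM (s₀ := s) hs.1.1
      exact ⟨_, mem_nhdsWithin_of_mem_nhds (eventually_nhdsWithin_iff.mp hK), K, fun _ hz => hz⟩
  obtain ⟨K, hK⟩ := hbound
  exact ⟨|K|, abs_nonneg K, fun z h1 h2 h3 h4 =>
    (hK z ⟨⟨h1.le, h2⟩, h3, h4⟩ h1).mono (le_abs_self K)⟩

/-! ### Horizontal integration -/

/-- Integration along the horizontal half-line to the right of `s`. For holomorphic `Φ` it is the
primitive of `-Φ` that vanishes at `+∞`. -/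
def horInt (Φ : ℂ → ℂ) (s : ℂ) : ℂ := ∫ v in Set.Ioi s.re, Φ (v + s.im * Complex.I)

/-- Functions on the upper right quadrant at `1/2` that can be integrated along horizontal lines,
locally uniformly in the ordinate. -/
structure HorAdmissible (Φ : ℂ → ℂ) : Prop where
  continuousOn : ContinuousOn Φ {s | 1 / 2 < s.re ∧ 0 ≤ s.im ∧ s ≠ 1}
  differentiableOn : DifferentiableOn ℂ Φ {s | 1 / 2 < s.re ∧ 0 < s.im}
  dominated : ∀ T : ℝ, ∃ W : ℝ → ℝ, IntegrableOn W (Set.Ioi (1 / 2)) ∧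
    ∀ v : ℝ, 1 / 2 < v → v ≠ 1 → ∀ t : ℝ, 0 ≤ t → t ≤ T → ‖Φ (v + t * Complex.I)‖ ≤ W v
  decay : ∀ T : ℝ, ∃ K : ℝ, 0 ≤ K ∧ ∀ v : ℝ, 2 ≤ v → ∀ t : ℝ, 0 ≤ t → t ≤ T →
    ‖Φ (v + t * Complex.I)‖ ≤ K * Real.exp (-(v / 2))

lemma re_add_mul_I (v t : ℝ) : ((v : ℂ) + t * Complex.I).re = v := by simp

lemma im_add_mul_I (v t : ℝ) : ((v : ℂ) + t * Complex.I).im = t := by simp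

lemma add_mul_I_ne_one {v t : ℝ} (hv : v ≠ 1) : (v : ℂ) + t * Complex.I ≠ 1 := fun h => by
  have := congrArg Complex.re h
  rw [re_add_mul_I, Complex.one_re] at this
  exact hv this

lemma isOpen_quadrant : IsOpen {s : ℂ | 1 / 2 < s.re ∧ 0 < s.im} :=
  isOpen_half_lt_re.inter (isOpen_lt continuous_const Complex.continuous_im)

lemma convex_quadrant : Convex ℝ {s : ℂ | 1 / 2 < s.re ∧ 0 < s.im} :=
  (convex_halfSpace_re_gt _).inter (convex_halfSpace_im_gt _)

lemma ae_restrict_ne (s : Set ℝ) (a : ℝ) : ∀ᵐ u ∂(volume.restrict s), u ≠ a :=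
  ae_restrict_of_ae (Measure.ae_ne volume a)

lemma integrableOn_Ioi_exp_neg_half (a : ℝ) :
    IntegrableOn (fun v : ℝ => Real.exp (-(v / 2))) (Set.Ioi a) := by
  have := integrableOn_exp_mul_Ioi (a := -(1 / 2)) (by norm_num) a
  refine this.congr_fun (fun v _ => ?_) measurableSet_Ioi
  simp only
  ring_nf

lemma integral_Ioi_exp_neg_half (a : ℝ) :
    ∫ v in Set.Ioi a, Real.exp (-(v / 2)) = 2 * Real.exp (-(a / 2)) := by
  have := integral_exp_mul_Ioi (a := -(1 / 2)) (by norm_num) a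
  rw [show (fun v : ℝ => Real.exp (-(v / 2))) = fun v => Real.exp (-(1 / 2) * v) by
    ext v; ring_nf, this]
  ring_nf

lemma tendsto_exp_neg_half_atTop : Tendsto (fun v : ℝ => Real.exp (-(v / 2))) atTop (𝓝 0) :=
  Real.tendsto_exp_neg_atTop_nhds_zero.comp (tendsto_id.atTop_div_const (by norm_num))

namespace HorAdmissible

variable {Φ : ℂ → ℂ}

lemma integrableOn (h : HorAdmissible Φ) {t : ℝ} (ht : 0 ≤ t) :
    IntegrableOn (fun v : ℝ => Φ (v + t * Complex.I)) (Set.Ioi (1 / 2)) := by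
  obtain ⟨W, hW, hΦW⟩ := h.dominated t
  have hae : (Set.Ioi (1 / 2 : ℝ) \ {1} : Set ℝ) =ᵐ[volume] Set.Ioi (1 / 2 : ℝ) :=
    sdiff_null_ae_eq_self (measure_singleton 1)
  have hmeas : MeasurableSet (Set.Ioi (1 / 2 : ℝ) \ {1}) :=
    measurableSet_Ioi.diff (measurableSet_singleton 1)
  rw [← integrableOn_congr_set_ae hae] at hW ⊢
  refine Integrable.mono' hW (ContinuousOn.aestronglyMeasurable ?_ hmeas) ?_
  · refine h.continuousOn.comp (by fun_prop) fun v ⟨(hv : 1 / 2 < v), hv1⟩ => ?_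
    exact ⟨by rwa [re_add_mul_I], by rwa [im_add_mul_I], add_mul_I_ne_one hv1⟩
  · filter_upwards [ae_restrict_mem hmeas] with v hv
    exact hΦW v hv.1 hv.2 t ht le_rfl

lemma exists_norm_horInt_le (h : HorAdmissible Φ) (T : ℝ) :
    ∃ K : ℝ, 0 ≤ K ∧ ∀ v : ℝ, 1 / 2 ≤ v → ∀ t : ℝ, 0 ≤ t → t ≤ T →
      ‖horInt Φ (v + t * Complex.I)‖ ≤ K * Real.exp (-(v / 2)) := by
  obtain ⟨W, hW, hΦW⟩ := h.dominated T
  obtain ⟨K, hK0, hK⟩ := h.decay T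
  set I := ∫ v in Set.Ioi (1 / 2 : ℝ), ‖W v‖
  have hI0 : 0 ≤ I := integral_nonneg fun v => norm_nonneg _
  refine ⟨2 * K + I * Real.exp 1, by positivity, fun v hv t ht0 htT => ?_⟩
  rw [horInt, re_add_mul_I, im_add_mul_I]
  have hexp := Real.exp_pos (-(v / 2))
  rcases le_or_gt 2 v with hv2 | hv2
  · calc ‖∫ u in Set.Ioi v, Φ (u + t * Complex.I)‖
        ≤ ∫ u in Set.Ioi v, K * Real.exp (-(u / 2)) := by
          refine norm_integral_le_of_norm_le ((integrableOn_Ioi_exp_neg_half v).const_mul K) ?_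
          filter_upwards [ae_restrict_mem measurableSet_Ioi] with u hu
          exact hK u (hv2.trans (le_of_lt hu)) t ht0 htT
      _ = 2 * K * Real.exp (-(v / 2)) := by
          rw [integral_const_mul, integral_Ioi_exp_neg_half]
          ring
      _ ≤ (2 * K + I * Real.exp 1) * Real.exp (-(v / 2)) := by
          gcongr
          exact le_add_of_nonneg_right (by positivity)
  · have hone : 1 ≤ Real.exp 1 * Real.exp (-(v / 2)) := by
      rw [← Real.exp_add]
      exact Real.one_le_exp (by linarith)
    calc ‖∫ u in Set.Ioi v, Φ (u + t * Complex.I)‖ ≤ ∫ u in Set.Ioi v, ‖W u‖ := by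
          refine norm_integral_le_of_norm_le (hW.mono_set (Set.Ioi_subset_Ioi hv)).norm ?_
          filter_upwards [ae_restrict_mem measurableSet_Ioi, ae_restrict_ne _ 1] with u hu hu1
          exact (hΦW u (lt_of_le_of_lt hv hu) hu1 t ht0 htT).trans (le_abs_self _)
      _ ≤ I := setIntegral_mono_set hW.norm (ae_of_all _ fun u => norm_nonneg _)
          (Set.Ioi_subset_Ioi hv).eventuallyLE
      _ ≤ I * (Real.exp 1 * Real.exp (-(v / 2))) := le_mul_of_one_le_right hI0 hone
      _ ≤ (2 * K + I * Real.exp 1) * Real.exp (-(v / 2)) := by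
          nlinarith [mul_nonneg hK0 hexp.le]

lemma horInt_eq_integral_indicator (Φ : ℂ → ℂ) {s : ℂ} (hs : 1 / 2 ≤ s.re) :
    horInt Φ s = ∫ v in Set.Ioi (1 / 2 : ℝ),
      Set.indicator (Set.Ioi s.re) (fun v : ℝ => Φ (v + s.im * Complex.I)) v := by
  rw [setIntegral_indicator measurableSet_Ioi, Set.inter_eq_right.mpr (Set.Ioi_subset_Ioi hs)]
  rfl

lemma continuousWithinAt_indicator (h : HorAdmissible Φ) {s₀ : ℂ} (hs₀ : 0 ≤ s₀.im) {v : ℝ}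
    (hv : 1 / 2 < v) (hv1 : v ≠ 1) (hvs : v ≠ s₀.re) :
    ContinuousWithinAt (fun s : ℂ =>
      Set.indicator (Set.Ioi s.re) (fun v : ℝ => Φ (v + s.im * Complex.I)) v)
      {s | 1 / 2 ≤ s.re ∧ 0 ≤ s.im} s₀ := by
  have hmem : ∀ {t : ℝ}, 0 ≤ t →
      (v : ℂ) + t * Complex.I ∈ {s : ℂ | 1 / 2 < s.re ∧ 0 ≤ s.im ∧ s ≠ 1} := fun ht =>
    ⟨by rwa [re_add_mul_I], by rwa [im_add_mul_I], add_mul_I_ne_one hv1⟩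
  rcases lt_or_gt_of_ne hvs with hlt | hgt
  · refine (continuousWithinAt_const (b := (0 : ℂ))).congr_of_eventuallyEq ?_
      (Set.indicator_of_notMem (by simpa using hlt.le) _)
    filter_upwards [nhdsWithin_le_nhds
      (continuousAt_const.eventually_lt Complex.continuous_re.continuousAt hlt)] with s hs
    exact Set.indicator_of_notMem (by simpa using le_of_lt hs) _
  · have hcont : ContinuousWithinAt (fun s : ℂ => Φ (v + s.im * Complex.I))
        {s | 1 / 2 ≤ s.re ∧ 0 ≤ s.im} s₀ :=
      (h.continuousOn _ (hmem hs₀)).comp (f := fun s : ℂ => (v : ℂ) + s.im * Complex.I)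
        (by fun_prop) fun s hs => hmem hs.2
    refine hcont.congr_of_eventuallyEq ?_ (Set.indicator_of_mem (by simpa using hgt) _)
    filter_upwards [nhdsWithin_le_nhds
      (Complex.continuous_re.continuousAt.eventually_lt continuousAt_const hgt)] with s hs
    exact Set.indicator_of_mem (by simpa using hs) _

lemma continuousOn_horInt (h : HorAdmissible Φ) :
    ContinuousOn (horInt Φ) {s | 1 / 2 ≤ s.re ∧ 0 ≤ s.im} := by
  intro s₀ hs₀
  obtain ⟨W, hW, hΦW⟩ := h.dominated (s₀.im + 1)
  refine ContinuousWithinAt.congr (f := fun s : ℂ => ∫ v in Set.Ioi (1 / 2 : ℝ),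
    Set.indicator (Set.Ioi s.re) (fun v : ℝ => Φ (v + s.im * Complex.I)) v) ?_
    (fun s hs => horInt_eq_integral_indicator Φ hs.1) (horInt_eq_integral_indicator Φ hs₀.1)
  refine continuousWithinAt_of_dominated (bound := fun v => ‖W v‖) ?_ ?_ hW.norm ?_
  · filter_upwards [self_mem_nhdsWithin] with s hs
    exact (h.integrableOn hs.2).aestronglyMeasurable.indicator measurableSet_Ioi
  · filter_upwards [self_mem_nhdsWithin, nhdsWithin_le_nhds
      (Complex.continuous_im.continuousAt.tendsto.eventually_le_const (lt_add_one s₀.im))]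
      with s hs hsT
    filter_upwards [ae_restrict_mem measurableSet_Ioi, ae_restrict_ne _ 1] with v hv hv1
    exact (norm_indicator_le_norm_self _ _).trans
      ((hΦW v hv hv1 s.im hs.2 hsT).trans (le_abs_self _))
  · filter_upwards [ae_restrict_mem measurableSet_Ioi, ae_restrict_ne _ 1,
      ae_restrict_ne _ s₀.re] with v hv hv1 hvs
    exact h.continuousWithinAt_indicator hs₀.2 hv hv1 hvs

lemma tendsto_primitive (h : HorAdmissible Φ) {P : ℂ → ℂ}
    (hP : ∀ z : ℂ, 1 / 2 < z.re → 0 < z.im → HasDerivAt P (Φ z) z) {z : ℂ} (hre : 1 / 2 < z.re)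
    (him : 0 < z.im) :
    Tendsto (fun V : ℝ => P (V + z.im * Complex.I)) atTop (𝓝 (horInt Φ z + P z)) := by
  have hint : IntegrableOn (fun v : ℝ => Φ (v + z.im * Complex.I)) (Set.Ioi z.re) :=
    (h.integrableOn him.le).mono_set (Set.Ioi_subset_Ioi hre.le)
  refine ((intervalIntegral_tendsto_integral_Ioi z.re hint tendsto_id).add_const (P z)).congr' ?_
  filter_upwards [eventually_ge_atTop z.re] with V hV
  have hderiv : ∀ v ∈ Set.uIcc z.re V,
      HasDerivAt (fun v : ℝ => P (v + z.im * Complex.I)) (Φ (v + z.im * Complex.I)) v := by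
    intro v hv
    rw [Set.uIcc_of_le hV] at hv
    have hPv := hP (v + z.im * Complex.I) (by rw [re_add_mul_I]; exact hre.trans_le hv.1)
      (by rw [im_add_mul_I]; exact him)
    simpa using (hPv.comp (v : ℂ) ((hasDerivAt_id _).add_const _)).comp_ofReal
  rw [id, intervalIntegral.integral_eq_sub_of_hasDerivAt hderiv, Complex.re_add_im,
    sub_add_cancel]
  rw [intervalIntegrable_iff_integrableOn_Ioc_of_le hV]
  exact hint.mono_set Set.Ioc_subset_Ioi_self

lemma tendsto_primitive_sub_primitive (h : HorAdmissible Φ) {P : ℂ → ℂ}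
    (hP : ∀ z : ℂ, 1 / 2 < z.re → 0 < z.im → HasDerivAt P (Φ z) z) {t u : ℝ} (ht : 0 < t)
    (hu : 0 < u) :
    Tendsto (fun V : ℝ => P (V + t * Complex.I) - P (V + u * Complex.I)) atTop (𝓝 0) := by
  obtain ⟨K, hK0, hK⟩ := h.decay (max t u)
  have hlim : Tendsto (fun V : ℝ => K * Real.exp (-(V / 2)) *
      ‖((t - u : ℝ) : ℂ) * Complex.I‖) atTop (𝓝 0) := by
    simpa using (tendsto_exp_neg_half_atTop.const_mul K).mul_const ‖((t - u : ℝ) : ℂ) * Complex.I‖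
  refine squeeze_zero_norm' ?_ hlim
  filter_upwards [eventually_ge_atTop 2] with V hV
  have hconv : Convex ℝ {w : ℂ | V ≤ w.re ∧ 0 < w.im ∧ w.im ≤ max t u} :=
    (convex_halfSpace_re_ge _).inter ((convex_halfSpace_im_gt _).inter (convex_halfSpace_im_le _))
  have hmem : ∀ {y : ℝ}, 0 < y → y ≤ max t u →
      (V : ℂ) + y * Complex.I ∈ {w : ℂ | V ≤ w.re ∧ 0 < w.im ∧ w.im ≤ max t u} := fun hy hyT =>
    ⟨by rw [re_add_mul_I], by rwa [im_add_mul_I], by rwa [im_add_mul_I]⟩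
  have hmean := hconv.norm_image_sub_le_of_norm_hasDerivWithin_le (f := P) (f' := Φ)
    (C := K * Real.exp (-(V / 2)))
    (fun w hw => (hP w (by linarith [hw.1]) hw.2.1).hasDerivWithinAt)
    (fun w hw => by
      obtain ⟨hre, him, hT⟩ := hw
      have hΦ := hK w.re (hV.trans hre) w.im him.le hT
      rw [Complex.re_add_im] at hΦ
      exact hΦ.trans (by gcongr))
    (hmem hu (le_max_right _ _)) (hmem ht (le_max_left _ _))
  rwa [show (V + t * Complex.I : ℂ) - (V + u * Complex.I) = ((t - u : ℝ) : ℂ) * Complex.I by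
    push_cast; ring] at hmean

lemma hasDerivAt_horInt (h : HorAdmissible Φ) {s : ℂ} (hs : 1 / 2 < s.re) (hs' : 0 < s.im) :
    HasDerivAt (horInt Φ) (-Φ s) s := by
  obtain ⟨P, hP⟩ := convex_quadrant.exists_forall_hasDerivWithinAt h.differentiableOn
  replace hP : ∀ z : ℂ, 1 / 2 < z.re → 0 < z.im → HasDerivAt P (Φ z) z := fun z hre him =>
    (hP z ⟨hre, him⟩).hasDerivAt (isOpen_quadrant.mem_nhds ⟨hre, him⟩)
  have hconst : ∀ z : ℂ, 1 / 2 < z.re → 0 < z.im → horInt Φ z + P z = horInt Φ s + P s :=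
    fun z hre him => sub_eq_zero.mp (tendsto_nhds_unique
      ((h.tendsto_primitive hP hre him).sub (h.tendsto_primitive hP hs hs'))
      (h.tendsto_primitive_sub_primitive hP him hs'))
  refine ((hP s hs hs').const_sub (horInt Φ s + P s)).congr_of_eventuallyEq ?_
  filter_upwards [isOpen_quadrant.mem_nhds ⟨hs, hs'⟩] with z hz
  rw [← hconst z hz.1 hz.2, add_sub_cancel_right]

protected lemma horInt (h : HorAdmissible Φ) : HorAdmissible (horInt Φ) where
  continuousOn := h.continuousOn_horInt.mono fun s hs => ⟨hs.1.le, hs.2.1⟩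
  differentiableOn := fun s hs =>
    (h.hasDerivAt_horInt hs.1 hs.2).differentiableAt.differentiableWithinAt
  dominated := fun T => by
    obtain ⟨K, -, hK⟩ := h.exists_norm_horInt_le T
    exact ⟨fun v => K * Real.exp (-(v / 2)), (integrableOn_Ioi_exp_neg_half _).const_mul K,
      fun v hv _ t ht0 htT => hK v hv.le t ht0 htT⟩
  decay := fun T => by
    obtain ⟨K, hK0, hK⟩ := h.exists_norm_horInt_le T
    exact ⟨K, hK0, fun v hv t ht0 htT => hK v (by linarith) t ht0 htT⟩

end HorAdmissible

lemma abs_log_le_of_le {a w b : ℝ} (ha : 0 < a) (haw : a ≤ w) (hwb : w ≤ b) :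
    |Real.log w| ≤ |Real.log a| + |Real.log b| :=
  (abs_le_max_abs_abs (Real.log_le_log ha haw) (Real.log_le_log (ha.trans_le haw) hwb)).trans
    (max_le_add_of_nonneg (abs_nonneg _) (abs_nonneg _))

lemma integrableOn_Ioc_abs_log_sub (a b c : ℝ) :
    IntegrableOn (fun v : ℝ => |Real.log (v - c)|) (Set.Ioc a b) := by
  have hint : IntervalIntegrable (fun v : ℝ => Real.log (v - c)) volume a b := by
    simpa using
      (intervalIntegral.intervalIntegrable_log' (a := a - c) (b := b - c)).comp_sub_right c
  exact hint.1.abs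

lemma norm_log_sub_one_le {z : ℂ} {T : ℝ} (hre : z.re ≠ 1) (hre₀ : 0 ≤ z.re) (hre₂ : z.re ≤ 2)
    (him : |z.im| ≤ T) :
    ‖Complex.log (z - 1)‖ ≤ |Real.log (z.re - 1)| + |Real.log (T + 1)| + Real.pi := by
  have hle : |z.re - 1| ≤ ‖z - 1‖ := by simpa using Complex.abs_re_le_norm (z - 1)
  have hge : ‖z - 1‖ ≤ T + 1 := by
    refine (Complex.norm_le_abs_re_add_abs_im _).trans ?_
    rw [Complex.sub_re, Complex.sub_im, Complex.one_re, Complex.one_im, sub_zero]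
    have : |z.re - 1| ≤ 1 := abs_le.mpr ⟨by linarith, by linarith⟩
    linarith
  refine (Complex.norm_le_abs_re_add_abs_im _).trans ?_
  rw [Complex.log_re, Complex.log_im]
  refine add_le_add ?_ (Complex.abs_arg_le_pi _)
  simpa only [Real.log_abs] using abs_log_le_of_le (abs_pos.mpr (sub_ne_zero.mpr hre)) hle hge

lemma exists_norm_logZeta_le_on_strip (hM : IsLogZ M) (T : ℝ) :
    ∃ V : ℝ → ℝ, IntegrableOn V (Set.Ioc (1 / 2) 2) ∧
      ∀ v : ℝ, 1 / 2 < v → v ≤ 2 → v ≠ 1 → ∀ t : ℝ, 0 ≤ t → t ≤ T →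
        ‖logZeta M (v + t * Complex.I)‖ ≤ V v := by
  obtain ⟨K, -, hK⟩ := exists_logGrowthBound_on_rect hM T
  refine ⟨fun v => (2 * K + Real.pi + |Real.log (T + 1)|) +
      (K * |Real.log (v - 1 / 2)| + |Real.log (v - 1)|),
    (integrableOn_const (by simp)).add (((integrableOn_Ioc_abs_log_sub _ _ (1 / 2)).const_mul K).add
      (integrableOn_Ioc_abs_log_sub _ _ 1)), fun v hv hv2 hv1 t ht0 htT => ?_⟩
  set z : ℂ := v + t * Complex.I
  have hre : z.re = v := re_add_mul_I v t
  have him : z.im = t := im_add_mul_I v t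
  have hlog := norm_log_sub_one_le (z := z) (T := T) (by rwa [hre]) (by linarith) (by rwa [hre])
    (by rwa [him, abs_of_nonneg ht0])
  obtain ⟨hMim, hMre⟩ := hK z (by rwa [hre]) (by rwa [hre]) (by rwa [him]) (by rwa [him])
  rw [hre] at hlog hMre
  have hMz := Complex.norm_le_abs_re_add_abs_im (M z)
  rw [logZeta]
  refine (norm_sub_le _ _).trans ?_
  linarith

lemma horAdmissible_logZeta (hM : IsLogZ M) : HorAdmissible (logZeta M) where
  continuousOn := continuousOn_logZeta hM
  differentiableOn := fun s hs => (differentiableAt_logZeta hM hs.1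
    (Complex.mem_slitPlane_iff.mpr (Or.inr (by simpa using hs.2.ne')))).differentiableWithinAt
  decay := fun T => by
    obtain ⟨K, hK0, hK⟩ := exists_norm_logZeta_le hM
    exact ⟨K, hK0, fun v hv t _ _ => by simpa using hK (v + t * Complex.I) (by simpa using hv)⟩
  dominated := fun T => by
    obtain ⟨K, hK0, hK⟩ := exists_norm_logZeta_le hM
    obtain ⟨V, hV, hVle⟩ := exists_norm_logZeta_le_on_strip hM T
    refine ⟨fun v => Set.indicator (Set.Ioc (1 / 2) 2) V v + K * Real.exp (-(v / 2)),
      ((integrable_indicator_iff measurableSet_Ioc).mpr hV).integrableOn.add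
        ((integrableOn_Ioi_exp_neg_half _).const_mul K), fun v hv hv1 t ht0 htT => ?_⟩
    rcases le_or_gt v 2 with hv2 | hv2
    · simp only [Set.indicator_of_mem (Set.mem_Ioc.mpr ⟨hv, hv2⟩)]
      exact (hVle v hv hv2 hv1 t ht0 htT).trans (le_add_of_nonneg_right (by positivity))
    · simp only [Set.indicator_of_notMem fun h : v ∈ Set.Ioc (1 / 2) 2 => h.2.not_gt hv2, zero_add]
      simpa using hK (v + t * Complex.I) (by simpa using hv2.le)

/-! ### The argument of `ζ` on the critical line -/

/-- `θ` is a continuous argument of the function `w` on `s`, that is, `w = |w| e^{iθ}` there. -/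
structure IsContinuousArg (w : ℝ → ℂ) (θ : ℝ → ℝ) (s : Set ℝ) : Prop where
  continuousOn : ContinuousOn θ s
  eq_norm_mul_exp : ∀ u ∈ s, w u = ‖w u‖ * Complex.exp (θ u * Complex.I)

namespace IsContinuousArg

variable {w : ℝ → ℂ} {θ θ' : ℝ → ℝ} {s : Set ℝ}

lemma eq_of_eq (h : IsContinuousArg w θ s) (h' : IsContinuousArg w θ' s) (hs : IsPreconnected s)
    (hw : ∀ u ∈ s, w u ≠ 0) {x y : ℝ} (hx : x ∈ s) (hy : y ∈ s) (hxy : θ x = θ' x) :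
    θ y = θ' y := by
  have hexp : ∀ u ∈ s, Complex.exp (θ u * Complex.I) = Complex.exp (θ' u * Complex.I) :=
    fun u hu => mul_left_cancel₀ (Complex.ofReal_ne_zero.mpr (norm_ne_zero_iff.mpr (hw u hu)))
      ((h.eq_norm_mul_exp u hu).symm.trans (h'.eq_norm_mul_exp u hu))
  have hdiff := sub_eq_sub_of_exp_eq_exp (p := fun u => (θ u : ℂ) * Complex.I)
    (q := fun u => (θ' u : ℂ) * Complex.I) hs
    ((Complex.continuous_ofReal.comp_continuousOn h.continuousOn).mul continuousOn_const)
    ((Complex.continuous_ofReal.comp_continuousOn h'.continuousOn).mul continuousOn_const)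
    hexp hx hy
  rw [hxy, sub_self, ← sub_mul, eq_comm, mul_eq_zero, or_iff_left Complex.I_ne_zero] at hdiff
  exact_mod_cast sub_eq_zero.mp hdiff

lemma update_left {a b ℓ : ℝ} (h : IsContinuousArg w θ (Set.Ioc a b)) (hab : a < b)
    (hw : ContinuousWithinAt w (Set.Ioi a) a) (hℓ : Tendsto θ (𝓝[>] a) (𝓝 ℓ)) :
    IsContinuousArg w (Function.update θ a ℓ) (Set.Icc a b) where
  continuousOn := by
    rw [continuousOn_update_iff, Set.Icc_sdiff_left]
    exact ⟨h.continuousOn, fun _ => hℓ.mono_left (nhdsWithin_mono _ Set.Ioc_subset_Ioi_self)⟩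
  eq_norm_mul_exp u hu := by
    rcases hu.1.eq_or_lt with rfl | hau
    · rw [Function.update_self]
      have hpolar : Tendsto (fun v => ‖w v‖ * Complex.exp (θ v * Complex.I)) (𝓝[>] a)
          (𝓝 (‖w a‖ * Complex.exp (ℓ * Complex.I))) :=
        ((Complex.continuous_ofReal.tendsto _).comp hw.norm).mul
          ((Complex.continuous_exp.tendsto _).comp
            (((Complex.continuous_ofReal.tendsto _).comp hℓ).mul_const _))
      refine tendsto_nhds_unique hw (hpolar.congr' ?_)
      filter_upwards [Ioc_mem_nhdsGT hab] with v hv using (h.eq_norm_mul_exp v hv).symm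
    · rw [Function.update_of_ne hau.ne']
      exact h.eq_norm_mul_exp u ⟨hau, hu.2⟩

end IsContinuousArg

lemma isArgAlongPath_iff {t a : ℝ} : IsArgAlongPath t a ↔ ∃ θ φ : ℝ → ℝ,
    IsContinuousArg (fun u => riemannZeta (2 + u * Complex.I)) θ (Set.Icc 0 t) ∧
    IsContinuousArg (fun σ => riemannZeta (σ + t * Complex.I)) φ (Set.Icc (1 / 2) 2) ∧
    θ 0 = 0 ∧ φ 2 = θ t ∧ φ (1 / 2) = a :=
  ⟨fun ⟨θ, φ, hθ, hφ, h0, hθp, h2, hφp, ha⟩ => ⟨θ, φ, ⟨hθ, hθp⟩, ⟨hφ, hφp⟩, h0, h2, ha⟩,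
    fun ⟨θ, φ, hθ, hφ, h0, h2, ha⟩ => ⟨θ, φ, hθ.1, hφ.1, h0, hθ.2, h2, hφ.2, ha⟩⟩

lemma riemannZeta_add_mul_I_ne_zero {t : ℝ} (hord : ¬ IsOrdinate t) (σ : ℝ) :
    riemannZeta (σ + t * Complex.I) ≠ 0 :=
  fun h => hord ⟨σ, h⟩

lemma IsArgAlongPath.unique {t a b : ℝ} (ht : 0 ≤ t) (hord : ¬ IsOrdinate t)
    (ha : IsArgAlongPath t a) (hb : IsArgAlongPath t b) : a = b := by
  obtain ⟨θ, φ, hθ, hφ, h0, h2, rfl⟩ := isArgAlongPath_iff.mp ha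
  obtain ⟨θ', φ', hθ', hφ', h0', h2', rfl⟩ := isArgAlongPath_iff.mp hb
  have hvertical : θ t = θ' t := hθ.eq_of_eq hθ' isPreconnected_Icc
    (fun u _ => riemannZeta_ne_zero_of_one_le_re (by norm_num)) (Set.left_mem_Icc.mpr ht)
    (Set.right_mem_Icc.mpr ht) (h0.trans h0'.symm)
  exact hφ.eq_of_eq hφ' isPreconnected_Icc (fun σ _ => riemannZeta_add_mul_I_ne_zero hord σ)
    (x := 2) (by norm_num) (by norm_num) (by rw [h2, h2', hvertical])

lemma IsArgAlongPath.argZeta_eq {t a : ℝ} (ht : 0 ≤ t) (hord : ¬ IsOrdinate t)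
    (h : IsArgAlongPath t a) : argZeta t = a :=
  (Classical.epsilon_spec (p := IsArgAlongPath t) ⟨a, h⟩).unique ht hord h

lemma riemannZeta_eq_norm_mul_exp_im_logZeta (hM : IsLogZ M) {s : ℂ} (hs : 1 / 2 < s.re)
    (hs1 : s ≠ 1) :
    riemannZeta s = ‖riemannZeta s‖ * Complex.exp ((logZeta M s).im * Complex.I) := by
  rw [← exp_logZeta hM hs hs1, Complex.norm_exp, Complex.ofReal_exp, ← Complex.exp_add,
    Complex.re_add_im]

lemma add_mul_I_ne_one_of_im_ne_zero {t : ℝ} (ht : t ≠ 0) (σ : ℝ) :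
    (σ : ℂ) + t * Complex.I ≠ 1 := fun h => by
  have him := congrArg Complex.im h
  rw [im_add_mul_I, Complex.one_im] at him
  exact ht him

lemma isContinuousArg_logZeta_vertical (hM : IsLogZ M) (t : ℝ) :
    IsContinuousArg (fun u => riemannZeta (2 + u * Complex.I))
      (fun u => (logZeta M (2 + u * Complex.I)).im) (Set.Icc 0 t) := by
  have hne : ∀ u : ℝ, (2 + u * Complex.I : ℂ) ≠ 1 := fun u => by
    simpa using add_mul_I_ne_one (t := u) (by norm_num : (2 : ℝ) ≠ 1)
  refine ⟨Complex.continuous_im.comp_continuousOn ((continuousOn_logZeta hM).comp (by fun_prop)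
    fun u hu => ⟨?_, ?_, hne u⟩),
    fun u _ => riemannZeta_eq_norm_mul_exp_im_logZeta hM (by norm_num) (hne u)⟩
  · norm_num
  · simpa using hu.1

lemma isContinuousArg_logZeta_horizontal (hM : IsLogZ M) {t : ℝ} (ht : 0 < t) :
    IsContinuousArg (fun σ => riemannZeta (σ + t * Complex.I))
      (fun σ => (logZeta M (σ + t * Complex.I)).im) (Set.Ioc (1 / 2) 2) := by
  have hne := add_mul_I_ne_one_of_im_ne_zero ht.ne'
  have hre : ∀ {σ : ℝ}, σ ∈ Set.Ioc (1 / 2 : ℝ) 2 → 1 / 2 < (σ + t * Complex.I : ℂ).re :=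
    fun hσ => by rw [re_add_mul_I]; exact hσ.1
  refine ⟨Complex.continuous_im.comp_continuousOn ((continuousOn_logZeta hM).comp (by fun_prop)
    fun σ hσ => ⟨hre hσ, by rw [im_add_mul_I]; exact ht.le, hne σ⟩),
    fun σ hσ => riemannZeta_eq_norm_mul_exp_im_logZeta hM (hre hσ) (hne σ)⟩

lemma tendsto_add_mul_I_nhdsWithin (σ t : ℝ) :
    Tendsto (fun σ : ℝ => (σ : ℂ) + t * Complex.I) (𝓝[>] σ)
      (𝓝[{z | σ < z.re}] (σ + t * Complex.I)) := by
  refine tendsto_nhdsWithin_of_tendsto_nhds_of_eventually_within _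
    (Continuous.tendsto' (by fun_prop) _ _ rfl |>.mono_left nhdsWithin_le_nhds) ?_
  filter_upwards [self_mem_nhdsWithin] with v hv
  rwa [re_add_mul_I]

lemma exists_tendsto_logZeta_im (hM : IsLogZ M) {t : ℝ} (ht : 0 < t) (hord : ¬ IsOrdinate t) :
    ∃ a : ℝ, Tendsto (fun σ : ℝ => (logZeta M (σ + t * Complex.I)).im) (𝓝[>] (1 / 2)) (𝓝 a) := by
  set s₀ : ℂ := ((1 / 2 : ℝ) : ℂ) + t * Complex.I with hs₀
  have hs₁ : s₀ ≠ 1 := add_mul_I_ne_one_of_im_ne_zero ht.ne' _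
  have hZ : Z s₀ ≠ 0 := by
    rw [Z_apply hs₁]
    exact mul_ne_zero (sub_ne_zero.mpr hs₁) (riemannZeta_add_mul_I_ne_zero hord _)
  obtain ⟨ℓ, hℓ⟩ := exists_tendsto_of_Z_ne_zero hM (re_add_mul_I _ _) hZ
  have hline := tendsto_add_mul_I_nhdsWithin (1 / 2) t
  have hslit : s₀ - 1 ∈ Complex.slitPlane := by
    rw [Complex.mem_slitPlane_iff]
    exact .inr (by simpa [hs₀] using ht.ne')
  have hlog : Tendsto (fun z => Complex.log (z - 1)) (𝓝[{z | 1 / 2 < z.re}] s₀)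
      (𝓝 (Complex.log (s₀ - 1))) :=
    ((continuousAt_id.sub continuousAt_const).clog hslit).tendsto.mono_left nhdsWithin_le_nhds
  exact ⟨_, (Complex.continuous_im.tendsto _).comp ((hℓ.sub hlog).comp hline)⟩

lemma tendsto_logZeta_im (hM : IsLogZ M) {t : ℝ} (ht : 0 < t) (hord : ¬ IsOrdinate t) :
    Tendsto (fun σ : ℝ => (logZeta M (σ + t * Complex.I)).im) (𝓝[>] (1 / 2)) (𝓝 (argZeta t)) := by
  obtain ⟨a, ha⟩ := exists_tendsto_logZeta_im hM ht hord
  have hζ : ContinuousAt (fun σ : ℝ => riemannZeta (σ + t * Complex.I)) (1 / 2) :=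
    (differentiableAt_riemannZeta (add_mul_I_ne_one_of_im_ne_zero ht.ne' _)).continuousAt.comp
      (f := fun σ : ℝ => (σ : ℂ) + t * Complex.I) (by fun_prop)
  have hzero : (logZeta M (2 + (0 : ℝ) * Complex.I)).im = 0 := by
    have h := logZeta_im_ofReal hM (v := 2) (by norm_num)
    rw [if_neg (by norm_num)] at h
    simpa using h
  have harg : IsArgAlongPath t a := isArgAlongPath_iff.mpr ⟨_, _,
    isContinuousArg_logZeta_vertical hM t,
    (isContinuousArg_logZeta_horizontal hM ht).update_left (by norm_num) hζ.continuousWithinAt ha,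
    hzero, by rw [Function.update_of_ne (by norm_num)]; norm_num, Function.update_self _ _ _⟩
  rwa [harg.argZeta_eq ht.le hord]

lemma countable_setOf_isOrdinate : {t : ℝ | IsOrdinate t}.Countable := by
  have hdiscrete : DiscreteTopology riemannZetaZeros := isDiscrete_riemannZetaZeros.to_subtype
  have hzeros : riemannZetaZeros.Countable :=
    Set.countable_coe_iff.mp (TopologicalSpace.separableSpace_iff_countable.mp inferInstance)
  refine (hzeros.image Complex.im).mono ?_
  rintro t ⟨σ, h⟩
  exact ⟨_, h, im_add_mul_I σ t⟩

lemma ae_tendsto_logZeta_im (hM : IsLogZ M) : ∀ᵐ t : ℝ, 0 < t →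
    Tendsto (fun σ : ℝ => (logZeta M (σ + t * Complex.I)).im) (𝓝[>] (1 / 2))
      (𝓝 (Real.pi * S t)) := by
  filter_upwards [countable_setOf_isOrdinate.ae_notMem volume] with t (hord : ¬ IsOrdinate t) ht
  rw [S, if_neg hord, ← mul_assoc, mul_one_div_cancel Real.pi_ne_zero, one_mul]
  exact tendsto_logZeta_im hM ht hord

/-! ### Iterated horizontal integrals of `log ζ` -/

/-- The iterated horizontal integrals of `log ζ`. -/
def iterInt (M : ℂ → ℂ) : ℕ → ℂ → ℂ
  | 0 => logZeta M
  | n + 1 => horInt (iterInt M n)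

lemma horAdmissible_iterInt (hM : IsLogZ M) : ∀ n, HorAdmissible (iterInt M n)
  | 0 => horAdmissible_logZeta hM
  | n + 1 => (horAdmissible_iterInt hM n).horInt

lemma HorAdmissible.continuousOn_vertical {Φ : ℂ → ℂ} (h : HorAdmissible Φ) {σ : ℝ}
    (hσ : 1 / 2 < σ) (hσ1 : σ ≠ 1) :
    ContinuousOn (fun τ : ℝ => Φ (σ + τ * Complex.I)) (Set.Ici 0) := by
  refine h.continuousOn.comp (by fun_prop) fun τ hτ => ⟨?_, ?_, add_mul_I_ne_one hσ1⟩
  · rwa [re_add_mul_I]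
  · rwa [im_add_mul_I]

lemma HorAdmissible.continuousOn_horInt_vertical {Φ : ℂ → ℂ} (h : HorAdmissible Φ) {σ : ℝ}
    (hσ : 1 / 2 ≤ σ) :
    ContinuousOn (fun τ : ℝ => ZetaSn.horInt Φ (σ + τ * Complex.I)) (Set.Ici 0) := by
  refine h.continuousOn_horInt.comp (by fun_prop) fun τ hτ => ⟨?_, ?_⟩
  · rwa [re_add_mul_I]
  · rwa [im_add_mul_I]

lemma HorAdmissible.continuousOn_horInt_horizontal {Φ : ℂ → ℂ} (h : HorAdmissible Φ) {t : ℝ}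
    (ht : 0 ≤ t) :
    ContinuousOn (fun σ : ℝ => ZetaSn.horInt Φ (σ + t * Complex.I)) (Set.Ici (1 / 2)) := by
  refine h.continuousOn_horInt.comp (by fun_prop) fun σ hσ => ⟨?_, ?_⟩
  · rwa [re_add_mul_I]
  · rwa [im_add_mul_I]

/-- The imaginary part of `i^n` times the `n`-fold horizontal integral of `log ζ`. Its boundary
values on the critical line are those of `π S_n`. -/
def phase (M : ℂ → ℂ) (n : ℕ) (σ t : ℝ) : ℝ :=
  (Complex.I ^ n * iterInt M n (σ + t * Complex.I)).im

lemma abs_phase_le (M : ℂ → ℂ) (n : ℕ) (σ t : ℝ) :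
    |phase M n σ t| ≤ ‖iterInt M n (σ + t * Complex.I)‖ := by
  refine (Complex.abs_im_le_norm _).trans ?_
  rw [norm_mul, norm_pow, Complex.norm_I, one_pow, one_mul]

lemma exists_abs_phase_le (hM : IsLogZ M) (n : ℕ) (T : ℝ) :
    ∃ K : ℝ, ∀ σ : ℝ, 1 / 2 < σ → σ ≤ 2 → ∀ t : ℝ, 0 ≤ t → t ≤ T → |phase M n σ t| ≤ K := by
  rcases n with _ | n
  · obtain ⟨K, -, hK⟩ := exists_logGrowthBound_on_rect hM T
    refine ⟨K + Real.pi, fun σ hσ hσ2 t ht htT => ?_⟩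
    have him := (hK (σ + t * Complex.I) (by rwa [re_add_mul_I]) (by rwa [re_add_mul_I])
      (by rwa [im_add_mul_I]) (by rwa [im_add_mul_I])).abs_im_le
    rw [phase, pow_zero, one_mul, iterInt, logZeta, Complex.sub_im, Complex.log_im]
    exact (abs_sub _ _).trans (add_le_add him (Complex.abs_arg_le_pi _))
  · obtain ⟨K, hK0, hK⟩ := (horAdmissible_iterInt hM n).exists_norm_horInt_le T
    refine ⟨K, fun σ hσ _ t ht htT => (abs_phase_le _ _ _ _).trans
      ((hK σ hσ.le t ht htT).trans ?_)⟩
    exact mul_le_of_le_one_right hK0 (Real.exp_le_one_iff.mpr (by linarith))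

lemma continuousOn_phase (hM : IsLogZ M) (n : ℕ) {σ : ℝ} (hσ : 1 / 2 < σ) (hσ1 : σ ≠ 1) :
    ContinuousOn (phase M n σ) (Set.Ici 0) :=
  Complex.continuous_im.comp_continuousOn
    (continuousOn_const.mul ((horAdmissible_iterInt hM n).continuousOn_vertical hσ hσ1))

lemma tendsto_phase_succ (hM : IsLogZ M) (n : ℕ) {t : ℝ} (ht : 0 ≤ t) :
    Tendsto (fun σ => phase M (n + 1) σ t) (𝓝[>] (1 / 2)) (𝓝 (phase M (n + 1) (1 / 2) t)) := by
  have hcont : ContinuousOn (fun σ : ℝ => phase M (n + 1) σ t) (Set.Ici (1 / 2)) :=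
    Complex.continuous_im.comp_continuousOn
      (continuousOn_const.mul ((horAdmissible_iterInt hM n).continuousOn_horInt_horizontal ht))
  exact (hcont (1 / 2) Set.self_mem_Ici).mono_left (nhdsWithin_mono _ Set.Ioi_subset_Ici_self)

-- Moving up by `dt` multiplies the derivative `-iterInt M n` by `i`, which `i ^ n` absorbs.
lemma hasDerivAt_phase_succ (hM : IsLogZ M) (n : ℕ) {σ t : ℝ} (hσ : 1 / 2 < σ) (ht : 0 < t) :
    HasDerivAt (phase M (n + 1) σ) (phase M n σ t) t := by
  have hprimitive := (horAdmissible_iterInt hM n).hasDerivAt_horInt (s := σ + t * Complex.I)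
    (by rwa [re_add_mul_I]) (by rwa [im_add_mul_I])
  have hline : HasDerivAt (fun w : ℂ => (σ : ℂ) + w * Complex.I) Complex.I (t : ℂ) := by
    simpa using ((hasDerivAt_id (t : ℂ)).mul_const Complex.I).const_add (σ : ℂ)
  refine (Complex.imCLM.hasFDerivAt.comp_hasDerivAt t
    ((hprimitive.comp (t : ℂ) hline).const_mul (Complex.I ^ (n + 1))).comp_ofReal).congr_deriv ?_
  rw [Complex.imCLM_apply, phase]
  congr 1
  rw [pow_succ]
  linear_combination (-Complex.I ^ n * iterInt M n (σ + t * Complex.I)) * Complex.I_mul_I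

lemma integral_phase (hM : IsLogZ M) (n : ℕ) {σ t : ℝ} (hσ : 1 / 2 < σ) (hσ1 : σ ≠ 1)
    (ht : 0 ≤ t) :
    ∫ τ in (0 : ℝ)..t, phase M n σ τ = phase M (n + 1) σ t - phase M (n + 1) σ 0 := by
  refine intervalIntegral.integral_eq_sub_of_hasDerivAt_of_le ht ?_
    (fun τ hτ => hasDerivAt_phase_succ hM n hσ hτ.1) ?_
  · exact (Complex.continuous_im.comp_continuousOn (continuousOn_const.mul
      ((horAdmissible_iterInt hM n).continuousOn_horInt_vertical hσ.le))).mono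
      Set.Icc_subset_Ici_self
  · refine ((continuousOn_phase hM n hσ hσ1).mono ?_).intervalIntegrable
    rw [Set.uIcc_of_le ht]
    exact Set.Icc_subset_Ici_self

lemma iterInt_succ_ofReal (M : ℂ → ℂ) (n : ℕ) (v : ℝ) :
    iterInt M (n + 1) v = ∫ u in Set.Ioi v, iterInt M n u := by
  simp [iterInt, horInt]

lemma integrableOn_iterInt_ofReal (hM : IsLogZ M) (n : ℕ) {v : ℝ} (hv : 1 / 2 ≤ v) :
    IntegrableOn (fun u : ℝ => iterInt M n u) (Set.Ioi v) := by
  have hint := (horAdmissible_iterInt hM n).integrableOn le_rfl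
  simp only [Complex.ofReal_zero, zero_mul, add_zero] at hint
  exact hint.mono_set (Set.Ioi_subset_Ioi hv)

lemma iterInt_ofReal_re (hM : IsLogZ M) {n : ℕ} {v : ℝ} (hv : 1 / 2 ≤ v)
    (hv₀ : n = 0 → v ≠ 1 / 2 ∧ v ≠ 1) : (iterInt M n v).re = iterLogZeta n v := by
  induction n generalizing v with
  | zero =>
    obtain ⟨hhalf, hone⟩ := hv₀ rfl
    exact logZeta_re hM (by simpa using hv.lt_of_ne' hhalf) (by exact_mod_cast hone)
  | succ n ih =>
    rw [iterInt_succ_ofReal, iterLogZeta]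
    refine (integral_re (integrableOn_iterInt_ofReal hM n hv)).symm.trans (integral_congr_ae ?_)
    filter_upwards [ae_restrict_mem measurableSet_Ioi, ae_restrict_ne _ 1] with u hu hu1
    exact ih (hv.trans (le_of_lt hu)) fun _ => ⟨(hv.trans_lt hu).ne', hu1⟩

-- The pole of `ζ` makes `log ζ` have imaginary part `-π` on `(1/2, 1)`: the source of `δ_{2k}`.
lemma iterInt_ofReal_im (hM : IsLogZ M) {n : ℕ} {v : ℝ} (hv : 1 / 2 ≤ v)
    (hv₀ : n = 0 → v ≠ 1 / 2) :
    (iterInt M n v).im = if v < 1 then -(Real.pi * iterOne n v) else 0 := by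
  induction n generalizing v with
  | zero => simpa [iterInt, iterOne] using logZeta_im_ofReal hM (hv.lt_of_ne' (hv₀ rfl))
  | succ n ih =>
    have him : (iterInt M (n + 1) v).im =
        ∫ u in Set.Ioi v, Set.indicator (Set.Iio 1) (fun u => -(Real.pi * iterOne n u)) u := by
      rw [iterInt_succ_ofReal]
      refine (integral_im (integrableOn_iterInt_ofReal hM n hv)).symm.trans
        (setIntegral_congr_fun measurableSet_Ioi fun u hu => ?_)
      refine (ih (hv.trans (le_of_lt hu)) fun _ => (hv.trans_lt hu).ne').trans ?_
      simp [Set.indicator_apply]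
    rw [him, setIntegral_indicator measurableSet_Iio, Set.Ioi_inter_Iio]
    split_ifs with hv1
    · rw [← integral_Ioc_eq_integral_Ioo, ← intervalIntegral.integral_of_le hv1.le,
        intervalIntegral.integral_neg, intervalIntegral.integral_const_mul, iterOne]
    · rw [Set.Ioo_eq_empty hv1, setIntegral_empty]

lemma phase_half_zero (hM : IsLogZ M) {n : ℕ} (hn : n ≠ 0) :
    phase M n (1 / 2) 0 = Real.pi * δ n := by
  have hsign : ∀ k : ℕ, (-1 : ℂ) ^ k = ((-1 : ℝ) ^ k : ℝ) := fun k => by push_cast; rfl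
  rw [phase, Complex.ofReal_zero, zero_mul, add_zero, δ]
  rcases n.even_or_odd' with ⟨k, rfl | rfl⟩
  · obtain ⟨j, rfl⟩ := Nat.exists_eq_succ_of_ne_zero (show k ≠ 0 by omega)
    rw [if_neg (by simp), show (2 * j.succ - 1) / 2 = j by omega, pow_mul, Complex.I_sq, hsign,
      Complex.im_ofReal_mul, iterInt_ofReal_im hM le_rfl (by omega), if_pos (by norm_num), pow_succ]
    ring
  · rw [if_pos (by simp), show (2 * k + 1 - 1) / 2 = k by omega, pow_succ, pow_mul, Complex.I_sq,
      hsign, mul_assoc, Complex.im_ofReal_mul, Complex.I_mul_im,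
      iterInt_ofReal_re hM le_rfl (by omega)]
    field_simp

lemma tendsto_integral_phase (hM : IsLogZ M) (n : ℕ) {t : ℝ} (ht : 0 ≤ t) {w : ℝ → ℝ}
    (hlim : ∀ᵐ τ : ℝ, 0 < τ → Tendsto (fun σ => phase M n σ τ) (𝓝[>] (1 / 2)) (𝓝 (w τ))) :
    Tendsto (fun σ => ∫ τ in (0 : ℝ)..t, phase M n σ τ) (𝓝[>] (1 / 2))
      (𝓝 (∫ τ in (0 : ℝ)..t, w τ)) := by
  obtain ⟨K, hK⟩ := exists_abs_phase_le hM n t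
  refine intervalIntegral.tendsto_integral_filter_of_dominated_convergence (fun _ => K) ?_ ?_
    intervalIntegrable_const ?_
  · filter_upwards [Ioo_mem_nhdsGT one_half_lt_one] with σ hσ
    refine ((continuousOn_phase hM n hσ.1 hσ.2.ne).mono ?_).aestronglyMeasurable measurableSet_uIoc
    rw [Set.uIoc_of_le ht]
    exact fun τ hτ => hτ.1.le
  · filter_upwards [Ioo_mem_nhdsGT one_half_lt_one] with σ hσ
    refine ae_of_all _ fun τ hτ => ?_
    rw [Set.uIoc_of_le ht] at hτ
    exact hK σ hσ.1 (hσ.2.le.trans one_le_two) τ hτ.1.le hτ.2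
  · filter_upwards [hlim] with τ h hτ
    rw [Set.uIoc_of_le ht] at hτ
    exact h hτ.1

lemma phase_succ_half_eq (hM : IsLogZ M) (n : ℕ) {t : ℝ} (ht : 0 ≤ t)
    (hlim : ∀ᵐ τ : ℝ, 0 < τ →
      Tendsto (fun σ => phase M n σ τ) (𝓝[>] (1 / 2)) (𝓝 (Real.pi * Sn n τ))) :
    phase M (n + 1) (1 / 2) t = Real.pi * Sn (n + 1) t := by
  have hdiff := (tendsto_phase_succ hM n ht).sub (tendsto_phase_succ hM n le_rfl)
  have hint := tendsto_nhds_unique (hdiff.congr' (by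
    filter_upwards [Ioo_mem_nhdsGT one_half_lt_one] with σ hσ
    exact (integral_phase hM n hσ.1 hσ.2.ne ht).symm)) (tendsto_integral_phase hM n ht hlim)
  rw [intervalIntegral.integral_const_mul, phase_half_zero hM n.succ_ne_zero] at hint
  rw [Sn, mul_add, ← hint, sub_add_cancel]

lemma ae_tendsto_phase (hM : IsLogZ M) (n : ℕ) : ∀ᵐ τ : ℝ, 0 < τ →
    Tendsto (fun σ => phase M n σ τ) (𝓝[>] (1 / 2)) (𝓝 (Real.pi * Sn n τ)) := by
  induction n with
  | zero =>
    filter_upwards [ae_tendsto_logZeta_im hM] with τ h hτ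
    simpa [phase, iterInt, Sn] using h hτ
  | succ n ih =>
    refine ae_of_all _ fun τ hτ => ?_
    rw [← phase_succ_half_eq hM n hτ.le ih]
    exact tendsto_phase_succ hM n hτ.le

lemma Sn_eq_phase (hM : IsLogZ M) {n : ℕ} (hn : n ≠ 0) {t : ℝ} (ht : 0 ≤ t) :
    Sn n t = 1 / Real.pi * phase M n (1 / 2) t := by
  obtain ⟨k, rfl⟩ := Nat.exists_eq_succ_of_ne_zero hn
  rw [phase_succ_half_eq hM k ht (ae_tendsto_phase hM k)]
  field_simp

/-! ### Growth in vertical direction -/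

lemma abscissa_mangoldt_le (j : ℕ) : LSeries.abscissaOfAbsConv
    (fun k => ((vonMangoldt k / Real.log k ^ (j + 1) : ℝ) : ℂ)) ≤ 1 :=
  LSeries.abscissaOfAbsConv_le_of_le_const ⟨_, fun k _ => norm_mangoldt_div_le j k⟩

lemma hasDerivAt_mangoldtSeries (j : ℕ) {s : ℂ} (hs : 1 < s.re) :
    HasDerivAt (mangoldtSeries (j + 2)) (-mangoldtSeries (j + 1) s) s := by
  have hderiv := LSeries_hasDerivAt (lt_of_le_of_lt (abscissa_mangoldt_le (j + 1))
    (by exact_mod_cast hs : (1 : EReal) < s.re))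
  refine hderiv.congr_deriv (congrArg Neg.neg (LSeries_congr (fun {k} _ => ?_) s))
  rw [LSeries.logMul, ← Complex.natCast_log, ← Complex.ofReal_mul]
  congr 1
  rcases eq_or_ne (Real.log k) 0 with hlog | hlog
  · have hΛ : vonMangoldt k = 0 := le_antisymm (hlog ▸ ArithmeticFunction.vonMangoldt_le_log)
      ArithmeticFunction.vonMangoldt_nonneg
    rw [hΛ, zero_div, zero_div, mul_zero]
  · rw [pow_succ _ (j + 1)]
    field_simp

lemma tendsto_mangoldtSeries (j : ℕ) (t : ℝ) :
    Tendsto (fun v : ℝ => mangoldtSeries (j + 1) (v + t * Complex.I)) atTop (𝓝 0) := by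
  have hbound : Tendsto (fun v : ℝ => (∑' k : ℕ, ((k : ℝ) ^ 2)⁻¹) *
      ((Real.log 2 ^ j)⁻¹ * (Real.exp 1 * Real.exp (-(v / 2))))) atTop (𝓝 0) := by
    simpa using ((tendsto_exp_neg_half_atTop.const_mul (Real.exp 1)).const_mul
      (Real.log 2 ^ j)⁻¹).const_mul (∑' k : ℕ, ((k : ℝ) ^ 2)⁻¹)
  refine squeeze_zero_norm' ?_ hbound
  filter_upwards [eventually_ge_atTop 2] with v hv
  have hle := norm_lseries_le_of_two_le_re (s := v + t * Complex.I) (norm_mangoldt_div_le j)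
    (by simp) (by rwa [re_add_mul_I])
  rwa [re_add_mul_I, sub_eq_add_neg, Real.exp_add] at hle

lemma iterInt_eq_mangoldtSeries (hM : IsLogZ M) (n : ℕ) {σ t : ℝ} (hσ : 1 < σ) (ht : 0 ≤ t) :
    iterInt M n (σ + t * Complex.I) = mangoldtSeries (n + 1) (σ + t * Complex.I) := by
  induction n generalizing σ with
  | zero => exact logZeta_eq_mangoldtSeries hM (by rwa [re_add_mul_I])
  | succ n ih =>
    have hint : IntegrableOn (fun v : ℝ => iterInt M n (v + t * Complex.I)) (Set.Ioi σ) :=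
      ((horAdmissible_iterInt hM n).integrableOn ht).mono_set (Set.Ioi_subset_Ioi (by linarith))
    have hderiv : ∀ v ∈ Set.Ici σ,
        HasDerivAt (fun v : ℝ => -mangoldtSeries (n + 2) (v + t * Complex.I))
          (iterInt M n (v + t * Complex.I)) v := fun v hv => by
      have hline : HasDerivAt (fun w : ℂ => w + t * Complex.I) 1 (v : ℂ) :=
        (hasDerivAt_id _).add_const _
      have hseries := hasDerivAt_mangoldtSeries n (s := v + t * Complex.I)
        (by rw [re_add_mul_I]; exact hσ.trans_le hv)
      refine ((hseries.comp (v : ℂ) hline).comp_ofReal.neg).congr_deriv ?_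
      rw [ih (hσ.trans_le hv), mul_one, neg_neg]
    rw [iterInt, horInt, re_add_mul_I, im_add_mul_I, integral_Ioi_of_hasDerivAt_of_tendsto' hderiv
      hint (tendsto_mangoldtSeries (n + 1) t).neg, neg_zero, zero_sub, neg_neg]

lemma norm_le_of_re_le_on_ball {F : ℂ → ℂ} {c z : ℂ} {A R : ℝ} (hA : 0 < A)
    (hF : DifferentiableOn ℂ F (Metric.ball c R)) (hre : ∀ s ∈ Metric.ball c R, (F s).re ≤ A)
    (hz : z ∈ Metric.ball c R) :
    ‖F z‖ ≤ (2 * A * ‖z - c‖ + ‖F c‖ * (R + ‖z - c‖)) / (R - ‖z - c‖) := by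
  have hmaps : Set.MapsTo (fun w : ℂ => c + w) (Metric.ball 0 R) (Metric.ball c R) := fun w hw => by
    simpa using hw
  have hbc := Complex.borelCaratheodory (f := fun w => F (c + w)) (z := z - c) hA
    (hF.comp (by fun_prop) hmaps) (fun w hw => hre _ (hmaps hw)) (Metric.pos_of_mem_ball hz)
    (by simpa [← dist_eq_norm] using hz)
  rwa [add_sub_cancel, add_zero, ← add_div] at hbc

section BorelCaratheodory

variable {t : ℝ} {s : ℂ}

lemma half_lt_re_of_mem_ball (hs : s ∈ Metric.ball (2 + t * Complex.I) (3 / 2)) : 1 / 2 < s.re := by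
  have hre := (Complex.abs_re_le_norm _).trans_lt (mem_ball_iff_norm.mp hs)
  rw [Complex.sub_re, ← Complex.ofReal_ofNat, re_add_mul_I] at hre
  linarith [(abs_lt.mp hre).1]

lemma half_lt_im_of_mem_ball (ht : 2 ≤ t) (hs : s ∈ Metric.ball (2 + t * Complex.I) (3 / 2)) :
    1 / 2 < s.im := by
  have him := (Complex.abs_im_le_norm _).trans_lt (mem_ball_iff_norm.mp hs)
  rw [Complex.sub_im, ← Complex.ofReal_ofNat, im_add_mul_I] at him
  linarith [(abs_lt.mp him).1]

lemma norm_le_of_mem_ball (ht : 0 ≤ t) (hs : s ∈ Metric.ball (2 + t * Complex.I) (3 / 2)) :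
    ‖s‖ ≤ t + 4 := by
  have hcenter : ‖(2 + t * Complex.I : ℂ)‖ ≤ 2 + t := by
    refine (norm_add_le _ _).trans_eq ?_
    rw [norm_mul, Complex.norm_I, mul_one, Complex.norm_of_nonneg ht, Complex.norm_ofNat]
  linarith [norm_le_norm_sub_add s (2 + t * Complex.I), mem_ball_iff_norm.mp hs]

lemma norm_zeta_le (ht : 2 ≤ t) (hs : s ∈ Metric.ball (2 + t * Complex.I) (3 / 2)) :
    ‖riemannZeta s‖ ≤ t ^ 9 := by
  have him := half_lt_im_of_mem_ball ht hs
  have hsub : 1 / 2 ≤ ‖s - 1‖ := by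
    have habs := (le_abs_self _).trans (Complex.abs_im_le_norm (s - 1))
    rw [Complex.sub_im, Complex.one_im, sub_zero] at habs
    linarith
  have hne : s ≠ 1 := fun h => by norm_num [h] at him
  have hZ : ‖s - 1‖ * ‖riemannZeta s‖ ≤ 3 * (1 + ‖s‖) ^ 2 := by
    rw [← norm_mul, ← Z_apply hne]
    exact norm_Z_le (half_lt_re_of_mem_ball hs).le
  have hhalf : 1 / 2 * ‖riemannZeta s‖ ≤ 3 * (4 * t) ^ 2 := by
    calc _ ≤ ‖s - 1‖ * ‖riemannZeta s‖ := by gcongr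
      _ ≤ 3 * (1 + ‖s‖) ^ 2 := hZ
      _ ≤ _ := by
        gcongr
        linarith [norm_le_of_mem_ball (zero_le_two.trans ht) hs]
  calc ‖riemannZeta s‖ ≤ 2 ^ 7 * t ^ 2 := by nlinarith
    _ ≤ t ^ 7 * t ^ 2 := by gcongr
    _ = t ^ 9 := by ring

lemma differentiableOn_logZeta_ball (hM : IsLogZ M) (ht : 2 ≤ t) :
    DifferentiableOn ℂ (logZeta M) (Metric.ball (2 + t * Complex.I) (3 / 2)) := fun s hs => by
  refine (differentiableAt_logZeta hM (half_lt_re_of_mem_ball hs) ?_).differentiableWithinAt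
  rw [Complex.mem_slitPlane_iff, Complex.sub_im, Complex.one_im, sub_zero]
  exact .inr (by linarith [half_lt_im_of_mem_ball ht hs])

lemma logZeta_re_le (hM : IsLogZ M) (ht : 2 ≤ t)
    (hs : s ∈ Metric.ball (2 + t * Complex.I) (3 / 2)) : (logZeta M s).re ≤ 9 * Real.log t := by
  have hre := half_lt_re_of_mem_ball hs
  have hne : s ≠ 1 := fun h => by
    have him := half_lt_im_of_mem_ball ht hs
    norm_num [h] at him
  have hζ : riemannZeta s ≠ 0 := exp_logZeta hM hre hne ▸ Complex.exp_ne_zero _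
  have hlog := Real.log_le_log (norm_pos_iff.mpr hζ) (norm_zeta_le ht hs)
  rwa [Real.log_pow, ← logZeta_re hM hre hne] at hlog

-- The ball of radius `3/2` around `2 + it` touches the critical line, so Borel–Carathéodory costs
-- a factor `(σ - 1/2)⁻¹`.
lemma norm_logZeta_le_of_le_two (hM : IsLogZ M) (ht : 2 ≤ t) {K σ : ℝ}
    (hK : ‖logZeta M (2 + t * Complex.I)‖ ≤ K) (hσ : 1 / 2 < σ) (hσ2 : σ ≤ 2) :
    ‖logZeta M (σ + t * Complex.I)‖ ≤ (27 + 6 * K) * Real.log t * (σ - 1 / 2)⁻¹ := by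
  have hlog := half_le_log ht
  have hK₀ : 0 ≤ K := (norm_nonneg _).trans hK
  have hnorm : ‖(σ + t * Complex.I : ℂ) - (2 + t * Complex.I)‖ = 2 - σ := by
    rw [add_sub_add_right_eq_sub, norm_sub_rev, ← Complex.ofReal_ofNat, ← Complex.ofReal_sub,
      Complex.norm_of_nonneg (by linarith)]
  have hbc := norm_le_of_re_le_on_ball (A := 9 * Real.log t) (by linarith)
    (differentiableOn_logZeta_ball hM ht) (fun s hs => logZeta_re_le hM ht hs)
    (z := σ + t * Complex.I) (by rw [mem_ball_iff_norm, hnorm]; linarith)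
  rw [hnorm, show (3 / 2 : ℝ) - (2 - σ) = σ - 1 / 2 by ring] at hbc
  refine hbc.trans ?_
  rw [div_eq_mul_inv]
  refine mul_le_mul_of_nonneg_right ?_ (inv_nonneg.mpr (by linarith))
  calc 2 * (9 * Real.log t) * (2 - σ) + ‖logZeta M (2 + t * Complex.I)‖ * (3 / 2 + (2 - σ))
      ≤ 2 * (9 * Real.log t) * (3 / 2) + K * 3 := by gcongr <;> linarith
    _ ≤ (27 + 6 * K) * Real.log t := by nlinarith

end BorelCaratheodory

lemma exp_neg_half_le {σ : ℝ} (hσ : 1 / 2 < σ) :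
    Real.exp (-(σ / 2)) ≤ 4 * ((σ - 1 / 2)⁻¹ * Real.exp (-((σ - 1 / 2) / 4))) := by
  set y := σ - 1 / 2 with hy
  have hy₀ : 0 < y := sub_pos.mpr hσ
  have hinv : Real.exp (-(y / 4)) ≤ 4 * y⁻¹ := by
    rw [Real.exp_neg, show 4 * y⁻¹ = (y / 4)⁻¹ by field_simp]
    exact inv_anti₀ (by positivity) (by linarith [Real.add_one_le_exp (y / 4)])
  calc Real.exp (-(σ / 2)) ≤ Real.exp (-(y / 4)) * Real.exp (-(y / 4)) := by
        rw [← Real.exp_add]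
        exact Real.exp_le_exp.mpr (by linarith)
    _ ≤ 4 * y⁻¹ * Real.exp (-(y / 4)) := by gcongr
    _ = _ := by ring

lemma exists_norm_logZeta_le_log (hM : IsLogZ M) :
    ∃ K : ℝ, 0 ≤ K ∧ ∀ t : ℝ, 2 ≤ t → ∀ σ : ℝ, 1 / 2 < σ →
      ‖logZeta M (σ + t * Complex.I)‖ ≤
        K * Real.log t * ((σ - 1 / 2)⁻¹ * Real.exp (-((σ - 1 / 2) / 4))) := by
  obtain ⟨K, hK₀, hK⟩ := exists_norm_logZeta_le hM
  refine ⟨2 * (27 + 6 * K) + 8 * K, by positivity, fun t ht σ hσ => ?_⟩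
  have hlog := half_le_log ht
  have : 0 < (σ - 1 / 2)⁻¹ := inv_pos.mpr (sub_pos.mpr hσ)
  set E := Real.exp (-((σ - 1 / 2) / 4))
  rcases le_or_gt σ 2 with hσ2 | hσ2
  · have hcenter : ‖logZeta M (2 + t * Complex.I)‖ ≤ K :=
      (hK _ (by simp)).trans (mul_le_of_le_one_right hK₀ (Real.exp_le_one_iff.mpr (by simp)))
    have hhalf : 1 / 2 ≤ E := by linarith [Real.add_one_le_exp (-((σ - 1 / 2) / 4))]
    calc _ ≤ (27 + 6 * K) * Real.log t * (σ - 1 / 2)⁻¹ :=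
          norm_logZeta_le_of_le_two hM ht hcenter hσ hσ2
      _ = 2 * (27 + 6 * K) * Real.log t * ((σ - 1 / 2)⁻¹ * (1 / 2)) := by ring
      _ ≤ (2 * (27 + 6 * K) + 8 * K) * Real.log t * ((σ - 1 / 2)⁻¹ * E) := by
        gcongr
        linarith
  · have hfar := hK (σ + t * Complex.I) (by rw [re_add_mul_I]; exact hσ2.le)
    rw [re_add_mul_I] at hfar
    calc _ ≤ K * (4 * ((σ - 1 / 2)⁻¹ * E)) := hfar.trans (by gcongr; exact exp_neg_half_le hσ)
      _ = 8 * K * (1 / 2) * ((σ - 1 / 2)⁻¹ * E) := by ring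
      _ ≤ (2 * (27 + 6 * K) + 8 * K) * Real.log t * ((σ - 1 / 2)⁻¹ * E) := by
        gcongr
        linarith

/-- The weight `y^{-1/2} e^{-y/8}`, integrable on the positive half-line. With `y = σ - 1/2` it
dominates the iterated horizontal integrals of `log ζ` up to the critical line. -/
def halfWeight (y : ℝ) : ℝ := y ^ (-(1 / 2) : ℝ) * Real.exp (-(1 / 8) * y)

lemma halfWeight_nonneg {y : ℝ} (hy : 0 ≤ y) : 0 ≤ halfWeight y :=
  mul_nonneg (Real.rpow_nonneg hy _) (Real.exp_pos _).le

lemma halfWeight_anti {y u : ℝ} (hy : 0 < y) (hyu : y ≤ u) : halfWeight u ≤ halfWeight y :=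
  mul_le_mul (Real.rpow_le_rpow_of_nonpos hy hyu (by norm_num))
    (Real.exp_le_exp.mpr (by linarith)) (Real.exp_pos _).le (Real.rpow_nonneg hy.le _)

lemma halfWeight_mul_self {u : ℝ} (hu : 0 < u) :
    halfWeight u * halfWeight u = u⁻¹ * Real.exp (-(u / 4)) := by
  rw [halfWeight, mul_mul_mul_comm, ← Real.rpow_add hu, ← Real.exp_add, ← Real.rpow_neg_one]
  ring_nf

lemma integrableOn_halfWeight : IntegrableOn halfWeight (Set.Ioi 0) := by
  have := integrableOn_rpow_mul_exp_neg_mul_rpow (s := -(1 / 2)) (p := 1) (b := 1 / 8)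
    (by norm_num) one_pos (by norm_num)
  refine this.congr_fun (fun y _ => ?_) measurableSet_Ioi
  simp only [halfWeight, Real.rpow_one]

lemma integrableOn_halfWeight_sub {σ : ℝ} (hσ : 1 / 2 ≤ σ) :
    IntegrableOn (fun v => halfWeight (v - 1 / 2)) (Set.Ioi σ) := by
  have h := ((measurePreserving_sub_right volume (1 / 2 : ℝ)).integrableOn_comp_preimage
    (measurableEmbedding_subRight (1 / 2 : ℝ))).mpr integrableOn_halfWeight
  rw [Set.preimage_sub_const_Ioi, zero_add] at h
  exact h.mono_set (Set.Ioi_subset_Ioi hσ)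

lemma integral_halfWeight_sub_le {σ : ℝ} (hσ : 1 / 2 < σ) :
    ∫ v in Set.Ioi σ, halfWeight (v - 1 / 2) ≤ 8 * halfWeight (σ - 1 / 2) := by
  have hexp : IntegrableOn (fun v : ℝ => Real.exp (-(1 / 8) * v)) (Set.Ioi σ) :=
    integrableOn_exp_mul_Ioi (by norm_num) σ
  have hshift : ∀ v : ℝ, Real.exp (-(1 / 8) * (v - 1 / 2)) =
      Real.exp (1 / 16) * Real.exp (-(1 / 8) * v) := fun v => by
    rw [← Real.exp_add]
    ring_nf
  calc ∫ v in Set.Ioi σ, halfWeight (v - 1 / 2)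
      ≤ ∫ v in Set.Ioi σ, (σ - 1 / 2) ^ (-(1 / 2) : ℝ) * Real.exp (1 / 16) *
          Real.exp (-(1 / 8) * v) := by
        refine setIntegral_mono_on (integrableOn_halfWeight_sub hσ.le) (hexp.const_mul _)
          measurableSet_Ioi fun v (hv : σ < v) => ?_
        rw [halfWeight, mul_assoc, ← hshift]
        gcongr ?_ * _
        exact Real.rpow_le_rpow_of_nonpos (by linarith) (by linarith) (by norm_num)
    _ = 8 * halfWeight (σ - 1 / 2) := by
        rw [integral_const_mul, integral_exp_mul_Ioi (by norm_num), halfWeight, hshift]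
        ring

lemma norm_horInt_le_mul_integral {Φ : ℂ → ℂ} {w : ℝ → ℝ} {σ t K : ℝ}
    (hw : IntegrableOn w (Set.Ioi σ)) (hΦ : ∀ v, σ < v → ‖Φ (v + t * Complex.I)‖ ≤ K * w v) :
    ‖horInt Φ (σ + t * Complex.I)‖ ≤ K * ∫ v in Set.Ioi σ, w v := by
  rw [horInt, re_add_mul_I, im_add_mul_I, ← integral_const_mul]
  refine norm_integral_le_of_norm_le (hw.const_mul _) ?_
  filter_upwards [ae_restrict_mem measurableSet_Ioi] with v hv using hΦ v hv

lemma exists_norm_iterInt_one_le (hM : IsLogZ M) :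
    ∃ K : ℝ, 0 ≤ K ∧ ∀ t : ℝ, 2 ≤ t → ∀ σ : ℝ, 1 / 2 < σ →
      ‖iterInt M 1 (σ + t * Complex.I)‖ ≤ K * Real.log t * halfWeight (σ - 1 / 2) := by
  obtain ⟨K, hK₀, hK⟩ := exists_norm_logZeta_le_log hM
  have hnonneg : ∀ v ∈ Set.Ioi (1 / 2 : ℝ), 0 ≤ halfWeight (v - 1 / 2) := fun v hv =>
    halfWeight_nonneg (sub_nonneg.mpr (le_of_lt hv))
  set G := ∫ v in Set.Ioi (1 / 2 : ℝ), halfWeight (v - 1 / 2)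
  have hG₀ : 0 ≤ G := setIntegral_nonneg measurableSet_Ioi hnonneg
  refine ⟨K * G, by positivity, fun t ht σ hσ => ?_⟩
  have hlog : 0 ≤ Real.log t := by linarith [half_le_log ht]
  have hw := hnonneg σ hσ
  calc ‖iterInt M 1 (σ + t * Complex.I)‖
      ≤ K * Real.log t * halfWeight (σ - 1 / 2) * ∫ v in Set.Ioi σ, halfWeight (v - 1 / 2) := by
        refine norm_horInt_le_mul_integral (integrableOn_halfWeight_sub hσ.le) fun v hv => ?_
        have hle : halfWeight (v - 1 / 2) ≤ halfWeight (σ - 1 / 2) :=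
          halfWeight_anti (sub_pos.mpr hσ) (by linarith)
        refine (hK t ht v (hσ.trans hv)).trans ?_
        rw [← halfWeight_mul_self (by linarith), mul_assoc (K * Real.log t)]
        gcongr
        exact hnonneg v (hσ.trans hv)
    _ ≤ K * Real.log t * halfWeight (σ - 1 / 2) * G := by
        gcongr
        exact setIntegral_mono_set (integrableOn_halfWeight_sub le_rfl)
          (ae_restrict_of_forall_mem measurableSet_Ioi hnonneg)
          (Set.Ioi_subset_Ioi hσ.le).eventuallyLE
    _ = _ := by ring

lemma exists_norm_iterInt_le (hM : IsLogZ M) (n : ℕ) :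
    ∃ K : ℝ, 0 ≤ K ∧ ∀ t : ℝ, 2 ≤ t → ∀ σ : ℝ, 1 / 2 < σ →
      ‖iterInt M (n + 1) (σ + t * Complex.I)‖ ≤ K * Real.log t * halfWeight (σ - 1 / 2) := by
  induction n with
  | zero => exact exists_norm_iterInt_one_le hM
  | succ n ih =>
    obtain ⟨K, hK₀, hK⟩ := ih
    refine ⟨8 * K, by positivity, fun t ht σ hσ => ?_⟩
    have hlog : 0 ≤ Real.log t := by linarith [half_le_log ht]
    calc ‖iterInt M (n + 2) (σ + t * Complex.I)‖
        ≤ K * Real.log t * ∫ v in Set.Ioi σ, halfWeight (v - 1 / 2) :=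
          norm_horInt_le_mul_integral (integrableOn_halfWeight_sub hσ.le) fun v hv =>
            hK t ht v (hσ.trans hv)
      _ ≤ K * Real.log t * (8 * halfWeight (σ - 1 / 2)) := by
          gcongr
          exact integral_halfWeight_sub_le hσ
      _ = 8 * K * Real.log t * halfWeight (σ - 1 / 2) := by ring

/-- The integral of `|Φ|` over the horizontal segment from `a + it` to `b + it`. -/
def segmentNorm (Φ : ℂ → ℂ) (a b t : ℝ) : ℝ := ∫ σ in a..b, ‖Φ (σ + t * Complex.I)‖

lemma segmentNorm_nonneg (Φ : ℂ → ℂ) {a b : ℝ} (hab : a ≤ b) (t : ℝ) : 0 ≤ segmentNorm Φ a b t :=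
  intervalIntegral.integral_nonneg hab fun _ _ => norm_nonneg _

lemma exists_segmentNorm_iterInt_le (hM : IsLogZ M) {n : ℕ} (hn : n ≠ 0) {c : ℝ} (hc : 1 / 2 ≤ c) :
    ∃ K : ℝ, 0 ≤ K ∧ ∀ t : ℝ, 2 ≤ t → segmentNorm (iterInt M n) (1 / 2) c t ≤ K * Real.log t := by
  obtain ⟨n, rfl⟩ := Nat.exists_eq_succ_of_ne_zero hn
  obtain ⟨K, hK₀, hK⟩ := exists_norm_iterInt_le hM n
  have hI : IntegrableOn (fun v => halfWeight (v - 1 / 2)) (Set.Ioc (1 / 2) c) :=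
    (integrableOn_halfWeight_sub le_rfl).mono_set Set.Ioc_subset_Ioi_self
  refine ⟨K * ∫ v in Set.Ioc (1 / 2) c, halfWeight (v - 1 / 2),
    mul_nonneg hK₀ (setIntegral_nonneg measurableSet_Ioc fun v hv =>
      halfWeight_nonneg (sub_nonneg.mpr hv.1.le)), fun t ht => ?_⟩
  rw [segmentNorm, intervalIntegral.integral_of_le hc]
  calc _ ≤ ∫ v in Set.Ioc (1 / 2) c, K * Real.log t * halfWeight (v - 1 / 2) := by
        refine setIntegral_mono_on ?_ (hI.const_mul _) measurableSet_Ioc fun v hv => hK t ht v hv.1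
        exact (((horAdmissible_iterInt hM (n + 1)).integrableOn (by linarith)).mono_set
          Set.Ioc_subset_Ioi_self).norm
    _ = _ := by
        rw [integral_const_mul]
        ring

lemma continuousOn_iterInt (hM : IsLogZ M) {n : ℕ} (hn : n ≠ 0) :
    ContinuousOn (iterInt M n) {s | 1 / 2 ≤ s.re ∧ 0 ≤ s.im} := by
  obtain ⟨n, rfl⟩ := Nat.exists_eq_succ_of_ne_zero hn
  exact (horAdmissible_iterInt hM n).continuousOn_horInt

/-! ### Moving the line of integration -/

/-- The integral of `Φ` against `e^{iqt}` along the vertical segment from `σ + ia` to `σ + ib`. -/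
def lineTransform (Φ : ℂ → ℂ) (q σ a b : ℝ) : ℂ :=
  ∫ t in a..b, Φ (σ + t * Complex.I) * Complex.exp (q * t * Complex.I)

section LineTransform

variable {Φ : ℂ → ℂ} {a b t₁ t₂ : ℝ}

lemma exp_mul_add_mul_I_sub (q σ a t : ℝ) :
    Complex.exp (q * (σ + t * Complex.I - a)) =
      Real.exp (q * (σ - a)) * Complex.exp (q * t * Complex.I) := by
  rw [Complex.ofReal_exp, ← Complex.exp_add]
  congr 1
  push_cast
  ring

lemma integral_vertical_mul_exp (Φ : ℂ → ℂ) (q σ a t₁ t₂ : ℝ) :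
    ∫ t in t₁..t₂, Φ (σ + t * Complex.I) * Complex.exp (q * (σ + t * Complex.I - a)) =
      Real.exp (q * (σ - a)) * lineTransform Φ q σ t₁ t₂ := by
  rw [lineTransform, ← intervalIntegral.integral_const_mul]
  refine intervalIntegral.integral_congr fun t _ => ?_
  simp only [exp_mul_add_mul_I_sub, mul_left_comm]

lemma norm_integral_horizontal_mul_exp_le (hab : a ≤ b) {t : ℝ}
    (hΦ : ContinuousOn (fun σ : ℝ => Φ (σ + t * Complex.I)) (Set.Icc a b)) (q : ℝ) :
    ‖∫ σ in a..b, Φ (σ + t * Complex.I) * Complex.exp (q * (σ + t * Complex.I - a))‖ ≤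
      Real.exp (|q| * (b - a)) * segmentNorm Φ a b t := by
  rw [segmentNorm, ← intervalIntegral.integral_const_mul]
  refine intervalIntegral.norm_integral_le_of_norm_le hab (ae_of_all _ fun σ hσ => ?_)
    ((hΦ.norm.intervalIntegrable_of_Icc hab).const_mul _)
  rw [exp_mul_add_mul_I_sub, norm_mul, norm_mul, ← Complex.ofReal_mul,
    Complex.norm_exp_ofReal_mul_I, mul_one, Complex.norm_of_nonneg (Real.exp_pos _).le, mul_comm]
  gcongr
  · linarith [hσ.1]
  · exact le_abs_self q
  · exact hσ.2

lemma norm_lineTransform_sub_le (hab : a ≤ b) (ht : t₁ ≤ t₂)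
    (hc : ContinuousOn Φ (Set.Icc a b ×ℂ Set.Icc t₁ t₂))
    (hd : DifferentiableOn ℂ Φ (Set.Ioo a b ×ℂ Set.Ioo t₁ t₂)) (q : ℝ) :
    ‖lineTransform Φ q a t₁ t₂ - Real.exp (q * (b - a)) * lineTransform Φ q b t₁ t₂‖ ≤
      Real.exp (|q| * (b - a)) * (segmentNorm Φ a b t₁ + segmentNorm Φ a b t₂) := by
  have hrect := Complex.integral_boundary_rect_eq_zero_of_continuousOn_of_differentiableOn
    (fun s => Φ s * Complex.exp (q * (s - a))) (a + t₁ * Complex.I) (b + t₂ * Complex.I)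
  simp only [re_add_mul_I, im_add_mul_I, min_eq_left hab, max_eq_right hab, min_eq_left ht,
    max_eq_right ht, Set.uIcc_of_le hab, Set.uIcc_of_le ht, smul_eq_mul,
    integral_vertical_mul_exp, sub_self, mul_zero, Real.exp_zero, Complex.ofReal_one,
    one_mul] at hrect
  have hrect := hrect (hc.mul (by fun_prop)) (hd.mul (by fun_prop))
  have hhor : ∀ t ∈ Set.Icc t₁ t₂,
      ‖∫ σ in a..b, Φ (σ + t * Complex.I) * Complex.exp (q * (σ + t * Complex.I - a))‖ ≤
        Real.exp (|q| * (b - a)) * segmentNorm Φ a b t := fun t ht =>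
    norm_integral_horizontal_mul_exp_le hab (hc.comp (f := fun σ : ℝ => (σ : ℂ) + t * Complex.I)
      (by fun_prop) fun σ hσ => by simpa [Complex.mem_reProdIm] using ⟨hσ, ht⟩) q
  refine (le_of_eq ?_).trans ((norm_sub_le _ _).trans ((add_le_add
    (hhor t₁ (Set.left_mem_Icc.mpr ht)) (hhor t₂ (Set.right_mem_Icc.mpr ht))).trans_eq
      (mul_add _ _ _).symm))
  rw [← one_mul ‖_ - _ * _‖, ← Complex.norm_I, ← norm_mul]
  congr 1
  linear_combination -hrect

end LineTransform

/-- The absolute value of the `k`-th term of `mangoldtSeries (n + 1)` on the line `Re s = c`. -/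
def termNorm (n : ℕ) (c : ℝ) (k : ℕ) : ℝ :=
  vonMangoldt k / Real.log k ^ (n + 1) * (k : ℝ) ^ (-c)

lemma termNorm_nonneg (n : ℕ) (c : ℝ) (k : ℕ) : 0 ≤ termNorm n c k :=
  mul_nonneg (div_nonneg ArithmeticFunction.vonMangoldt_nonneg
    (pow_nonneg (Real.log_natCast_nonneg k) _)) (Real.rpow_nonneg (Nat.cast_nonneg k) _)

lemma termNorm_eq_zero (n : ℕ) (c : ℝ) {k : ℕ} (hk : k < 2) : termNorm n c k = 0 := by
  have hΛ : vonMangoldt k = 0 := by interval_cases k <;> simp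
  rw [termNorm, hΛ, zero_div, zero_mul]

lemma term_mangoldt_eq (n : ℕ) (c t : ℝ) (k : ℕ) :
    LSeries.term (fun k => ((vonMangoldt k / Real.log k ^ (n + 1) : ℝ) : ℂ)) (c + t * Complex.I) k =
      termNorm n c k * Complex.exp ((-Real.log k : ℝ) * t * Complex.I) := by
  rcases eq_or_ne k 0 with rfl | hk
  · simp [termNorm]
  · rw [LSeries.term_of_ne_zero hk, termNorm, Complex.ofReal_mul,
      Complex.ofReal_cpow (Nat.cast_nonneg k), div_eq_mul_inv, ← Complex.cpow_neg, neg_add,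
      Complex.cpow_add _ _ (by exact_mod_cast hk), mul_assoc, ← natCast_cpow_neg_I_mul hk,
      mul_comm (t : ℂ), Complex.ofReal_neg, Complex.ofReal_natCast]

lemma norm_termNorm_mul_exp (n : ℕ) (c : ℝ) (k : ℕ) (q t : ℝ) :
    ‖(termNorm n c k : ℂ) * Complex.exp (q * t * Complex.I)‖ = termNorm n c k := by
  rw [norm_mul, ← Complex.ofReal_mul, Complex.norm_exp_ofReal_mul_I, mul_one,
    Complex.norm_of_nonneg (termNorm_nonneg n c k)]

lemma summable_termNorm (n : ℕ) {c : ℝ} (hc : 1 < c) : Summable (termNorm n c) := by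
  have hsum := lseriesSummable_mangoldt n (s := c + (0 : ℝ) * Complex.I) (by rwa [re_add_mul_I])
  refine hsum.norm.congr fun k => ?_
  rw [term_mangoldt_eq, norm_termNorm_mul_exp]

lemma hasSum_lineTransform_mangoldtSeries (n : ℕ) {c : ℝ} (hc : 1 < c) (q a b : ℝ) :
    HasSum (fun k : ℕ => (termNorm n c k : ℂ) *
      ∫ t in a..b, Complex.exp ((q - Real.log k : ℝ) * t * Complex.I))
      (lineTransform (mangoldtSeries (n + 1)) q c a b) := by
  simp only [← intervalIntegral.integral_const_mul]
  refine intervalIntegral.hasSum_integral_of_dominated_convergence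
    (fun k _ => termNorm n c k) (fun k => ?_) (fun k => ae_of_all _ fun t _ => ?_)
    (ae_of_all _ fun t _ => summable_termNorm n hc) intervalIntegrable_const
    (ae_of_all _ fun t _ => ?_)
  · exact Continuous.aestronglyMeasurable (by fun_prop)
  · exact (norm_termNorm_mul_exp n c k _ t).le
  · refine ((lseriesSummable_mangoldt n (s := c + t * Complex.I)
      (by rwa [re_add_mul_I])).hasSum.mul_right (Complex.exp (q * t * Complex.I))).congr_fun
        fun k => ?_
    rw [term_mangoldt_eq, mul_assoc (termNorm n c k : ℂ), ← Complex.exp_add]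
    congr 2
    push_cast
    ring

lemma norm_lineTransform_mangoldtSeries_sub_le (n : ℕ) {c : ℝ} (hc : 1 < c) {q B : ℝ} (k₀ : ℕ)
    (hB₀ : 0 ≤ B) (hB : ∀ k : ℕ, 2 ≤ k → k ≠ k₀ → 2 ≤ B * |q - Real.log k|) (a b : ℝ) :
    ‖lineTransform (mangoldtSeries (n + 1)) q c a b -
      termNorm n c k₀ * ∫ t in a..b, Complex.exp ((q - Real.log k₀ : ℝ) * t * Complex.I)‖ ≤
      B * ∑' k, termNorm n c k := by
  have hdiff := (hasSum_lineTransform_mangoldtSeries n hc q a b).sub (hasSum_ite_eq k₀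
    ((termNorm n c k₀ : ℂ) * ∫ t in a..b, Complex.exp ((q - Real.log k₀ : ℝ) * t * Complex.I)))
  refine hdiff.norm_le_of_bounded ((summable_termNorm n hc).hasSum.mul_left B) fun k => ?_
  have hnonneg := termNorm_nonneg n c k
  split_ifs with hk
  · rw [hk, sub_self, norm_zero]
    exact mul_nonneg hB₀ (hk ▸ hnonneg)
  · rw [sub_zero, norm_mul, Complex.norm_of_nonneg hnonneg, mul_comm]
    rcases lt_or_ge k 2 with hk2 | hk2
    · rw [termNorm_eq_zero n c hk2, mul_zero, mul_zero]
    · have hbound := hB k hk2 hk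
      have hpos : 0 < |q - Real.log k| := pos_of_mul_pos_right (two_pos.trans_le hbound) hB₀
      gcongr
      exact (norm_integral_exp_mul_I_le (abs_pos.mp hpos) a b).trans ((div_le_iff₀ hpos).mpr hbound)

lemma two_le_mul_abs_log_sub_log {m k : ℕ} (hm : m ≠ 0) (hk : k ≠ 0) (hkm : k ≠ m) :
    2 ≤ 4 * m * |Real.log m - Real.log k| := by
  have hm₀ : (1 : ℝ) ≤ m := by exact_mod_cast Nat.one_le_iff_ne_zero.mpr hm
  have hgap : 1 / ((m : ℝ) + 1) ≤ |Real.log m - Real.log k| := by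
    rw [← Nat.cast_succ]
    rcases le_or_gt k (m + 1) with hle | hgt
    · exact one_div_le_abs_log_sub_log hk hm hle m.le_succ hkm
    · have hsucc := one_div_le_abs_log_sub_log m.succ_ne_zero hm le_rfl m.le_succ
        m.succ_ne_self
      have hlog₁ : Real.log m ≤ Real.log (m.succ : ℝ) :=
        Real.log_le_log (by linarith) (by exact_mod_cast m.le_succ)
      have hlog₂ : Real.log (m.succ : ℝ) ≤ Real.log k :=
        Real.log_le_log (by positivity) (by exact_mod_cast hgt.le)
      rw [abs_of_nonpos (by linarith)] at hsucc ⊢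
      linarith
  calc (2 : ℝ) ≤ 4 * m * (1 / (m + 1)) := by
        rw [mul_one_div, le_div_iff₀ (by positivity)]
        linarith
    _ ≤ _ := by gcongr

lemma two_le_mul_abs_neg_log_sub_log {m k : ℕ} (hm : 2 ≤ m) (hk : 2 ≤ k) :
    2 ≤ 4 * m * |-Real.log m - Real.log k| := by
  have hm₂ : (2 : ℝ) ≤ m := by exact_mod_cast hm
  have hlog_m := half_le_log hm₂
  have hlog_k := half_le_log (x := k) (by exact_mod_cast hk)
  rw [abs_of_neg (by linarith)]
  nlinarith

lemma rpow_mul_termNorm (n : ℕ) (c : ℝ) {m : ℕ} (hm : m ≠ 0) :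
    (m : ℝ) ^ (c - 1 / 2) * termNorm n c m = coeff n m := by
  have hm₀ : (0 : ℝ) < m := by positivity
  rw [termNorm, coeff, mul_left_comm, ← Real.rpow_add hm₀,
    show c - 1 / 2 + -c = -(1 / 2) by ring, Real.rpow_neg hm₀.le, ← Real.sqrt_eq_rpow]
  field_simp

lemma coeff_nonneg (n m : ℕ) : 0 ≤ coeff n m :=
  div_nonneg ArithmeticFunction.vonMangoldt_nonneg
    (mul_nonneg (Real.sqrt_nonneg _) (pow_nonneg (Real.log_natCast_nonneg m) _))

lemma coeff_le (n : ℕ) {m : ℕ} (hm : m ≠ 0) : coeff n m ≤ (Real.log 2 ^ n)⁻¹ := by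
  have hdiv : vonMangoldt m / Real.log m ^ (n + 1) ≤ (Real.log 2 ^ n)⁻¹ :=
    ((Complex.norm_real _).symm ▸ Real.le_norm_self _).trans (norm_mangoldt_div_le n m)
  refine le_trans ?_ hdiv
  rw [coeff, ← div_div, div_right_comm]
  exact div_le_self (div_nonneg ArithmeticFunction.vonMangoldt_nonneg
    (pow_nonneg (Real.log_natCast_nonneg m) _))
    (Real.one_le_sqrt.mpr (by exact_mod_cast Nat.one_le_iff_ne_zero.mpr hm))

/-! ### Correlation of `S_n` with an oscillation -/

lemma continuousOn_iterInt_half (hM : IsLogZ M) {n : ℕ} (hn : n ≠ 0) :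
    ContinuousOn (fun t : ℝ => iterInt M n ((1 / 2 : ℝ) + t * Complex.I)) (Set.Ici 0) := by
  obtain ⟨n, rfl⟩ := Nat.exists_eq_succ_of_ne_zero hn
  exact (horAdmissible_iterInt hM n).continuousOn_horInt_vertical le_rfl

lemma intervalIntegrable_Sn (hM : IsLogZ M) {n : ℕ} (hn : n ≠ 0) {a b : ℝ} (ha : 0 ≤ a)
    (hab : a ≤ b) : IntervalIntegrable (Sn n) volume a b := by
  have hcont : ContinuousOn (fun t => 1 / Real.pi * phase M n (1 / 2) t) (Set.Ici 0) :=
    continuousOn_const.mul (Complex.continuous_im.comp_continuousOn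
      (continuousOn_const.mul (continuousOn_iterInt_half hM hn)))
  refine ContinuousOn.intervalIntegrable_of_Icc hab ?_
  exact (hcont.congr fun t ht => Sn_eq_phase hM hn ht).mono fun t ht => ha.trans ht.1

lemma integral_Sn_mul_osc (hM : IsLogZ M) {n : ℕ} (hn : n ≠ 0) {m : ℕ} (hm : m ≠ 0) {a b : ℝ}
    (ha : 0 ≤ a) (hab : a ≤ b) :
    ∫ t in a..b, Sn n t * osc n m t = 1 / Real.pi * (1 / 2 *
      (lineTransform (iterInt M n) (Real.log m) (1 / 2) a b -
        (-1) ^ n * lineTransform (iterInt M n) (-Real.log m) (1 / 2) a b).re) := by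
  have hint : ∀ q : ℝ, IntervalIntegrable (fun t : ℝ => iterInt M n ((1 / 2 : ℝ) + t * Complex.I) *
      Complex.exp (q * t * Complex.I)) volume a b := fun q =>
    (((continuousOn_iterInt_half hM hn).mono fun t ht => ha.trans ht.1).mul
      (by fun_prop)).intervalIntegrable_of_Icc hab
  have hpoint : ∀ t ∈ Set.uIcc a b, Sn n t * osc n m t = 1 / Real.pi * (1 / 2 *
      (iterInt M n ((1 / 2 : ℝ) + t * Complex.I) * Complex.exp ((Real.log m : ℝ) * t * Complex.I) -
        (-1) ^ n * (iterInt M n ((1 / 2 : ℝ) + t * Complex.I) *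
          Complex.exp ((-Real.log m : ℝ) * t * Complex.I))).re) := fun t ht => by
    rw [Set.uIcc_of_le hab] at ht
    rw [Sn_eq_phase hM hn (ha.trans ht.1), osc_eq n hm, mul_assoc, phase, im_I_pow_mul_mul_im,
      conj_exp_ofReal_mul_mul_I, neg_neg]
  rw [intervalIntegral.integral_congr hpoint, intervalIntegral.integral_const_mul,
    intervalIntegral.integral_const_mul, lineTransform, lineTransform]
  congr 2
  rw [← intervalIntegral.integral_const_mul,
    ← intervalIntegral.integral_sub (hint _) ((hint _).const_mul _)]
  exact Complex.reCLM.intervalIntegral_comp_comm ((hint _).sub ((hint _).const_mul _))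

lemma norm_lineTransform_iterInt_sub_le (hM : IsLogZ M) {n : ℕ} (hn : n ≠ 0) {a b c q B : ℝ}
    (hc : 1 < c) (ha : 0 ≤ a) (hab : a ≤ b) (k₀ : ℕ) (hB₀ : 0 ≤ B)
    (hB : ∀ k : ℕ, 2 ≤ k → k ≠ k₀ → 2 ≤ B * |q - Real.log k|) :
    ‖lineTransform (iterInt M n) q (1 / 2) a b - Real.exp (q * (c - 1 / 2)) * (termNorm n c k₀ *
        ∫ t in a..b, Complex.exp ((q - Real.log k₀ : ℝ) * t * Complex.I))‖ ≤
      Real.exp (|q| * (c - 1 / 2)) * (segmentNorm (iterInt M n) (1 / 2) c a +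
        segmentNorm (iterInt M n) (1 / 2) c b + B * ∑' k, termNorm n c k) := by
  have hseries : lineTransform (iterInt M n) q c a b =
      lineTransform (mangoldtSeries (n + 1)) q c a b := by
    refine intervalIntegral.integral_congr fun t ht => ?_
    rw [Set.uIcc_of_le hab] at ht
    exact congrArg (· * _) (iterInt_eq_mangoldtSeries hM n hc (ha.trans ht.1))
  have hshift := norm_lineTransform_sub_le (a := 1 / 2) (b := c) (by linarith) hab
    ((continuousOn_iterInt hM hn).mono fun s hs => ⟨hs.1.1, ha.trans hs.2.1⟩)
    ((horAdmissible_iterInt hM n).differentiableOn.mono fun s hs =>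
      ⟨hs.1.1, ha.trans_lt hs.2.1⟩) q
  rw [hseries] at hshift
  rw [mul_add]
  refine (norm_sub_le_norm_sub_add_norm_sub _ _ _).trans (add_le_add hshift ?_)
  rw [← mul_sub, norm_mul, Complex.norm_of_nonneg (Real.exp_pos _).le]
  gcongr
  · linarith
  · exact le_abs_self q
  · exact norm_lineTransform_mangoldtSeries_sub_le n hc k₀ hB₀ hB a b

lemma exists_norm_lineTransform_iterInt_sub_le (hM : IsLogZ M) {n : ℕ} (hn : n ≠ 0) {c : ℝ}
    (hc : 1 < c) : ∃ K : ℝ, 0 ≤ K ∧ ∀ T : ℝ, 2 ≤ T → ∀ m : ℕ, 2 ≤ m → ∀ q : ℝ, |q| = Real.log m →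
      ∀ k₀ : ℕ, (∀ k : ℕ, 2 ≤ k → k ≠ k₀ → 2 ≤ 4 * m * |q - Real.log k|) →
      ‖lineTransform (iterInt M n) q (1 / 2) 1 T - Real.exp (q * (c - 1 / 2)) *
        (termNorm n c k₀ * ∫ t in (1 : ℝ)..T,
          Complex.exp ((q - Real.log k₀ : ℝ) * t * Complex.I))‖ ≤
        K * (m : ℝ) ^ (c + 1 / 2) * Real.log T := by
  have hc₂ : 1 / 2 ≤ c := by linarith
  obtain ⟨K, hK₀, hK⟩ := exists_segmentNorm_iterInt_le hM hn hc₂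
  set b := segmentNorm (iterInt M n) (1 / 2) c 1
  have hb₀ : 0 ≤ b := segmentNorm_nonneg _ hc₂ 1
  set D := ∑' k, termNorm n c k
  have hD₀ : 0 ≤ D := tsum_nonneg (termNorm_nonneg n c)
  refine ⟨2 * b + K + 8 * D, by positivity, fun T hT m hm q hq k₀ hk₀ => ?_⟩
  have hlog := half_le_log hT
  have hm₁ : (1 : ℝ) ≤ m := by exact_mod_cast (by omega : 1 ≤ m)
  have hpow : (m : ℝ) ^ (c - 1 / 2) * m = (m : ℝ) ^ (c + 1 / 2) := by
    rw [← Real.rpow_add_one (by positivity)]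
    ring_nf
  have hmain := norm_lineTransform_iterInt_sub_le hM hn hc zero_le_one (by linarith : 1 ≤ T) k₀
    (by positivity) hk₀
  rw [hq, ← Real.rpow_def_of_pos (by positivity)] at hmain
  have hb : b ≤ b * (m * (2 * Real.log T)) :=
    le_mul_of_one_le_right hb₀ (one_le_mul_of_one_le_of_one_le hm₁ (by linarith))
  have hK' : segmentNorm (iterInt M n) (1 / 2) c T ≤ m * (K * Real.log T) :=
    (hK T hT).trans (le_mul_of_one_le_left (by positivity) hm₁)
  have hD : 4 * m * D ≤ 4 * m * D * (2 * Real.log T) :=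
    le_mul_of_one_le_right (by positivity) (by linarith)
  calc _ ≤ (m : ℝ) ^ (c - 1 / 2) * (b * (m * (2 * Real.log T)) + m * (K * Real.log T) +
          4 * m * D * (2 * Real.log T)) :=
        hmain.trans (mul_le_mul_of_nonneg_left (add_le_add (add_le_add hb hK') hD) (by positivity))
    _ = (2 * b + K + 8 * D) * ((m : ℝ) ^ (c - 1 / 2) * m) * Real.log T := by ring
    _ = _ := by rw [hpow]

lemma exp_mul_termNorm_mul_integral (n : ℕ) (c : ℝ) {m : ℕ} (hm : m ≠ 0) (a b : ℝ) :
    (Real.exp (Real.log m * (c - 1 / 2)) * (termNorm n c m * ∫ t in a..b,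
      Complex.exp ((Real.log m - Real.log m : ℝ) * t * Complex.I)) : ℂ) =
      ((b - a) * coeff n m : ℝ) := by
  rw [← rpow_mul_termNorm n c hm, Real.rpow_def_of_pos (by positivity)]
  simp only [sub_self, Complex.ofReal_zero, zero_mul, Complex.exp_zero,
    intervalIntegral.integral_const, Complex.real_smul]
  push_cast
  ring

lemma exists_norm_lineTransform_log_sub_le (hM : IsLogZ M) {n : ℕ} (hn : n ≠ 0) {c : ℝ}
    (hc : 1 < c) : ∃ K : ℝ, 0 ≤ K ∧ ∀ T : ℝ, 2 ≤ T → ∀ m : ℕ, 2 ≤ m →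
      ‖lineTransform (iterInt M n) (Real.log m) (1 / 2) 1 T - (T * coeff n m : ℝ)‖ ≤
          K * (m : ℝ) ^ (c + 1 / 2) * Real.log T ∧
        ‖lineTransform (iterInt M n) (-Real.log m) (1 / 2) 1 T‖ ≤
          K * (m : ℝ) ^ (c + 1 / 2) * Real.log T := by
  obtain ⟨K, hK₀, hK⟩ := exists_norm_lineTransform_iterInt_sub_le hM hn hc
  have hκ : 0 ≤ (Real.log 2 ^ n)⁻¹ := by
    have := Real.log_nonneg one_le_two
    positivity
  refine ⟨K + 2 * (Real.log 2 ^ n)⁻¹, by positivity, fun T hT m hm => ?_⟩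
  have hm₀ : m ≠ 0 := by omega
  have hlog := half_le_log hT
  have hpow : 1 ≤ (m : ℝ) ^ (c + 1 / 2) :=
    Real.one_le_rpow (by exact_mod_cast (by omega : 1 ≤ m)) (by linarith)
  have habs : |Real.log m| = Real.log m := abs_of_nonneg (Real.log_natCast_nonneg m)
  have hpos := hK T hT m hm _ habs m fun k hk hkm =>
    two_le_mul_abs_log_sub_log hm₀ (by omega) hkm
  have hneg := hK T hT m hm _ ((abs_neg _).trans habs) 0 fun k hk _ =>
    two_le_mul_abs_neg_log_sub_log hm hk
  rw [exp_mul_termNorm_mul_integral n c hm₀] at hpos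
  rw [termNorm_eq_zero n c two_pos, Complex.ofReal_zero, zero_mul, mul_zero, sub_zero] at hneg
  have hcoeff : ‖(coeff n m : ℂ)‖ ≤
      2 * (Real.log 2 ^ n)⁻¹ * (m : ℝ) ^ (c + 1 / 2) * Real.log T := by
    rw [Complex.norm_of_nonneg (coeff_nonneg n m)]
    calc coeff n m ≤ (Real.log 2 ^ n)⁻¹ := coeff_le n hm₀
      _ ≤ (Real.log 2 ^ n)⁻¹ * ((m : ℝ) ^ (c + 1 / 2) * (2 * Real.log T)) :=
        le_mul_of_one_le_right hκ (one_le_mul_of_one_le_of_one_le hpow (by linarith))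
      _ = _ := by ring
  constructor
  · rw [add_mul, add_mul]
    refine le_trans ?_ ((norm_sub_le _ _).trans (add_le_add hpos hcoeff))
    rw [sub_sub, ← Complex.ofReal_add, sub_one_mul, sub_add_cancel]
  · refine hneg.trans ?_
    gcongr
    linarith

lemma exists_abs_integral_Sn_mul_osc_sub_le (hM : IsLogZ M) {n : ℕ} (hn : n ≠ 0) {c : ℝ}
    (hc : 1 < c) : ∃ K : ℝ, 0 ≤ K ∧ ∀ T : ℝ, 2 ≤ T → ∀ m : ℕ, 2 ≤ m →
      |(∫ t in (1 : ℝ)..T, Sn n t * osc n m t) - T / (2 * Real.pi) * coeff n m| ≤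
        K * (m : ℝ) ^ (c + 1 / 2) * Real.log T := by
  obtain ⟨K, hK₀, hK⟩ := exists_norm_lineTransform_log_sub_le hM hn hc
  refine ⟨K, hK₀, fun T hT m hm => ?_⟩
  obtain ⟨hpos, hneg⟩ := hK T hT m hm
  have hpi : 1 / Real.pi ≤ 1 := (div_le_one Real.pi_pos).mpr (by linarith [Real.pi_gt_three])
  rw [integral_Sn_mul_osc hM hn (by omega) zero_le_one (by linarith)]
  set J₁ := lineTransform (iterInt M n) (Real.log m) (1 / 2) 1 T
  set J₂ := lineTransform (iterInt M n) (-Real.log m) (1 / 2) 1 T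
  have hdiff : 1 / Real.pi * (1 / 2 * (J₁ - (-1) ^ n * J₂).re) - T / (2 * Real.pi) * coeff n m =
      1 / Real.pi * (1 / 2 * (J₁ - (T * coeff n m : ℝ) - (-1) ^ n * J₂).re) := by
    rw [sub_right_comm J₁, Complex.sub_re (J₁ - _), Complex.ofReal_re]
    field_simp
  rw [hdiff, abs_mul, abs_of_pos (one_div_pos.mpr Real.pi_pos)]
  calc _ ≤ 1 * (1 / 2 * (‖J₁ - (T * coeff n m : ℝ)‖ + ‖J₂‖)) := by
        gcongr
        exact abs_half_re_sub_le n _ _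
    _ ≤ _ := by linarith

/-! ### The difference of the moments -/

lemma eventually_rpow_mul_log_le {a : ℝ} (ha : a < 1) (k : ℕ) :
    ∀ᶠ T : ℝ in atTop, T ^ a * Real.log T ≤ T / Real.log T ^ k := by
  have hlittle := (isLittleO_log_rpow_rpow_atTop ((k + 1 : ℕ) : ℝ) (sub_pos.mpr ha)).bound one_pos
  filter_upwards [hlittle, eventually_ge_atTop 2] with T hT hT₂
  have hlog := half_le_log hT₂
  have hT₀ : 0 < T := by linarith
  rw [Real.rpow_natCast, one_mul, Real.norm_of_nonneg (by positivity),
    Real.norm_of_nonneg (by positivity)] at hT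
  rw [le_div_iff₀ (by positivity), mul_assoc, ← pow_succ']
  calc T ^ a * Real.log T ^ (k + 1) ≤ T ^ a * T ^ (1 - a) := by gcongr
    _ = T := by rw [← Real.rpow_add hT₀, add_sub_cancel, Real.rpow_one]

lemma diagonalSum_eq_sub (n : ℕ) (x : ℝ) : diagonalSum n x =
    (∑ m ∈ Finset.Icc 2 ⌊x⌋₊, 2 * (coeff n m ^ 2 * f n (Real.log m / Real.log x))) -
      ∑ m ∈ Finset.Icc 2 ⌊x⌋₊, smoothCoeff n x m ^ 2 := by
  rw [diagonalSum, ← Finset.sum_sub_distrib]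
  refine Finset.sum_congr rfl fun m _ => ?_
  rw [smoothCoeff]
  ring

lemma exists_abs_H_sub_G_sub_le (hM : IsLogZ M) {n : ℕ} (hn : 1 ≤ n) {c : ℝ} (hc : 1 < c) :
    ∃ K : ℝ, 0 ≤ K ∧ ∀ T : ℝ, 2 ≤ T → ∀ x : ℝ, 2 ≤ x →
      |H n x T - G n x T - T / (2 * Real.pi ^ 2) * diagonalSum n x| ≤
        K * (x ^ (c + 1) * Real.log T) + 2 * C n * x ^ 2 := by
  have hn₀ : n ≠ 0 := by omega
  obtain ⟨K, hK₀, hK⟩ := exists_abs_integral_Sn_mul_osc_sub_le hM hn₀ hc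
  refine ⟨K * Real.sqrt (C n), by positivity, fun T hT x hx => ?_⟩
  have hlog := half_le_log hT
  have hx₀ : 0 < x := by linarith
  have hH := abs_H_sub_le hn hx (T := T) (E := K * x ^ (c + 1 / 2) * Real.log T)
    (intervalIntegrable_Sn hM hn₀ zero_le_one (by linarith)) fun m hm => by
      rw [Finset.mem_Icc] at hm
      refine (hK T hT m hm.1).trans ?_
      gcongr
      exact (Nat.cast_le.mpr hm.2).trans (Nat.floor_le hx₀.le)
  have hpow : K * x ^ (c + 1 / 2) * Real.log T * Real.sqrt (x * C n) =
      K * Real.sqrt (C n) * (x ^ (c + 1) * Real.log T) := by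
    rw [Real.sqrt_mul hx₀.le, Real.sqrt_eq_rpow x,
      show c + 1 = (c + 1 / 2) + 1 / 2 by ring, Real.rpow_add hx₀ (c + 1 / 2)]
    ring
  rw [hpow] at hH
  rw [diagonalSum_eq_sub, mul_sub, sub_sub_sub_comm]
  exact (abs_sub _ _).trans (add_le_add hH (abs_G_sub_le hn hx₀.le T))

lemma isBigO_H_sub_G_sub (hM : IsLogZ M) {n : ℕ} (hn : 1 ≤ n) {β : ℝ} (hβ₀ : 0 < β)
    (hβ₁ : β < 1 / 2) (k : ℕ) :
    (fun T => H n (T ^ β) T - G n (T ^ β) T - T / (2 * Real.pi ^ 2) * diagonalSum n (T ^ β))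
      =O[atTop] fun T => T / Real.log T ^ k := by
  have hc : 1 < 1 / (2 * β) := by
    rw [lt_div_iff₀ (by positivity)]
    linarith
  obtain ⟨K, hK₀, hK⟩ := exists_abs_H_sub_G_sub_le hM hn hc
  have hC := C_nonneg hn
  refine Asymptotics.IsBigO.of_bound (K + 2 * C n * 2) ?_
  filter_upwards [eventually_ge_atTop 2, (tendsto_rpow_atTop hβ₀).eventually_ge_atTop 2,
    eventually_rpow_mul_log_le (a := 1 / 2 + β) (by linarith) k,
    eventually_rpow_mul_log_le (a := β * 2) (by linarith) k] with T hT hx hpow₁ hpow₂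
  have hlog := half_le_log hT
  have hT₀ : 0 ≤ T := by linarith
  have hbound := hK T hT _ hx
  have hsq : (T ^ β) ^ 2 ≤ 2 * (T / Real.log T ^ k) := by
    rw [Real.rpow_mul hT₀, Real.rpow_two] at hpow₂
    nlinarith [sq_nonneg (T ^ β)]
  rw [← Real.rpow_mul hT₀,
    show β * (1 / (2 * β) + 1) = 1 / 2 + β by field_simp] at hbound
  rw [Real.norm_eq_abs, Real.norm_of_nonneg (by positivity : 0 ≤ T / Real.log T ^ k), add_mul,
    mul_assoc (2 * C n)]
  exact hbound.trans (by gcongr)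

lemma isBigO_diagonalSum_rpow_sub {n : ℕ} (hn : 1 ≤ n) {β : ℝ} (hβ : 0 < β) :
    (fun T => diagonalSum n (T ^ β) -
      (C n - (A n + 1 / (2 * n)) / (β ^ (2 * n) * Real.log T ^ (2 * n))))
      =O[atTop] fun T => (Real.log T ^ (2 * n + 1))⁻¹ := by
  have hlog : ∀ᶠ T : ℝ in atTop, Real.log (T ^ β) = β * Real.log T := by
    filter_upwards [eventually_gt_atTop 0] with T hT using Real.log_rpow hT β
  have hcomp := (isBigO_diagonalSum_sub hn).comp_tendsto (tendsto_rpow_atTop hβ)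
  refine (hcomp.congr' (g₂ := fun T => (β ^ (2 * n + 1))⁻¹ * (Real.log T ^ (2 * n + 1))⁻¹)
    ?_ ?_).of_const_mul_right
  · filter_upwards [hlog] with T hT
    rw [Function.comp_apply, hT, mul_pow]
  · filter_upwards [hlog] with T hT
    rw [Function.comp_apply, hT, mul_pow, mul_inv]

end ZetaSn

end

theorem mainTheorem5 (n : ℕ) (hn : 1 ≤ n) (β : ℝ) (hβ₀ : 0 < β) (hβ₁ : β < 1 / 2)
    (hRH : RiemannHypothesis) :
    (fun T : ℝ =>
        (ZetaSn.H n (T ^ β) T - ZetaSn.G n (T ^ β) T) -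
          (T / (2 * Real.pi ^ 2) * ZetaSn.C n -
            T / (2 * Real.pi ^ 2 * β ^ (2 * n) * Real.log T ^ (2 * n)) *
              (ZetaSn.A n + 1 / (2 * (n : ℝ)))))
      =O[Filter.atTop] (fun T : ℝ => T / Real.log T ^ (2 * n + 1)) := by
  obtain ⟨M, hM⟩ := ZetaSn.exists_isLogZ hRH
  have hmoments := ZetaSn.isBigO_H_sub_G_sub hM hn hβ₀ hβ₁ (2 * n + 1)
  have hdiagonal : (fun T : ℝ => T / (2 * Real.pi ^ 2) * (ZetaSn.diagonalSum n (T ^ β) -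
      (ZetaSn.C n - (ZetaSn.A n + 1 / (2 * n)) / (β ^ (2 * n) * Real.log T ^ (2 * n)))))
      =O[Filter.atTop] fun T => T / Real.log T ^ (2 * n + 1) := by
    simp only [div_eq_inv_mul _ (2 * Real.pi ^ 2), div_eq_mul_inv _ (Real.log _ ^ (2 * n + 1))]
    exact ((Asymptotics.isBigO_refl _ _).const_mul_left _).mul
      (ZetaSn.isBigO_diagonalSum_rpow_sub hn hβ₀)
  refine (hmoments.add hdiagonal).congr_left fun T => ?_
  rw [mul_assoc (2 * Real.pi ^ 2), ← div_div]
  ring
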